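/- Write $\langle x\rangle=1+|x|$, and for $(\tau,\xi)\in\mathbb R^2$ put $\sigma=\sigma(\tau,\xi)=\tau-\xi^3+\frac1\xi$. For integers $j,k\ge 0$ let $$A_j=\{(\tau,\xi): 2^j\le\langle\xi\rangle<2^{j+1}\},\qquad B_k=\{(\tau,\xi): 2^k\le\langle\sigma\rangle<2^{k+1}\},$$ $$D=\{(\tau,\xi): |\xi|\le \tfrac18,\ |\tau|\ge|\xi|^{-3}\},$$ and let $I_E$ be the indicator function of $E$ and $D^c=\mathbb R^2\setminus D$. For measurable $f:\mathbb R^2\to\mathbb C$ put $$\|f\|_{\hat X^{s,b}}=\|\langle\xi\rangle^s\langle\sigma\rangle^bf\|_{L^2(\mathbb R^2)},\qquad \|f\|_{\hat X^{s,b,1}}=\Big[\sum_{j\ge0}\Big(\sum_{k\ge0}\|\langle\xi\rangle^s\langle\sigma\rangle^bf\|_{L^2(A_j\cap B_k)}\Big)^2\Big]^{1/2},$$ $$\|f\|_{\hat X}=\|I_{D^c}f\|_{\hat X^{-3/4,1/2,1}}+\|I_Df\|_{\hat X^{-3/4,1/2}}\in[0,\infty],\qquad \|h\|_{L^2_\xi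 L^1_\tau}=\Big(\int\Big(\int|h(\tau,\xi)|\,d\tau\Big)^2d\xi\Big)^{1/2}.$$ **Lemma 3.1.** There is an absolute constant $C>0$ such that the following holds. Let $j_1,j_2\ge0$ be integers and let $f,g:\mathbb R^2\to\mathbb C$ be measurable, with $f=0$ a.e. outside $A_{j_1}$ and $g=0$ a.e. outside $A_{j_2}$. If $\|f\|_{\hat X}<\infty$ and $\|g\|_{\hat X}<\infty$, then the integral defining $f*g$ converges absolutely a.e. Moreover, for every integer $j\ge0$, $$\big\|I_{A_j}\langle\sigma\rangle^{-1}\xi\,(f*g)\big\|_{\hat X}\le C\,c(j,j_1,j_2)\,\|f\|_{\hat X}\|g\|_{\hat X},$$ $$\big\|I_{A_j}\langle\xi\rangle^{-3/4}\langle\sigma\rangle^{-1}\xi\,(f*g)\big\|_{L^2_\xi L^1_\tau}\le C\,c(j,j_1,j_2)\,\|f\|_{\hat X}\|g\|_{\hat X}$$ in each of the following cases (if several apply, the bounds hold with each of the corresponding values of $c$): 1. at least two of $j,j_1,j_2$ are less than $30$, with $c=1$; 2. $j_1,j_2\ge30$, $|j_1-j_2|\le10$, $0<j<j_1-9$, with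 $c=2^{-\frac38j}$; 3. $j,j_1\ge30$, $|j-j_1|\le10$, $0<j_2<j-10$, with $c=2^{-\frac14(j-j_2)}$; 4. $j,j_2\ge30$, $|j-j_2|\le10$, $0<j_1<j-10$, with $c=2^{-\frac14(j-j_1)}$; 5. $j,j_1,j_2\ge30$, $|j-j_1|\le10$, $|j-j_2|\le10$, with $c=1$; 6. $j_1,j_2\ge30$, $j=0$, with $c=1$; 7. $j,j_1\ge30$, $j_2=0$, with $c=1$; 8. $j,j_2\ge30$, $j_1=0$, with $c=1$. (If one of the two norms on the right is infinite, the right-hand sides are read with $0\cdot\infty=0$, and $f*g$ is set to $0$ at points where its defining integral does not converge absolutely.) -/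

import Mathlib

open MeasureTheory
open scoped ENNReal

noncomputable section

namespace Ostrovsky

/-! Points of the Fourier side `ℝ²` are written `p = (τ, ξ)`, so `p.1 = τ` and `p.2 = ξ`.
The line `ξ = 0`, where `1 / ξ` is a junk value, is Lebesgue-null. -/

/-- The bracket `⟨x⟩ = 1 + |x|`. -/
def bracket (x : ℝ) : ℝ := 1 + |x|

/-- The modulation `τ - ξ³ + 1/ξ`. -/
def modulation (p : ℝ × ℝ) : ℝ := p.1 - p.2 ^ 3 + 1 / p.2

/-- `A_j = {2^j ≤ ⟨ξ⟩ < 2^(j+1)}`. -/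
def shellA (j : ℕ) : Set (ℝ × ℝ) :=
  {p | (2 : ℝ) ^ j ≤ bracket p.2 ∧ bracket p.2 < (2 : ℝ) ^ (j + 1)}

/-- `B_k = {2^k ≤ ⟨τ - ξ³ + 1/ξ⟩ < 2^(k+1)}`. -/
def shellB (k : ℕ) : Set (ℝ × ℝ) :=
  {p | (2 : ℝ) ^ k ≤ bracket (modulation p) ∧ bracket (modulation p) < (2 : ℝ) ^ (k + 1)}

/-- `D = {|ξ| ≤ 1/8, |τ| ≥ |ξ|⁻³}`. -/
def regionD : Set (ℝ × ℝ) :=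
  {p | |p.2| ≤ 1 / 8 ∧ (|p.2| ^ 3)⁻¹ ≤ |p.1|}

/-- `⟨ξ⟩^s ⟨τ - ξ³ + 1/ξ⟩^b f`. -/
def weighted (s b : ℝ) (f : ℝ × ℝ → ℂ) (p : ℝ × ℝ) : ℂ :=
  ((bracket p.2 ^ s * bracket (modulation p) ^ b : ℝ) : ℂ) * f p

/-- The norm of `X̂^{s,b}`. -/
def normXsb (s b : ℝ) (f : ℝ × ℝ → ℂ) : ℝ≥0∞ :=
  eLpNorm (weighted s b f) 2 volume

/-- The norm of `X̂^{s,b,1}`: the `ℓ²_j(ℓ¹_k)` norm of the weighted `L²(A_j ∩ B_k)` norms. -/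
def normXsb1 (s b : ℝ) (f : ℝ × ℝ → ℂ) : ℝ≥0∞ :=
  (∑' j : ℕ, (∑' k : ℕ,
    eLpNorm (weighted s b f) 2 (volume.restrict (shellA j ∩ shellB k))) ^ 2) ^ (1 / 2 : ℝ)

/-- The norm of `X̂`, with values in `[0, ∞]`. -/
def normX (f : ℝ × ℝ → ℂ) : ℝ≥0∞ :=
  normXsb1 (-3 / 4) (1 / 2) (regionDᶜ.indicator f) +
    normXsb (-3 / 4) (1 / 2) (regionD.indicator f)

/-- The mixed norm of `L²_ξ L¹_τ`. -/
def normL2L1 (h : ℝ × ℝ → ℂ) : ℝ≥0∞ :=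
  (∫⁻ ξ : ℝ, (∫⁻ τ : ℝ, ‖h (τ, ξ)‖ₑ) ^ 2) ^ (1 / 2 : ℝ)

/-- The convolution `f * g` on `ℝ²`. -/
def conv (f g : ℝ × ℝ → ℂ) : ℝ × ℝ → ℂ :=
  convolution f g (ContinuousLinearMap.mul ℝ ℂ) volume

/-- `I_{A_j} ⟨τ - ξ³ + 1/ξ⟩⁻¹ ξ (f * g)`. -/
def localized (j : ℕ) (f g : ℝ × ℝ → ℂ) : ℝ × ℝ → ℂ :=
  (shellA j).indicator fun p =>
    (((bracket (modulation p))⁻¹ * p.2 : ℝ) : ℂ) * conv f g p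

/-- The eight interaction cases: `c` is the size of the constant `C(j, j₁, j₂)` in a case
that the triple `(j, j₁, j₂)` satisfies. -/
def InteractionSize (j j₁ j₂ : ℕ) (c : ℝ) : Prop :=
  -- (i) at least two of the indices are less than 30
  (((j < 30 ∧ j₁ < 30) ∨ (j < 30 ∧ j₂ < 30) ∨ (j₁ < 30 ∧ j₂ < 30)) ∧ c = 1) ∨
  -- (ii)
  (30 ≤ j₁ ∧ 30 ≤ j₂ ∧ |(j₁ : ℤ) - j₂| ≤ 10 ∧ 0 < j ∧ (j : ℤ) < j₁ - 9 ∧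
    c = (2 : ℝ) ^ (-(3 / 8) * (j : ℝ))) ∨
  -- (iii)
  (30 ≤ j ∧ 30 ≤ j₁ ∧ |(j : ℤ) - j₁| ≤ 10 ∧ 0 < j₂ ∧ (j₂ : ℤ) < j - 10 ∧
    c = (2 : ℝ) ^ (-(1 / 4) * ((j : ℝ) - j₂))) ∨
  -- (iv)
  (30 ≤ j ∧ 30 ≤ j₂ ∧ |(j : ℤ) - j₂| ≤ 10 ∧ 0 < j₁ ∧ (j₁ : ℤ) < j - 10 ∧
    c = (2 : ℝ) ^ (-(1 / 4) * ((j : ℝ) - j₁))) ∨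
  -- (v)
  (30 ≤ j ∧ 30 ≤ j₁ ∧ 30 ≤ j₂ ∧ |(j : ℤ) - j₁| ≤ 10 ∧ |(j : ℤ) - j₂| ≤ 10 ∧ c = 1) ∨
  -- (vi)
  (30 ≤ j₁ ∧ 30 ≤ j₂ ∧ j = 0 ∧ c = 1) ∨
  -- (vii)
  (30 ≤ j ∧ 30 ≤ j₁ ∧ j₂ = 0 ∧ c = 1) ∨
  -- (viii)
  (30 ≤ j ∧ 30 ≤ j₂ ∧ j₁ = 0 ∧ c = 1)

end Ostrovsky

end

/-! Only absolute values matter: f and g are replaced by nonnegative majorants F and G. By duality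
(`l2_le_of_forall`, `l2_lconv_le_of_dual`), each piece of the output is tested against a third
function H. This reduces everything to the form ∫ F(p) G(q) H(r) over p + q + r = 0, with the
functions localized to modulations of size 2^a, 2^b, 2^k. The target is always a bound 2^((a+b+k)/2
+ E - γ(k)) times the L² norms. The factors 2^(a/2) and 2^(b/2) belong to the input norms, 2^(k/2)
is cancelled by the output weight, and the gain γ, usually a peak such as min(k, |k - x|)/8, makes
the sum over k converge (`normDual_lconv_le`).

Two mechanisms produce such bounds. The first is resonance (`abs_modulation_sum`): for frequencies
with sum zero, the cubic part and the 1/ξ part of the sum of the modulations have the same sign. The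
largest modulation therefore controls both the product of the frequencies and the quotient of the
sum of their squares by that product. The second is Cauchy-Schwarz (`lintegral_lconv_mul_le`), which
bounds the form by the measure of the set of p that can interact with a given r. That set is a thin
slab in τ over a set of frequencies. The frequencies are confined either by a low-frequency
constraint (`triBound_low`) or by a sublevel set of the phase ξ ↦ ω(ξ) + ω(ξ₀ - ξ), where ω(ξ) = ξ³
- 1/ξ (`triBound_transversal`, `triBound_square`). The usual choice is to apply Cauchy-Schwarz to
the two functions with the smaller modulations and to use resonance for the largest; the
configurations are treated in `HighHighLow` and `triBound_comparable`.

The region D matters only for frequencies below 1. An input in D is controlled merely in ℓ² over the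
modulation shells, so a gain in its own modulation is needed (`triBound_output_high_regionD`); it
comes from |ξ| being bounded below there in terms of the modulation. For a high-high interaction
with output in D, the modulation may follow |ξ| 2^(2n), and then no decay in k away from a fixed
centre is available (`resonantRegion`). On that set only an ℓ² norm is required, so all k are
estimated at once with the weight |ξ|^(1/2) (`l2_output_resonant`). At fixed ξ the modulation there
fills a window of bounded ratio, which also gives the L²L¹ bound. -/

noncomputable section

namespace Ostrovsky

/-! ### Powers of two in `[0, ∞]` -/

/-- The real power `2 ^ x` as an extended nonnegative number. -/
def e2 (x : ℝ) : ℝ≥0∞ := (2 : ℝ≥0∞) ^ x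

lemma e2_add (x y : ℝ) : e2 (x + y) = e2 x * e2 y :=
  ENNReal.rpow_add _ _ (by norm_num) (by norm_num)

lemma e2_mono {x y : ℝ} (h : x ≤ y) : e2 x ≤ e2 y :=
  ENNReal.rpow_le_rpow_of_exponent_le (by norm_num) h

lemma e2_eq_ofReal (x : ℝ) : e2 x = ENNReal.ofReal ((2 : ℝ) ^ x) := by
  rw [e2, ← ENNReal.ofReal_rpow_of_pos (by norm_num)]; norm_num

lemma e2_ne_top (x : ℝ) : e2 x ≠ ∞ := by
  rw [e2_eq_ofReal]; exact ENNReal.ofReal_ne_top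

lemma e2_rpow (x y : ℝ) : e2 x ^ y = e2 (x * y) := (ENNReal.rpow_mul _ _ _).symm

lemma e2_zero : e2 0 = 1 := by simp [e2]

lemma e2_mul_neg (x : ℝ) : e2 x * e2 (-x) = 1 := by
  rw [← e2_add]; simp [e2_zero]

lemma le_e2_mul {x y : ℝ≥0∞} {t : ℝ} (h : e2 (-t) * x ≤ y) : x ≤ e2 t * y := by
  calc x = e2 t * (e2 (-t) * x) := by rw [← mul_assoc, e2_mul_neg, one_mul]
    _ ≤ _ := by gcongr

lemma tsum_e2_neg_nat : ∑' k : ℕ, e2 (-(k : ℝ) / 8) ≤ e2 4 := by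
  have h1 : ∀ k : ℕ, e2 (-(k : ℝ) / 8) = e2 (-1 / 8) ^ k := by
    intro k
    rw [← ENNReal.rpow_natCast, e2_rpow]; congr 1; ring
  simp_rw [h1]
  rw [ENNReal.tsum_geometric]
  -- Since 2^(-1/8) ≤ 15/16, the ratio of the geometric series stays 2^(-4) away from 1, which gives
  -- the bound 2^4.
  have h2 : e2 (-1 / 8) + e2 (-4) ≤ 1 := by
    rw [e2_eq_ofReal, e2_eq_ofReal, ← ENNReal.ofReal_add (by positivity) (by positivity)]
    rw [← ENNReal.ofReal_one]
    apply ENNReal.ofReal_le_ofReal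
    have h3 : (2 : ℝ) ^ (-4 : ℝ) = 1 / 16 := by
      rw [Real.rpow_neg (by norm_num)]; norm_num
    have h4 : (2 : ℝ) ^ (-1 / 8 : ℝ) ≤ 15 / 16 := by
      have h5 : ((2 : ℝ) ^ (-1 / 8 : ℝ)) ^ 8 ≤ (15 / 16) ^ 8 := by
        rw [← Real.rpow_natCast, ← Real.rpow_mul (by norm_num)]
        norm_num [Real.rpow_neg]
      exact le_of_pow_le_pow_left₀ (by norm_num) (by norm_num) h5
    linarith
  have h6 : e2 (-4) ≤ 1 - e2 (-1 / 8) := by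
    apply ENNReal.le_sub_of_add_le_right (e2_ne_top _)
    rw [add_comm]; exact h2
  calc (1 - e2 (-1 / 8))⁻¹ ≤ (e2 (-4))⁻¹ := ENNReal.inv_le_inv.2 h6
    _ = e2 4 := by rw [e2, e2, ENNReal.rpow_neg, inv_inv]

/-- A two-sided exponential peak is summable uniformly in its centre. -/
lemma tsum_e2_peak (x : ℝ) : ∑' k : ℕ, e2 (-|(k : ℝ) - x| / 8) ≤ e2 6 := by
  set m : ℕ := ⌊x⌋₊ with hm
  have hb : ∀ k : ℕ, e2 (-|(k : ℝ) - x| / 8) ≤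
      (if m ≤ k then e2 1 * e2 (-((k - m : ℕ) : ℝ) / 8) else 0) +
      (if k ≤ m then e2 0 * e2 (-((m - k : ℕ) : ℝ) / 8) else 0) := by
    intro k
    rcases le_total m k with h | h
    · rw [if_pos h, ← e2_add]
      refine le_trans (e2_mono ?_) le_self_add
      push_cast [h]
      have h1 : x < m + 1 := Nat.lt_floor_add_one x
      have h2 := neg_abs_le ((k : ℝ) - x)
      have h3 := le_abs_self ((k : ℝ) - x)
      linarith
    · refine le_trans ?_ le_add_self
      rw [if_pos h, ← e2_add]
      refine e2_mono ?_
      push_cast [h]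
      have h2 := neg_abs_le ((k : ℝ) - x)
      -- The natural-number floor of a negative x is 0, so m ≤ x can fail only for m = 0; then k = 0
      -- is the only index left.
      rcases Nat.eq_zero_or_pos m with h0 | h0
      · have : k = 0 := by omega
        subst this
        rw [h0]
        have := abs_nonneg x
        simp only [CharP.cast_eq_zero, zero_sub, abs_neg]
        linarith
      · have h1 : (m : ℝ) ≤ x := Nat.floor_le (by
          by_contra hx
          have := Nat.floor_of_nonpos (le_of_not_ge hx)
          omega)
        linarith
  have s1 : ∑' k : ℕ, (if m ≤ k then e2 1 * e2 (-((k - m : ℕ) : ℝ) / 8) else 0) ≤ e2 5 := by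
    rw [← tsum_subtype_eq_of_support_subset (s := Set.range fun i : ℕ => i + m)]
    · rw [tsum_range (g := fun i : ℕ => i + m)
        (f := fun k => if m ≤ k then e2 1 * e2 (-((k - m : ℕ) : ℝ) / 8) else 0)
        (fun a b h => by simpa using h)]
      simp only [le_add_iff_nonneg_left, zero_le, if_true, Nat.add_sub_cancel]
      rw [ENNReal.tsum_mul_left]
      calc _ ≤ e2 1 * e2 4 := by gcongr; exact tsum_e2_neg_nat
        _ = _ := by rw [← e2_add]; norm_num
    · intro k hk
      have : m ≤ k := by
        by_contra h
        simp [h] at hk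
      exact ⟨k - m, by simp [this]⟩
  have s2 : ∑' k : ℕ, (if k ≤ m then e2 0 * e2 (-((m - k : ℕ) : ℝ) / 8) else 0) ≤ e2 4 := by
    rw [tsum_eq_sum (s := Finset.range (m + 1))]
    · rw [← Finset.sum_range_reflect]
      calc _ ≤ ∑ j ∈ Finset.range (m + 1), e2 (-(j : ℝ) / 8) := by
            apply Finset.sum_le_sum
            intro j hj
            have hj' : j ≤ m := by simpa [Nat.lt_succ_iff] using hj
            rw [if_pos (by omega), e2_zero, one_mul]
            apply le_of_eq
            congr 4
            omega
        _ ≤ _ := (ENNReal.sum_le_tsum _).trans tsum_e2_neg_nat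
    · intro k hk
      have : ¬ k ≤ m := by simpa [Nat.lt_succ_iff] using hk
      simp [this]
  calc _ ≤ _ := ENNReal.tsum_le_tsum hb
    _ ≤ e2 5 + e2 5 := by
      rw [ENNReal.tsum_add]
      exact add_le_add s1 (s2.trans (e2_mono (by norm_num)))
    _ = e2 6 := by
      rw [← two_mul, show (6 : ℝ) = 1 + 5 by norm_num, e2_add]
      congr 1
      simp [e2]

/-! ### The `L²` norm of a `[0, ∞]`-valued function -/

variable {α β : Type*} [MeasurableSpace α] [MeasurableSpace β]

/-- The `L²` norm of a `[0, ∞]`-valued function. -/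
def l2 (μ : Measure α) (F : α → ℝ≥0∞) : ℝ≥0∞ := (∫⁻ p, F p ^ 2 ∂μ) ^ (1 / 2 : ℝ)

lemma l2_sq (μ : Measure α) (F : α → ℝ≥0∞) : l2 μ F ^ 2 = ∫⁻ p, F p ^ 2 ∂μ := by
  rw [l2, ← ENNReal.rpow_natCast, ← ENNReal.rpow_mul]; norm_num

lemma le_of_sq_le_sq {x y : ℝ≥0∞} (h : x ^ 2 ≤ y ^ 2) : x ≤ y :=
  (ENNReal.pow_le_pow_left_iff (by norm_num)).1 h

lemma l2_mono {μ : Measure α} {F G : α → ℝ≥0∞} (h : ∀ p, F p ≤ G p) : l2 μ F ≤ l2 μ G := by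
  apply ENNReal.rpow_le_rpow _ (by norm_num)
  exact lintegral_mono fun p => by gcongr; exact h p

lemma l2_congr {μ : Measure α} {F G : α → ℝ≥0∞} (h : F =ᵐ[μ] G) : l2 μ F = l2 μ G := by
  have : ∫⁻ p, F p ^ 2 ∂μ = ∫⁻ p, G p ^ 2 ∂μ :=
    lintegral_congr_ae (h.mono fun p hp => by simp only [hp])
  rw [l2, l2, this]

lemma l2_const_mul {μ : Measure α} {F : α → ℝ≥0∞} {c : ℝ≥0∞} (hc : c ≠ ∞) :
    l2 μ (fun p => c * F p) = c * l2 μ F := by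
  simp only [l2, mul_pow]
  rw [lintegral_const_mul' _ _ (ENNReal.pow_ne_top hc), ENNReal.mul_rpow_of_nonneg _ _ (by norm_num),
    ← ENNReal.rpow_natCast, ← ENNReal.rpow_mul]
  norm_num

lemma lintegral_mul_le_l2 {μ : Measure α} {F G : α → ℝ≥0∞} (hF : AEMeasurable F μ)
    (hG : AEMeasurable G μ) : ∫⁻ p, F p * G p ∂μ ≤ l2 μ F * l2 μ G := by
  have := ENNReal.lintegral_mul_le_Lp_mul_Lq μ (p := 2) (q := 2)
    (by constructor <;> norm_num) hF hG
  simpa [l2] using this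

/-- Converse of Cauchy-Schwarz: F is tested against its truncations min(F, n) on sets of finite
measure. The truncation is needed because the norm of the test function is divided out and must be
finite. Test functions supported where F is nonzero suffice, so they inherit every localization of
F. -/
lemma l2_le_of_forall {μ : Measure α} [SigmaFinite μ] {F : α → ℝ≥0∞} (hF : Measurable F)
    {K : ℝ≥0∞} (h : ∀ H : α → ℝ≥0∞, Measurable H → (∀ p, H p ≠ 0 → F p ≠ 0) →
      ∫⁻ p, F p * H p ∂μ ≤ K * l2 μ H) :
    l2 μ F ≤ K := by
  let Hn : ℕ → α → ℝ≥0∞ := fun n => (spanningSets μ n).indicator fun p => min (F p) n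
  have hmeas : ∀ n, Measurable (Hn n) := fun n =>
    (hF.min measurable_const).indicator (measurableSet_spanningSets μ n)
  have hle : ∀ n p, Hn n p ≤ F p := by
    intro n p
    by_cases hp : p ∈ spanningSets μ n
    · simp [Hn, hp]
    · simp [Hn, hp]
  have hfin : ∀ n, l2 μ (Hn n) ≠ ∞ := by
    intro n
    have : ∫⁻ p, Hn n p ^ 2 ∂μ ≤ (n : ℝ≥0∞) ^ 2 * μ (spanningSets μ n) := by
      calc _ ≤ ∫⁻ p, (spanningSets μ n).indicator (fun _ => (n : ℝ≥0∞) ^ 2) p ∂μ := by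
            apply lintegral_mono
            intro p
            by_cases hp : p ∈ spanningSets μ n
            · simp only [Hn, Set.indicator_of_mem hp]
              gcongr; exact min_le_right _ _
            · simp [Hn, hp]
        _ = _ := by rw [lintegral_indicator (measurableSet_spanningSets μ n)]; simp
    refine ENNReal.rpow_ne_top_of_nonneg (by norm_num) (ne_top_of_le_ne_top ?_ this)
    exact ENNReal.mul_ne_top (by simp) (measure_spanningSets_lt_top μ n).ne
  have hK : ∀ n, l2 μ (Hn n) ≤ K := by
    intro n
    have h1 : l2 μ (Hn n) * l2 μ (Hn n) ≤ K * l2 μ (Hn n) := by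
      rw [← sq, l2_sq]
      calc _ ≤ ∫⁻ p, F p * Hn n p ∂μ := by
            apply lintegral_mono
            intro p
            simp only [sq]
            gcongr; exact hle n p
        _ ≤ _ := h _ (hmeas n) fun p hp hF0 => hp (le_antisymm (hF0 ▸ hle n p) zero_le)
    rcases eq_or_ne (l2 μ (Hn n)) 0 with h0 | h0
    · rw [h0]; exact zero_le
    · exact (ENNReal.mul_le_mul_iff_left h0 (hfin n)).1 h1
  have hsup : ∀ p, ⨆ n, Hn n p ^ 2 = F p ^ 2 := by
    intro p
    apply le_antisymm
    · exact iSup_le fun n => by gcongr; exact hle n p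
    · have ht : Filter.Tendsto (fun n => Hn n p ^ 2) Filter.atTop (nhds (F p ^ 2)) := by
        apply ENNReal.Tendsto.pow
        have h1 : Filter.Tendsto (fun n : ℕ => min (F p) (n : ℝ≥0∞)) Filter.atTop
            (nhds (min (F p) ∞)) := tendsto_const_nhds.min ENNReal.tendsto_nat_nhds_top
        rw [min_eq_left le_top] at h1
        refine h1.congr' ?_
        filter_upwards [Filter.eventually_ge_atTop (spanningSetsIndex μ p)] with n hn
        have : p ∈ spanningSets μ n :=
          monotone_spanningSets μ hn (mem_spanningSetsIndex μ p)
        simp [Hn, this]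
      exact le_of_tendsto' ht fun n => le_iSup (fun n => Hn n p ^ 2) n
  apply le_of_sq_le_sq
  rw [l2_sq]
  simp_rw [← hsup]
  rw [lintegral_iSup (fun n => (hmeas n).pow_const 2)]
  · exact iSup_le fun n => by rw [← l2_sq]; gcongr; exact hK n
  · intro n m hnm p
    dsimp only
    gcongr
    by_cases hp : p ∈ spanningSets μ n
    · have hp' := monotone_spanningSets μ hnm hp
      simp only [Hn, Set.indicator_of_mem hp, Set.indicator_of_mem hp']
      gcongr
    · simp [Hn, hp]

/-- Minkowski's inequality by duality: against a test function the sum comes out of the integral,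
and Cauchy-Schwarz applies term by term. -/
lemma l2_tsum_le {μ : Measure α} [SigmaFinite μ] {ι : Type*} [Countable ι]
    {F : ι → α → ℝ≥0∞} (hF : ∀ i, Measurable (F i)) :
    l2 μ (fun p => ∑' i, F i p) ≤ ∑' i, l2 μ (F i) := by
  apply l2_le_of_forall (Measurable.tsum hF)
  intro H hH _
  simp_rw [← ENNReal.tsum_mul_right]
  rw [lintegral_tsum fun i => (show Measurable fun p => F i p * H p from (hF i).mul hH).aemeasurable]
  exact ENNReal.tsum_le_tsum fun i => lintegral_mul_le_l2 (hF i).aemeasurable hH.aemeasurable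

lemma l2_add_le {μ : Measure α} [SigmaFinite μ] {F G : α → ℝ≥0∞} (hF : Measurable F)
    (hG : Measurable G) : l2 μ (fun p => F p + G p) ≤ l2 μ F + l2 μ G := by
  apply l2_le_of_forall (show Measurable fun p => F p + G p from hF.add hG)
  intro H hH _
  simp_rw [add_mul]
  rw [lintegral_add_left (show Measurable fun p => F p * H p from hF.mul hH)]
  exact add_le_add (lintegral_mul_le_l2 hF.aemeasurable hH.aemeasurable)
    (lintegral_mul_le_l2 hG.aemeasurable hH.aemeasurable)

end Ostrovsky

end

noncomputable section

namespace Ostrovsky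

/-! ### The trilinear convolution form -/

/-- The convolution of two `[0, ∞]`-valued functions on the plane. -/
def lconv (F G : ℝ × ℝ → ℝ≥0∞) (r : ℝ × ℝ) : ℝ≥0∞ := ∫⁻ p, F p * G (r - p)

/-- The trilinear form `∫ F(p) G(q) H(r)` over `p + q + r = 0`. -/
def triForm (F G H : ℝ × ℝ → ℝ≥0∞) : ℝ≥0∞ := ∫⁻ p, ∫⁻ q, F p * G q * H (-(p + q))

section

variable {F G H W : ℝ × ℝ → ℝ≥0∞}

lemma measurable_lconv (hF : Measurable F) (hG : Measurable G) : Measurable (lconv F G) := by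
  have : Measurable fun z : (ℝ × ℝ) × (ℝ × ℝ) => F z.2 * G (z.1 - z.2) := by fun_prop
  exact this.lintegral_prod_right'

lemma triForm_eq_lconv (hF : Measurable F) (hG : Measurable G) (hH : Measurable H) :
    triForm F G H = ∫⁻ r, lconv F G r * H (-r) := by
  have h1 : ∀ p : ℝ × ℝ, ∫⁻ q, F p * G q * H (-(p + q)) =
      ∫⁻ r, F p * G (r - p) * H (-r) := by
    intro p
    rw [← lintegral_sub_right_eq_self (fun q => F p * G q * H (-(p + q))) p]
    simp
  simp_rw [triForm, h1]
  rw [lintegral_lintegral_swap (by fun_prop)]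
  congr 1; ext r
  rw [lconv, lintegral_mul_const _ (by fun_prop)]

lemma triForm_swap (hF : Measurable F) (hG : Measurable G) (hH : Measurable H) :
    triForm F G H = triForm G F H := by
  rw [triForm, lintegral_lintegral_swap (by fun_prop)]
  simp only [triForm, mul_comm, add_comm]

/-- The substitution q ↦ -(p + q) exchanges the last two points of a triple with sum zero. Together
with `triForm_swap` it gives full symmetry, so Cauchy-Schwarz may be applied to any pair of the
three functions. -/
lemma triForm_rot : triForm F G H = triForm F H G := by
  unfold triForm
  congr 1; ext p
  rw [← lintegral_neg_eq_self, ← lintegral_add_left_eq_self _ p]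
  congr 1; ext q
  rw [show -(p + -(p + q)) = q by abel]
  ring

/-- Cauchy-Schwarz after inserting the indicator of the set of interacting p, on which the integrand
is supported. -/
lemma lconv_sq_le (hF : Measurable F) (hG : Measurable G) (r : ℝ × ℝ) :
    lconv F G r ^ 2 ≤
      volume {p | F p ≠ 0 ∧ G (r - p) ≠ 0} * ∫⁻ p, F p ^ 2 * G (r - p) ^ 2 := by
  set S := {p | F p ≠ 0 ∧ G (r - p) ≠ 0} with hS
  have hSm : MeasurableSet S :=
    (hF (measurableSet_singleton 0).compl).inter
      ((show Measurable fun p => G (r - p) by fun_prop) (measurableSet_singleton 0).compl)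
  have h1 : lconv F G r ≤ l2 volume (S.indicator 1) * l2 volume fun p => F p * G (r - p) := by
    refine le_trans (le_of_eq ?_) (lintegral_mul_le_l2 (measurable_one.indicator hSm).aemeasurable
      (by fun_prop))
    rw [lconv]
    congr 1; ext p
    by_cases hp : p ∈ S
    · simp [hp]
    · simp only [hp, not_false_eq_true, Set.indicator_of_notMem, zero_mul]
      rw [hS, Set.mem_ofPred_eq, not_and_or, not_not, not_not] at hp
      rcases hp with hp | hp <;> simp [hp]
  calc _ ≤ (l2 volume (S.indicator 1) * l2 volume fun p => F p * G (r - p)) ^ 2 := by gcongr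
    _ = _ := by
      rw [mul_pow, l2_sq, l2_sq]
      congr 1
      · rw [← lintegral_indicator_one hSm]
        congr 1; ext p
        by_cases hp : p ∈ S <;> simp [hp]
      · simp_rw [mul_pow]

lemma lintegral_lconv_sq (hF : Measurable F) (hG : Measurable G) :
    ∫⁻ r, ∫⁻ p, F p ^ 2 * G (r - p) ^ 2 = l2 volume F ^ 2 * l2 volume G ^ 2 := by
  rw [lintegral_lintegral_swap (by fun_prop), l2_sq, l2_sq, ← lintegral_mul_const _ (by fun_prop)]
  congr 1; ext p
  rw [lintegral_const_mul _ (by fun_prop), lintegral_sub_right_eq_self (fun q => G q ^ 2) p]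

/-- The Cauchy--Schwarz bound for the weighted trilinear form. -/
lemma lintegral_lconv_mul_le (hF : Measurable F) (hG : Measurable G) (hH : Measurable H)
    (hW : Measurable W) {K : ℝ≥0∞}
    (h : ∀ r, H (-r) ≠ 0 → W r ^ 2 * volume {p | F p ≠ 0 ∧ G (r - p) ≠ 0} ≤ K) :
    ∫⁻ r, lconv F G r * (W r * H (-r)) ≤
      K ^ (1 / 2 : ℝ) * (l2 volume F * l2 volume G * l2 volume H) := by
  have hc := measurable_lconv hF hG
  set S := {r : ℝ × ℝ | H (-r) ≠ 0} with hS
  have hSm : MeasurableSet S :=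
    (show Measurable fun p => H (-p) by fun_prop) (measurableSet_singleton 0).compl
  set U := S.indicator fun r => W r * lconv F G r
  have hU : Measurable U := (hW.mul hc).indicator hSm
  have h1 : ∫⁻ r, lconv F G r * (W r * H (-r)) = ∫⁻ r, U r * H (-r) := by
    congr 1; ext r
    by_cases hr : r ∈ S
    · simp only [U, hr, Set.indicator_of_mem]; ring
    · have : H (-r) = 0 := by simpa [hS] using hr
      simp [this]
  have h2 : l2 volume (fun r => H (-r)) = l2 volume H := by
    rw [l2, l2, lintegral_neg_eq_self fun r => H r ^ 2]
  have h3 : l2 volume U ≤ K ^ (1 / 2 : ℝ) * (l2 volume F * l2 volume G) := by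
    apply le_of_sq_le_sq
    rw [mul_pow, mul_pow, l2_sq volume U, ← lintegral_lconv_sq hF hG,
      ← ENNReal.rpow_natCast, ← ENNReal.rpow_mul]
    norm_num
    calc ∫⁻ r, U r ^ 2 ≤ ∫⁻ r, K * ∫⁻ p, F p ^ 2 * G (r - p) ^ 2 := by
          apply lintegral_mono
          intro r
          by_cases hr : r ∈ S
          · simp only [U, hr, Set.indicator_of_mem, mul_pow]
            calc _ ≤ W r ^ 2 * (volume {p | F p ≠ 0 ∧ G (r - p) ≠ 0} *
                  ∫⁻ p, F p ^ 2 * G (r - p) ^ 2) := by gcongr; exact lconv_sq_le hF hG r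
              _ ≤ _ := by rw [← mul_assoc]; gcongr; exact h r hr
          · simp [U, hr]
      _ = _ := lintegral_const_mul _
        (show Measurable fun z : (ℝ × ℝ) × (ℝ × ℝ) => F z.2 ^ 2 * G (z.1 - z.2) ^ 2 by
          fun_prop).lintegral_prod_right'
  rw [h1]
  calc _ ≤ l2 volume U * l2 volume fun r => H (-r) :=
        lintegral_mul_le_l2 hU.aemeasurable (by fun_prop)
    _ ≤ K ^ (1 / 2 : ℝ) * (l2 volume F * l2 volume G) * l2 volume H := by rw [h2]; gcongr
    _ = _ := by ring

/-- The trilinear form vanishes if the supports do not interact. -/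
lemma triForm_eq_zero (h : ∀ p q r : ℝ × ℝ, p + q + r = 0 → F p ≠ 0 → G q ≠ 0 → H r ≠ 0 → False) :
    triForm F G H = 0 := by
  unfold triForm
  rw [← nonpos_iff_eq_zero]
  refine le_trans (lintegral_mono (g := fun _ => 0) fun p => ?_) (by simp)
  refine le_trans (lintegral_mono (g := fun _ => 0) fun q => ?_) (by simp)
  by_contra hne
  have hne' : F p * G q * H (-(p + q)) ≠ 0 := fun h0 => hne h0.le
  simp only [ne_eq, mul_eq_zero, not_or] at hne'
  exact h p q _ (by abel) hne'.1.1 hne'.1.2 hne'.2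

/-- `P` holds for all interacting triples `p + q + r = 0` in the supports of `F, G, H`. -/
def OnInter (F G H : ℝ × ℝ → ℝ≥0∞) (P : ℝ × ℝ → ℝ × ℝ → ℝ × ℝ → Prop) : Prop :=
  ∀ p q r : ℝ × ℝ, p + q + r = 0 → F p ≠ 0 → G q ≠ 0 → H r ≠ 0 → P p q r

/-- The trilinear form is bounded by `2 ^ E` times the product of the `L²` norms. -/
def TriBound (F G H : ℝ × ℝ → ℝ≥0∞) (E : ℝ) : Prop :=
  triForm F G H ≤ e2 E * (l2 volume F * l2 volume G * l2 volume H)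

lemma TriBound.mono {E E' : ℝ} (h : TriBound F G H E) (hE : E ≤ E') : TriBound F G H E' :=
  le_trans h (by gcongr; exact e2_mono hE)

lemma TriBound.swap {E : ℝ} (hF : Measurable F) (hG : Measurable G) (hH : Measurable H)
    (h : TriBound F G H E) : TriBound G F H E := by
  unfold TriBound at *
  rw [triForm_swap hG hF hH, mul_comm (l2 volume G)]; exact h

lemma TriBound.rot {E : ℝ} (h : TriBound F G H E) : TriBound F H G E := by
  unfold TriBound at *
  rw [triForm_rot, mul_right_comm]; exact h

lemma TriBound.of_false {E : ℝ} (h : OnInter F G H fun _ _ _ => False) : TriBound F G H E := by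
  unfold TriBound
  rw [triForm_eq_zero h]; exact zero_le

lemma OnInter.swap {P : ℝ × ℝ → ℝ × ℝ → ℝ × ℝ → Prop} (h : OnInter F G H P) :
    OnInter G F H fun p q r => P q p r :=
  fun p q r h0 hp hq hr => h q p r (by rw [← h0]; abel) hq hp hr

lemma OnInter.rot {P : ℝ × ℝ → ℝ × ℝ → ℝ × ℝ → Prop} (h : OnInter F G H P) :
    OnInter F H G fun p q r => P p r q :=
  fun p q r h0 hp hq hr => h p r q (by rw [← h0]; abel) hp hr hq

lemma TriBound.of_inter {E : ℝ}
    (h : (∃ p q r : ℝ × ℝ, p + q + r = 0 ∧ F p ≠ 0 ∧ G q ≠ 0 ∧ H r ≠ 0) → TriBound F G H E) :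
    TriBound F G H E := by
  by_cases hex : ∃ p q r : ℝ × ℝ, p + q + r = 0 ∧ F p ≠ 0 ∧ G q ≠ 0 ∧ H r ≠ 0
  · exact h hex
  · exact TriBound.of_false fun p q r h0 hp hq hr => hex ⟨p, q, r, h0, hp, hq, hr⟩

/-- The unweighted Cauchy-Schwarz bound. All unweighted trilinear estimates below are reduced to the
measure of the interaction set; the exponent is halved by the square root. -/
lemma TriBound.of_volume {E : ℝ} (hF : Measurable F) (hG : Measurable G) (hH : Measurable H)
    (h : ∀ r, H (-r) ≠ 0 → volume {p | F p ≠ 0 ∧ G (r - p) ≠ 0} ≤ e2 (2 * E)) :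
    TriBound F G H E := by
  have := lintegral_lconv_mul_le hF hG hH (W := fun _ => 1) measurable_const
    (K := e2 (2 * E)) (by simpa using h)
  rw [e2_rpow] at this
  rw [TriBound, triForm_eq_lconv hF hG hH]
  convert this using 2
  · simp
  · congr 1; ring

end

/-! ### Measure of slabs -/

lemma volume_slab_le {E : Set (ℝ × ℝ)} {T : Set ℝ} {c : ℝ → ℝ} (hc : Measurable c) {ρ : ℝ}
    (h : ∀ p ∈ E, p.2 ∈ T ∧ |p.1 - c p.2| ≤ ρ) :
    volume E ≤ ENNReal.ofReal (2 * ρ) * volume T := by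
  -- T need not be measurable, so it is replaced by a measurable hull of the same measure before
  -- Fubini is applied.
  set T' := toMeasurable volume T
  have hT' : MeasurableSet T' := measurableSet_toMeasurable _ _
  set E' : Set (ℝ × ℝ) := {p | p.2 ∈ T' ∧ |p.1 - c p.2| ≤ ρ}
  have hE' : MeasurableSet E' :=
    (measurable_snd hT').inter (measurableSet_le
      (show Measurable fun p : ℝ × ℝ => |p.1 - c p.2| by fun_prop) measurable_const)
  calc volume E ≤ volume E' :=
        measure_mono fun p hp => ⟨subset_toMeasurable _ _ (h p hp).1, (h p hp).2⟩
    _ = ∫⁻ ξ, volume ((fun τ => (τ, ξ)) ⁻¹' E') := Measure.prod_apply_symm hE'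
    _ ≤ ∫⁻ ξ, T'.indicator (fun _ => ENNReal.ofReal (2 * ρ)) ξ := by
        apply lintegral_mono
        intro ξ
        by_cases hξ : ξ ∈ T'
        · simp only [hξ, Set.indicator_of_mem]
          calc _ ≤ volume (Set.Icc (c ξ - ρ) (c ξ + ρ)) := by
                apply measure_mono
                intro τ hτ
                have := abs_le.1 hτ.2
                simp only at this
                constructor <;> linarith
            _ = _ := by rw [Real.volume_Icc]; congr 1; ring
        · have : (fun τ => (τ, ξ)) ⁻¹' E' = ∅ := by
            ext τ; simp [E', hξ]
          simp [this]
    _ = _ := by rw [lintegral_indicator hT', lintegral_const]; simp [T']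

lemma volume_le_of_forall_dist {T : Set ℝ} {d : ℝ}
    (h : ∀ x ∈ T, ∀ y ∈ T, |x - y| ≤ d) : volume T ≤ ENNReal.ofReal d := by
  refine (Real.volume_le_diam T).trans ?_
  apply Metric.ediam_le
  intro x hx y hy
  rw [edist_dist, Real.dist_eq]
  exact ENNReal.ofReal_le_ofReal (h x hx y hy)

end Ostrovsky

end

noncomputable section

namespace Ostrovsky

/-! ### The resonance identity -/

/-- The sum of the modulations of a triple with `p + q + r = 0` is
`-(3abc + (a² + b² + c²) / (2abc))`, where `a, b, c` are the frequencies. -/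
lemma abs_modulation_sum {p q r : ℝ × ℝ} (h : p + q + r = 0) (hp : p.2 ≠ 0) (hq : q.2 ≠ 0)
    (hr : r.2 ≠ 0) :
    |modulation p + modulation q + modulation r| = 3 * |p.2 * q.2 * r.2| +
      (p.2 ^ 2 + q.2 ^ 2 + r.2 ^ 2) / (2 * |p.2 * q.2 * r.2|) := by
  obtain ⟨t₁, a⟩ := p
  obtain ⟨t₂, b⟩ := q
  obtain ⟨t₃, c⟩ := r
  simp only [Prod.mk_add_mk, Prod.mk_eq_zero] at h
  simp only at hp hq hr
  have e : modulation (t₁, a) + modulation (t₂, b) + modulation (t₃, c) =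
      -(3 * (a * b * c) + (a ^ 2 + b ^ 2 + c ^ 2) / (2 * (a * b * c))) := by
    have ht : t₃ = -(t₁ + t₂) := by linarith
    have hc : c = -(a + b) := by linarith
    have hab : a + b ≠ 0 := fun h0 => hr (by rw [hc, h0, neg_zero])
    simp only [modulation, ht, hc]
    field_simp
    ring
  simp only
  rw [e, abs_neg]
  rcases lt_or_gt_of_ne (mul_ne_zero (mul_ne_zero hp hq) hr) with hn | hn
  · rw [abs_of_neg hn, abs_of_nonpos]
    · rw [mul_neg, mul_neg, div_neg]; ring
    · have : (a ^ 2 + b ^ 2 + c ^ 2) / (2 * (a * b * c)) ≤ 0 :=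
        div_nonpos_of_nonneg_of_nonpos (by positivity) (by linarith)
      linarith
  · rw [abs_of_pos hn, abs_of_pos]
    have : 0 ≤ (a ^ 2 + b ^ 2 + c ^ 2) / (2 * (a * b * c)) := by positivity
    linarith

/-- The two terms in the identity for the sum of the modulations are nonnegative, so each is
separately at most 3M. The first inequality comes from the cubic part of the dispersion, the second
from the 1/ξ part. -/
lemma resonance_upper {p q r : ℝ × ℝ} {M : ℝ} (h : p + q + r = 0) (hp : p.2 ≠ 0) (hq : q.2 ≠ 0)
    (hr : r.2 ≠ 0) (mp : |modulation p| ≤ M) (mq : |modulation q| ≤ M)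
    (mr : |modulation r| ≤ M) :
    |p.2 * q.2 * r.2| ≤ M ∧
      p.2 ^ 2 + q.2 ^ 2 + r.2 ^ 2 ≤ 6 * M * |p.2 * q.2 * r.2| := by
  have e := abs_modulation_sum h hp hq hr
  have h1 : |modulation p + modulation q + modulation r| ≤ 3 * M := by
    have := abs_add_three (modulation p) (modulation q) (modulation r)
    linarith
  rw [e] at h1
  have hpos : 0 < |p.2 * q.2 * r.2| := abs_pos.2 (mul_ne_zero (mul_ne_zero hp hq) hr)
  have h2 : 0 ≤ (p.2 ^ 2 + q.2 ^ 2 + r.2 ^ 2) / (2 * |p.2 * q.2 * r.2|) := by positivity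
  constructor
  · linarith
  · have h3 : (p.2 ^ 2 + q.2 ^ 2 + r.2 ^ 2) / (2 * |p.2 * q.2 * r.2|) ≤ 3 * M := by linarith
    rw [div_le_iff₀ (by positivity)] at h3
    linarith

/-- The same identity used in the other direction: a modulation that dominates the other two must be
supplied by the resonance terms, which later bounds a low frequency from below. -/
lemma resonance_lower {p q r : ℝ × ℝ} (h : p + q + r = 0) (hp : p.2 ≠ 0) (hq : q.2 ≠ 0)
    (hr : r.2 ≠ 0) :
    |modulation r| ≤ |modulation p| + |modulation q| + 3 * |p.2 * q.2 * r.2| +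
      (p.2 ^ 2 + q.2 ^ 2 + r.2 ^ 2) / (2 * |p.2 * q.2 * r.2|) := by
  have e := abs_modulation_sum h hp hq hr
  have h1 : |modulation r| ≤
      |modulation p + modulation q + modulation r| + |modulation p| + |modulation q| := by
    calc |modulation r| = |(modulation p + modulation q + modulation r) + -modulation p +
          -modulation q| := by congr 1; ring
      _ ≤ _ := by
        refine (abs_add_three _ _ _).trans ?_
        rw [abs_neg, abs_neg]
  linarith

/-! ### Sublevel sets of the phase -/

/-- The dispersion relation `ξ³ - 1/ξ`. -/
def dispersion (x : ℝ) : ℝ := x ^ 3 - 1 / x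

lemma measurable_dispersion : Measurable dispersion := by
  unfold dispersion; fun_prop

lemma measurable_modulation : Measurable modulation := by
  unfold modulation; fun_prop

lemma modulation_eq (p : ℝ × ℝ) : modulation p = p.1 - dispersion p.2 := by
  simp only [modulation, dispersion]; ring

/-- The phase x ↦ ω(x) + ω(ξ - x) is invariant under x ↦ ξ - x, so its difference at x and y is
divisible by both x - y and ξ - x - y. -/
lemma phase_sub {ξ x y : ℝ} (hx : x * (ξ - x) ≠ 0) (hy : y * (ξ - y) ≠ 0) :
    dispersion x + dispersion (ξ - x) - (dispersion y + dispersion (ξ - y)) =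
      -(ξ * (x - y) * (ξ - x - y) * (3 - 1 / (x * (ξ - x) * (y * (ξ - y))))) := by
  have h1 := left_ne_zero_of_mul hx
  have h2 := right_ne_zero_of_mul hx
  have h3 := left_ne_zero_of_mul hy
  have h4 := right_ne_zero_of_mul hy
  simp only [dispersion]
  field_simp
  ring

/-- When both products of frequencies are at least 1 in size, the correction from 1/ξ is at most 1
and the last factor of `phase_sub` is at least 3 - 1 = 2. -/
lemma phase_sub_lower {ξ x y : ℝ} (hx : 1 ≤ |x * (ξ - x)|) (hy : 1 ≤ |y * (ξ - y)|) :
    2 * (|ξ| * |x - y| * |ξ - x - y|) ≤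
      |dispersion x + dispersion (ξ - x) - (dispersion y + dispersion (ξ - y))| := by
  have hx0 : x * (ξ - x) ≠ 0 := fun h => by norm_num [h] at hx
  have hy0 : y * (ξ - y) ≠ 0 := fun h => by norm_num [h] at hy
  rw [phase_sub hx0 hy0, abs_neg, abs_mul, abs_mul, abs_mul, mul_comm 2]
  gcongr
  have h1 : |1 / (x * (ξ - x) * (y * (ξ - y)))| ≤ 1 := by
    rw [abs_div, abs_one, abs_mul]
    exact div_le_one_of_le₀ (by nlinarith) (by positivity)
  have h2 := abs_le.1 h1
  exact le_trans (by linarith) (le_abs_self _)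

/-- The set is cut at the critical point x = ξ/2. On either half |ξ - 2x| + |ξ - 2y| = 2|ξ - x - y|,
so the lower bound for the phase difference makes the diameter of each half at most R / L. -/
lemma volume_phase_le {ξ τ L R : ℝ} (hL : 0 < L) :
    volume {x : ℝ | 1 ≤ |x * (ξ - x)| ∧ L ≤ |ξ| * |ξ - 2 * x| ∧
      |dispersion x + dispersion (ξ - x) - τ| ≤ R} ≤ ENNReal.ofReal (2 * (R / L)) := by
  set T := {x : ℝ | 1 ≤ |x * (ξ - x)| ∧ L ≤ |ξ| * |ξ - 2 * x| ∧
      |dispersion x + dispersion (ξ - x) - τ| ≤ R} with hT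
  rcases lt_or_ge R 0 with hR | hR
  · have : T = ∅ := by
      ext x
      simp only [hT, Set.mem_ofPred_eq, Set.mem_empty_iff_false, iff_false, not_and, not_le]
      intro _ _
      exact hR.trans_le (abs_nonneg _)
    rw [this]; simp
  have key : ∀ x ∈ T, ∀ y ∈ T, |ξ - 2 * x| + |ξ - 2 * y| = 2 * |ξ - x - y| →
      |x - y| ≤ R / L := by
    intro x hx y hy hxy
    have h1 := phase_sub_lower hx.1 hy.1
    have h2 : |dispersion x + dispersion (ξ - x) - (dispersion y + dispersion (ξ - y))| ≤
        2 * R := by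
      have a := abs_le.1 hx.2.2
      have b := abs_le.1 hy.2.2
      rw [abs_le]; constructor <;> linarith
    rw [le_div_iff₀ hL]
    have h3 : L ≤ |ξ| * |ξ - x - y| := by
      have := hx.2.1
      have := hy.2.1
      have h4 : |ξ| * (|ξ - 2 * x| + |ξ - 2 * y|) = |ξ| * (2 * |ξ - x - y|) := by rw [hxy]
      linarith
    have h5 := mul_le_mul_of_nonneg_left h3 (abs_nonneg (x - y))
    linarith
  have hsub : T ⊆ {x ∈ T | 0 ≤ ξ - 2 * x} ∪ {x ∈ T | ξ - 2 * x ≤ 0} := by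
    intro x hx
    rcases le_total 0 (ξ - 2 * x) with h | h
    · exact Or.inl ⟨hx, h⟩
    · exact Or.inr ⟨hx, h⟩
  calc volume T ≤ _ := (measure_mono hsub).trans (measure_union_le _ _)
    _ ≤ ENNReal.ofReal (R / L) + ENNReal.ofReal (R / L) := by
      apply add_le_add
      · apply volume_le_of_forall_dist
        intro x hx y hy
        refine key x hx.1 y hy.1 ?_
        have h1 := hx.2
        have h2 := hy.2
        rw [abs_of_nonneg h1, abs_of_nonneg h2, abs_of_nonneg (by linarith)]; ring
      · apply volume_le_of_forall_dist
        intro x hx y hy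
        refine key x hx.1 y hy.1 ?_
        have h1 := hx.2
        have h2 := hy.2
        rw [abs_of_nonpos h1, abs_of_nonpos h2, abs_of_nonpos (by linarith)]; ring
    _ = _ := by
      rw [← ENNReal.ofReal_add (by positivity) (by positivity)]; congr 1; ring

/-- No distance from the critical point is assumed. For one fixed y in the set, every other x
satisfies |x - y| |ξ - x - y| ≤ R / L, hence lies within √(R / L) of y or of its mirror image ξ - y.
-/
lemma volume_phase_le_sqrt {ξ τ L R : ℝ} (hL : 0 < L) (hξ : L ≤ |ξ|) :
    volume {x : ℝ | 1 ≤ |x * (ξ - x)| ∧ |dispersion x + dispersion (ξ - x) - τ| ≤ R} ≤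
      ENNReal.ofReal (4 * √(R / L)) := by
  set T := {x : ℝ | 1 ≤ |x * (ξ - x)| ∧ |dispersion x + dispersion (ξ - x) - τ| ≤ R} with hT
  rcases T.eq_empty_or_nonempty with h0 | ⟨y, hy⟩
  · rw [h0]; simp
  have hR : 0 ≤ R := (abs_nonneg _).trans hy.2
  set s := √(R / L)
  have hs : 0 ≤ s := Real.sqrt_nonneg _
  have hs2 : s * s = R / L := Real.mul_self_sqrt (by positivity)
  have hsub : T ⊆ Set.Icc (y - s) (y + s) ∪ Set.Icc (ξ - y - s) (ξ - y + s) := by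
    intro x hx
    have h1 := phase_sub_lower hx.1 hy.1
    have h2 : |dispersion x + dispersion (ξ - x) - (dispersion y + dispersion (ξ - y))| ≤
        2 * R := by
      have a := abs_le.1 hx.2
      have b := abs_le.1 hy.2
      rw [abs_le]; constructor <;> linarith
    have h3 : L * (|x - y| * |ξ - x - y|) ≤ R := by
      have : L * (|x - y| * |ξ - x - y|) ≤ |ξ| * (|x - y| * |ξ - x - y|) := by gcongr
      linarith
    by_contra hcon
    simp only [Set.mem_union, Set.mem_Icc, not_or] at hcon
    have c1 : s < |x - y| := by
      by_contra hc
      have := abs_le.1 (not_lt.1 hc)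
      exact hcon.1 ⟨by linarith, by linarith⟩
    have c2 : s < |ξ - x - y| := by
      by_contra hc
      have := abs_le.1 (not_lt.1 hc)
      exact hcon.2 ⟨by linarith, by linarith⟩
    have c3 : s * s < |x - y| * |ξ - x - y| := mul_lt_mul'' c1 c2 hs hs
    rw [hs2, div_lt_iff₀ hL] at c3
    linarith
  calc volume T ≤ _ := (measure_mono hsub).trans (measure_union_le _ _)
    _ = _ := by
      rw [Real.volume_Icc, Real.volume_Icc, ← ENNReal.ofReal_add (by linarith) (by linarith)]
      congr 1; ring

/-! ### Trilinear bounds -/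

/-- `F` is supported in modulations at most `2 ^ (k + 1)`. -/
def ModLE (F : ℝ × ℝ → ℝ≥0∞) (k : ℝ) : Prop :=
  ∀ p, F p ≠ 0 → |modulation p| ≤ (2 : ℝ) ^ (k + 1)

variable {F G H : ℝ × ℝ → ℝ≥0∞} {k k₁ k₂ k₃ m n l : ℝ}

lemma ofReal_two_mul (x : ℝ) : ENNReal.ofReal (2 * (2 : ℝ) ^ x) = e2 (1 + x) := by
  rw [e2_eq_ofReal, Real.rpow_add (by norm_num), Real.rpow_one]

lemma volume_inter_le (hF : ModLE F k) {T : Set ℝ} {r : ℝ × ℝ}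
    (hT : ∀ p, F p ≠ 0 → G (r - p) ≠ 0 → p.2 ∈ T) :
    volume {p | F p ≠ 0 ∧ G (r - p) ≠ 0} ≤ e2 (k + 2) * volume T := by
  have := volume_slab_le (E := {p | F p ≠ 0 ∧ G (r - p) ≠ 0}) (T := T) (c := dispersion)
    measurable_dispersion (ρ := (2 : ℝ) ^ (k + 1))
    fun p hp => ⟨hT p hp.1 hp.2, by rw [← modulation_eq]; exact hF p hp.1⟩
  rw [ofReal_two_mul] at this
  convert this using 3
  ring

lemma volume_inter_le' (hG : ModLE G k) {T : Set ℝ} {r : ℝ × ℝ}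
    (hT : ∀ p, F p ≠ 0 → G (r - p) ≠ 0 → p.2 ∈ T) :
    volume {p | F p ≠ 0 ∧ G (r - p) ≠ 0} ≤ e2 (k + 2) * volume T := by
  have := volume_slab_le (E := {p | F p ≠ 0 ∧ G (r - p) ≠ 0}) (T := T)
    (c := fun x => r.1 - dispersion (r.2 - x))
    (measurable_const.sub (measurable_dispersion.comp (measurable_const.sub measurable_id)))
    (ρ := (2 : ℝ) ^ (k + 1))
    fun p hp => ⟨hT p hp.1 hp.2, by
      have := hG _ hp.2
      rw [modulation_eq] at this
      rw [abs_sub_comm]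
      convert this using 2
      simp only [Prod.fst_sub, Prod.snd_sub]
      ring⟩
  rw [ofReal_two_mul] at this
  convert this using 3
  ring

lemma triBound_low_other (hF : Measurable F) (hG : Measurable G) (hH : Measurable H)
    (hk : ModLE F k) (hm : OnInter F G H fun _ q _ => |q.2| ≤ (2 : ℝ) ^ m) :
    TriBound F G H ((m + k) / 2 + 2) := by
  apply TriBound.of_volume hF hG hH
  intro r hr
  refine (volume_inter_le hk (T := Set.Icc (r.2 - 2 ^ m) (r.2 + 2 ^ m)) ?_).trans ?_
  · intro p hp hq
    have := abs_le.1 (hm p (r - p) (-r) (by abel) hp hq hr)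
    simp only [Prod.snd_sub] at this
    constructor <;> linarith
  · rw [Real.volume_Icc, show r.2 + (2 : ℝ) ^ m - (r.2 - 2 ^ m) = 2 * 2 ^ m by ring,
      ofReal_two_mul, ← e2_add]
    exact e2_mono (by linarith)

lemma triBound_low_same (hF : Measurable F) (hG : Measurable G) (hH : Measurable H)
    (hk : ModLE F k) (hm : OnInter F G H fun p _ _ => |p.2| ≤ (2 : ℝ) ^ m) :
    TriBound F G H ((m + k) / 2 + 2) := by
  apply TriBound.of_volume hF hG hH
  intro r hr
  refine (volume_inter_le hk (T := Set.Icc (-2 ^ m) (2 ^ m)) ?_).trans ?_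
  · intro p hp hq
    exact abs_le.1 (hm p (r - p) (-r) (by abel) hp hq hr)
  · rw [Real.volume_Icc, show (2 : ℝ) ^ m - (-2 ^ m) = 2 * 2 ^ m by ring,
      ofReal_two_mul, ← e2_add]
    exact e2_mono (by linarith)

/-- If the third frequency is at most `2 ^ m` and one of the modulations is at most `2 ^ k`, then
the form is bounded by `2 ^ ((m + k) / 2)`. -/
lemma triBound_low (hF : Measurable F) (hG : Measurable G) (hH : Measurable H)
    (hm : OnInter F G H fun _ _ r => |r.2| ≤ (2 : ℝ) ^ m)
    (hk : ModLE F k ∨ ModLE G k ∨ ModLE H k) :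
    TriBound F G H ((m + k) / 2 + 2) := by
  rcases hk with hk | hk | hk
  · exact (triBound_low_other hF hH hG hk hm.rot).rot
  · exact ((triBound_low_other hG hH hF hk hm.swap.rot).rot).swap hG hF hH
  · exact ((triBound_low_same hH hF hG hk hm.rot.swap).swap hH hF hG).rot

/-- The smaller modulation gives the thickness of the slab in τ. Adding the two modulation
constraints eliminates τ and places the frequency in a sublevel set of the phase, at a height given
by the larger one. -/
lemma volume_bilinear_le {r : ℝ × ℝ} (h₁ : ModLE F k₁) (h₂ : ModLE G k₂) {e : ℝ}
    {A : ℝ → Prop} (hA : ∀ p, F p ≠ 0 → G (r - p) ≠ 0 → A p.2)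
    (hT : volume {x : ℝ | A x ∧
      |dispersion x + dispersion (r.2 - x) - r.1| ≤ (2 : ℝ) ^ (max k₁ k₂ + 2)} ≤ e2 e) :
    volume {p | F p ≠ 0 ∧ G (r - p) ≠ 0} ≤ e2 (min k₁ k₂ + 2 + e) := by
  have hmem : ∀ p, F p ≠ 0 → G (r - p) ≠ 0 → p.2 ∈ {x : ℝ | A x ∧
      |dispersion x + dispersion (r.2 - x) - r.1| ≤ (2 : ℝ) ^ (max k₁ k₂ + 2)} := by
    intro p hp hq
    refine ⟨hA p hp hq, ?_⟩
    have a := h₁ p hp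
    have b := h₂ _ hq
    rw [modulation_eq] at a b
    simp only [Prod.fst_sub, Prod.snd_sub] at b
    have a' : (2 : ℝ) ^ (k₁ + 1) ≤ 2 ^ (max k₁ k₂ + 1) :=
      Real.rpow_le_rpow_of_exponent_le (by norm_num) (by linarith [le_max_left k₁ k₂])
    have b' : (2 : ℝ) ^ (k₂ + 1) ≤ 2 ^ (max k₁ k₂ + 1) :=
      Real.rpow_le_rpow_of_exponent_le (by norm_num) (by linarith [le_max_right k₁ k₂])
    have e : (2 : ℝ) ^ (max k₁ k₂ + 2) = 2 * 2 ^ (max k₁ k₂ + 1) := by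
      rw [show max k₁ k₂ + 2 = 1 + (max k₁ k₂ + 1) by ring, Real.rpow_add (by norm_num),
        Real.rpow_one]
    rw [e]
    have a'' := abs_le.1 (a.trans a')
    have b'' := abs_le.1 (b.trans b')
    rw [abs_le]
    constructor <;> linarith
  rw [e2_add]
  rcases le_total k₁ k₂ with h | h
  · rw [min_eq_left h]
    exact (volume_inter_le h₁ hmem).trans (by gcongr)
  · rw [min_eq_right h]
    exact (volume_inter_le' h₂ hmem).trans (by gcongr)

/-- L is kept as a real parameter that may depend on r, whence the logarithm: in
`Dyadic.bound_resonant` it is proportional to |r.2|, and this factor is cancelled by the weight. -/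
lemma volume_transversal_le {r : ℝ × ℝ} {L : ℝ} (hL : 0 < L) (h₁ : ModLE F k₁)
    (h₂ : ModLE G k₂)
    (hA : ∀ p, F p ≠ 0 → G (r - p) ≠ 0 →
      1 ≤ |p.2 * (r.2 - p.2)| ∧ L ≤ |r.2| * |r.2 - 2 * p.2|) :
    volume {p | F p ≠ 0 ∧ G (r - p) ≠ 0} ≤ e2 (k₁ + k₂ + 5 - Real.logb 2 L) := by
  have := volume_bilinear_le (r := r) h₁ h₂ (e := max k₁ k₂ + 3 - Real.logb 2 L)
    (A := fun x => 1 ≤ |x * (r.2 - x)| ∧ L ≤ |r.2| * |r.2 - 2 * x|) hA ?_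
  · convert this using 2
    have := min_add_max k₁ k₂
    linarith
  · simp only [and_assoc]
    refine (volume_phase_le hL).trans (le_of_eq ?_)
    rw [e2_eq_ofReal, Real.rpow_sub (by norm_num), Real.rpow_logb (by norm_num) (by norm_num) hL,
      show max k₁ k₂ + 3 = 1 + (max k₁ k₂ + 2) by ring,
      Real.rpow_add (by norm_num) 1 (max k₁ k₂ + 2), Real.rpow_one]
    congr 1; ring

/-- The transversal bilinear estimate. -/
lemma triBound_transversal (hF : Measurable F) (hG : Measurable G) (hH : Measurable H)
    (h₁ : ModLE F k₁) (h₂ : ModLE G k₂)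
    (h : OnInter F G H fun p q r => 1 ≤ |p.2 * q.2| ∧ (2 : ℝ) ^ l ≤ |r.2| * |p.2 - q.2|) :
    TriBound F G H ((k₁ + k₂ - l) / 2 + 3) := by
  apply TriBound.of_volume hF hG hH
  intro r hr
  refine (volume_transversal_le (L := (2 : ℝ) ^ l) (by positivity) h₁ h₂ ?_).trans ?_
  · intro p hp hq
    have := h p (r - p) (-r) (by abel) hp hq hr
    simp only [Prod.snd_sub, Prod.snd_neg, abs_neg] at this
    rw [abs_sub_comm r.2 (2 * p.2), show 2 * p.2 - r.2 = p.2 - (r.2 - p.2) by ring]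
    exact this
  · rw [Real.logb_rpow (by norm_num) (by norm_num)]
    exact e2_mono (by linarith)

/-- The bilinear estimate that allows for coinciding group velocities. -/
lemma triBound_square (hF : Measurable F) (hG : Measurable G) (hH : Measurable H)
    (h₁ : ModLE F k₁) (h₂ : ModLE G k₂)
    (h : OnInter F G H fun p q r => 1 ≤ |p.2 * q.2| ∧ (2 : ℝ) ^ n ≤ |r.2|) :
    TriBound F G H (min k₁ k₂ / 2 + max k₁ k₂ / 4 - n / 4 + 3) := by
  apply TriBound.of_inter
  rintro -
  apply TriBound.of_volume hF hG hH
  intro r hr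
  -- The lower bound on |r.2| is known only for interacting triples, so one interacting p has to be
  -- produced before the phase estimate can be used.
  by_cases hex : ∃ p, F p ≠ 0 ∧ G (r - p) ≠ 0
  · obtain ⟨p₀, hp₀, hq₀⟩ := hex
    have hn := (h p₀ (r - p₀) (-r) (by abel) hp₀ hq₀ hr).2
    rw [Prod.snd_neg, abs_neg] at hn
    refine (volume_bilinear_le (r := r) h₁ h₂ (e := (max k₁ k₂ + 2 - n) / 2 + 2)
      (A := fun x => 1 ≤ |x * (r.2 - x)|) ?_ ?_).trans ?_
    · intro p hp hq
      exact (h p (r - p) (-r) (by abel) hp hq hr).1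
    · refine (volume_phase_le_sqrt (L := (2 : ℝ) ^ n) (by positivity) hn).trans (le_of_eq ?_)
      rw [e2_eq_ofReal, ← Real.rpow_sub (by norm_num), Real.sqrt_eq_rpow,
        ← Real.rpow_mul (by norm_num), Real.rpow_add (by norm_num)]
      congr 1
      norm_num
      rw [mul_comm]; congr 2; ring
    · exact e2_mono (by linarith)
  · have : {p | F p ≠ 0 ∧ G (r - p) ≠ 0} = ∅ := by
      ext p
      simp only [Set.mem_ofPred_eq, Set.mem_empty_iff_false, iff_false]
      exact fun hp => hex ⟨p, hp⟩
    rw [this]; simp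

end Ostrovsky

end

noncomputable section

namespace Ostrovsky

/-! ### Frequencies inside and outside the exceptional region -/

/-- With y = 1/|ξ| ≥ 8, the terms |ξ|³ and y are negligible against |τ| ≥ y³. So the modulation is
at least y³ / 2, which bounds y from above. -/
lemma freq_ge_of_mem_regionD {r : ℝ × ℝ} {k : ℝ} (hr : r ∈ regionD) (h0 : r.2 ≠ 0)
    (hk : |modulation r| ≤ (2 : ℝ) ^ (k + 1)) : (2 : ℝ) ^ (-(k + 2) / 3) ≤ |r.2| := by
  obtain ⟨τ, ξ⟩ := r
  obtain ⟨h1, h2⟩ := hr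
  simp only at h0 h1 h2 ⊢
  have hpos : 0 < |ξ| := abs_pos.2 h0
  set y := |ξ|⁻¹ with hy
  have hy8 : 8 ≤ y := by
    rw [hy]
    calc (8 : ℝ) = (1 / 8)⁻¹ := by norm_num
      _ ≤ _ := inv_anti₀ hpos h1
  have hτ : |τ| ≤ |modulation (τ, ξ)| + |ξ| ^ 3 + y := by
    calc |τ| = |modulation (τ, ξ) + ξ ^ 3 + -(1 / ξ)| := by
          congr 1; simp only [modulation]; ring
      _ ≤ _ := by
        refine (abs_add_three _ _ _).trans ?_
        rw [abs_neg, abs_div, abs_one, abs_pow, one_div]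
  have hξ3 : |ξ| ^ 3 ≤ 1 := pow_le_one₀ hpos.le (by linarith)
  have e3 : (|ξ| ^ 3)⁻¹ = y ^ 3 := by rw [hy, inv_pow]
  have hy3 : y ^ 3 ≤ (2 : ℝ) ^ (k + 2) := by
    have : (2 : ℝ) ^ (k + 2) = 2 * 2 ^ (k + 1) := by
      rw [show k + 2 = 1 + (k + 1) by ring, Real.rpow_add (by norm_num), Real.rpow_one]
    rw [this]
    rw [e3] at h2
    nlinarith [mul_self_nonneg y, mul_nonneg (sub_nonneg.2 hy8) (mul_self_nonneg y)]
  have h4 : ((2 : ℝ) ^ (-(k + 2) / 3)) ^ 3 ≤ |ξ| ^ 3 := by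
    rw [← Real.rpow_natCast ((2 : ℝ) ^ _), ← Real.rpow_mul (by norm_num)]
    rw [show -(k + 2) / 3 * ((3 : ℕ) : ℝ) = -(k + 2) by push_cast; ring,
      Real.rpow_neg (by norm_num)]
    rw [← e3] at hy3
    exact inv_le_of_inv_le₀ (by positivity) hy3
  exact le_of_pow_le_pow_left₀ (by norm_num) hpos.le h4

/-- Complementary to the bound in D: here |τ| < y³ with y = 1/|ξ| ≥ 8, so the bracket of the
modulation is at most 2y³, and a large modulation forces a small frequency. -/
lemma freq_le_of_notMem_regionD {r : ℝ × ℝ} {k : ℝ} (hr : r ∉ regionD) (h0 : r.2 ≠ 0)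
    (h8 : |r.2| ≤ 1 / 8) (hk : (2 : ℝ) ^ k ≤ bracket (modulation r)) :
    |r.2| ≤ (2 : ℝ) ^ ((1 - k) / 3) := by
  obtain ⟨τ, ξ⟩ := r
  have hr' : |τ| < (|ξ| ^ 3)⁻¹ := by
    by_contra h
    exact hr ⟨h8, not_lt.1 h⟩
  simp only at h0 h8 ⊢
  have hpos : 0 < |ξ| := abs_pos.2 h0
  set y := |ξ|⁻¹ with hy
  have hy8 : 8 ≤ y := by
    rw [hy]
    calc (8 : ℝ) = (1 / 8)⁻¹ := by norm_num
      _ ≤ _ := inv_anti₀ hpos h8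
  have hσ : |modulation (τ, ξ)| ≤ |τ| + |ξ| ^ 3 + y := by
    calc |modulation (τ, ξ)| = |τ + -ξ ^ 3 + 1 / ξ| := by
          congr 1
      _ ≤ _ := by
        refine (abs_add_three _ _ _).trans ?_
        rw [abs_neg, abs_div, abs_one, abs_pow, one_div]
  have hξ3 : |ξ| ^ 3 ≤ 1 := pow_le_one₀ hpos.le (by linarith)
  have e3 : (|ξ| ^ 3)⁻¹ = y ^ 3 := by rw [hy, inv_pow]
  have hy3 : (2 : ℝ) ^ (k - 1) ≤ (|ξ| ^ 3)⁻¹ := by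
    rw [Real.rpow_sub (by norm_num), Real.rpow_one, e3]
    rw [e3] at hr'
    unfold bracket at hk
    nlinarith [mul_self_nonneg y, mul_nonneg (sub_nonneg.2 hy8) (mul_self_nonneg y)]
  have h4 : |ξ| ^ 3 ≤ ((2 : ℝ) ^ ((1 - k) / 3)) ^ 3 := by
    rw [← Real.rpow_natCast ((2 : ℝ) ^ _), ← Real.rpow_mul (by norm_num)]
    rw [show (1 - k) / 3 * ((3 : ℕ) : ℝ) = -(k - 1) by push_cast; ring,
      Real.rpow_neg (by norm_num)]
    exact le_inv_of_le_inv₀ (by positivity) hy3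
  exact le_of_pow_le_pow_left₀ (by norm_num) (by positivity) h4

/-! ### Two high frequencies and a low one -/

/-- The functions `F`, `G` live at frequencies of size `2 ^ n`, `H` at much lower ones, and the
modulations are at most `2 ^ a`, `2 ^ b`, `2 ^ c` up to constants. -/
structure HighHighLow (F G H : ℝ × ℝ → ℝ≥0∞) (n a b c : ℝ) : Prop where
  measF : Measurable F
  measG : Measurable G
  measH : Measurable H
  modF : ModLE F a
  modG : ModLE G b
  modH : ModLE H c
  ha : 0 ≤ a
  hb : 0 ≤ b
  hc : 0 ≤ c
  hn : 20 ≤ n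
  freqF : ∀ p, F p ≠ 0 → (2 : ℝ) ^ (n - 2) ≤ |p.2| ∧ |p.2| ≤ (2 : ℝ) ^ (n + 2)
  freqG : ∀ p, G p ≠ 0 → (2 : ℝ) ^ (n - 2) ≤ |p.2| ∧ |p.2| ≤ (2 : ℝ) ^ (n + 2)
  freqH : ∀ p, H p ≠ 0 → p.2 ≠ 0 ∧ |p.2| ≤ (2 : ℝ) ^ (n - 8)

namespace HighHighLow

variable {F G H : ℝ × ℝ → ℝ≥0∞} {n a b c K m : ℝ}

lemma swap (h : HighHighLow F G H n a b c) : HighHighLow G F H n b a c :=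
  ⟨h.measG, h.measF, h.measH, h.modG, h.modF, h.modH, h.hb, h.ha, h.hc, h.hn, h.freqG, h.freqF,
    h.freqH⟩

lemma mono_right {H' : ℝ × ℝ → ℝ≥0∞} (h : HighHighLow F G H n a b c) (hm : Measurable H')
    (hH : ∀ p, H' p ≠ 0 → H p ≠ 0) : HighHighLow F G H' n a b c :=
  ⟨h.measF, h.measG, hm, h.modF, h.modG, fun p hp => h.modH p (hH p hp), h.ha, h.hb, h.hc, h.hn,
    h.freqF, h.freqG, fun p hp => h.freqH p (hH p hp)⟩

lemma bounds (h : HighHighLow F G H n a b c) : OnInter F G H fun p q r =>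
    p.2 + q.2 + r.2 = 0 ∧ p.2 ≠ 0 ∧ q.2 ≠ 0 ∧ r.2 ≠ 0 ∧
    (2 : ℝ) ^ n / 4 ≤ |p.2| ∧ |p.2| ≤ 4 * (2 : ℝ) ^ n ∧
    (2 : ℝ) ^ n / 4 ≤ |q.2| ∧ |q.2| ≤ 4 * (2 : ℝ) ^ n ∧ |r.2| ≤ (2 : ℝ) ^ n / 256 := by
  intro p q r h0 hp hq hr
  have hN : 0 < (2 : ℝ) ^ n := by positivity
  have e1 : (2 : ℝ) ^ (n - 2) = 2 ^ n / 4 := by rw [Real.rpow_sub (by norm_num)]; norm_num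
  have e2 : (2 : ℝ) ^ (n + 2) = 4 * 2 ^ n := by
    rw [Real.rpow_add (by norm_num)]; norm_num; ring
  have e3 : (2 : ℝ) ^ (n - 8) = 2 ^ n / 256 := by rw [Real.rpow_sub (by norm_num)]; norm_num
  have h1 := h.freqF p hp
  have h2 := h.freqG q hq
  have h3 := h.freqH r hr
  rw [e1, e2] at h1 h2
  rw [e3] at h3
  refine ⟨by simpa using congrArg Prod.snd h0, ?_, ?_, h3.1, h1.1, h1.2, h2.1, h2.2, h3.2⟩
  · exact abs_pos.1 (by linarith [h1.1])
  · exact abs_pos.1 (by linarith [h2.1])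

/-- Both high frequencies have size 2^n. The cubic term gives 2^(2n) |r| ≲ 2^K, hence the upper
bound. The 1/ξ term gives 2^(2n) ≲ 2^K 2^(2n) |r|; the high frequencies cancel and leave the lower
bound. -/
lemma resonance (h : HighHighLow F G H n a b c) (ha : a ≤ K) (hb : b ≤ K) (hc : c ≤ K) :
    OnInter F G H fun _ _ r => |r.2| ≤ (2 : ℝ) ^ (K + 5 - 2 * n) ∧
      (2 : ℝ) ^ (-K - 12) ≤ |r.2| := by
  intro p q r h0 hp hq hr
  obtain ⟨-, p0, q0, r0, p1, p2, q1, q2, -⟩ := h.bounds p q r h0 hp hq hr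
  have hN : 0 < (2 : ℝ) ^ n := by positivity
  have hM : ∀ x, x ≤ K → (2 : ℝ) ^ (x + 1) ≤ 2 ^ (K + 1) := fun x hx =>
    Real.rpow_le_rpow_of_exponent_le (by norm_num) (by linarith)
  obtain ⟨h1, h2⟩ := resonance_upper h0 p0 q0 r0 ((h.modF p hp).trans (hM a ha))
    ((h.modG q hq).trans (hM b hb)) ((h.modH r hr).trans (hM c hc))
  have hKp : 0 < (2 : ℝ) ^ K := by positivity
  have hr' : 0 < |r.2| := abs_pos.2 r0
  have e1 : (2 : ℝ) ^ (K + 1) = 2 * 2 ^ K := by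
    rw [Real.rpow_add (by norm_num), Real.rpow_one, mul_comm]
  have e2 : (2 : ℝ) ^ (K + 5 - 2 * n) = 32 * 2 ^ K / (2 ^ n * 2 ^ n) := by
    rw [Real.rpow_sub (by norm_num), Real.rpow_add (by norm_num), two_mul n,
      Real.rpow_add (by norm_num) n n]
    norm_num; ring
  have e3 : (2 : ℝ) ^ (-K - 12) = (4096 * 2 ^ K)⁻¹ := by
    rw [show -K - 12 = -(12 + K) by ring, Real.rpow_neg (by norm_num),
      Real.rpow_add (by norm_num)]
    norm_num
  rw [e1, abs_mul, abs_mul] at h1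
  rw [e1, abs_mul, abs_mul] at h2
  have l1 : (2 : ℝ) ^ n / 4 * (2 ^ n / 4) ≤ |p.2| * |q.2| := by gcongr
  have l2 : |p.2| * |q.2| ≤ 4 * (2 : ℝ) ^ n * (4 * (2 : ℝ) ^ n) := by gcongr
  constructor
  · rw [e2, le_div_iff₀ (by positivity)]
    have := mul_le_mul_of_nonneg_right l1 hr'.le
    linarith
  · rw [e3]
    apply inv_le_of_inv_le₀ hr'
    rw [inv_le_iff_one_le_mul₀ hr']
    have l3 : ((2 : ℝ) ^ n / 4) ^ 2 ≤ p.2 ^ 2 := by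
      rw [← sq_abs p.2]; gcongr
    have l4 : 6 * (2 * (2 : ℝ) ^ K) * (|p.2| * |q.2| * |r.2|) ≤
        6 * (2 * (2 : ℝ) ^ K) * (4 * (2 : ℝ) ^ n * (4 * (2 : ℝ) ^ n) * |r.2|) := by gcongr
    have l5 : ((2 : ℝ) ^ n / 4) ^ 2 ≤
        6 * (2 * (2 : ℝ) ^ K) * (4 * (2 : ℝ) ^ n * (4 * (2 : ℝ) ^ n) * |r.2|) := by
      nlinarith [sq_nonneg q.2, sq_nonneg r.2]
    have hNN : 0 < (2 : ℝ) ^ n * 2 ^ n := by positivity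
    have l6 : (2 : ℝ) ^ n * 2 ^ n * 1 ≤ 2 ^ n * 2 ^ n * (4096 * 2 ^ K * |r.2|) := by nlinarith
    exact le_of_mul_le_mul_left l6 hNN

/-- The two bounds for the low frequency are compatible only if 2K ≥ 2n - 17. Thus some modulation
is large however small the low frequency is, which is the benefit of the 1/ξ term. -/
lemma modulation_ge (h : HighHighLow F G H n a b c) (ha : a ≤ K) (hb : b ≤ K) (hc : c ≤ K)
    (hex : ∃ p q r : ℝ × ℝ, p + q + r = 0 ∧ F p ≠ 0 ∧ G q ≠ 0 ∧ H r ≠ 0) : n - 9 ≤ K := by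
  obtain ⟨p, q, r, h0, hp, hq, hr⟩ := hex
  obtain ⟨h1, h2⟩ := h.resonance ha hb hc p q r h0 hp hq hr
  have := (Real.rpow_le_rpow_left_iff (by norm_num)).1 (h2.trans h1)
  linarith

/-- Transversality of a high and the low frequency. -/
lemma triBound_highLow (h : HighHighLow F G H n a b c)
    (hr : OnInter F G H fun _ _ r => (2 : ℝ) ^ (2 - n) ≤ |r.2|) :
    TriBound F G H ((a + c) / 2 - n + 6) := by
  have := triBound_transversal (l := 2 * n - 5) h.measF h.measH h.measG h.modF h.modH ?_
  · exact this.rot.mono (by linarith)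
  · intro p r q h0 hp hr' hq
    have h0' : p + q + r = 0 := by rw [← h0]; abel
    obtain ⟨-, p0, q0, r0, p1, p2, q1, q2, r1⟩ := h.bounds p q r h0' hp hq hr'
    have r2 := hr p q r h0' hp hq hr'
    have hN : 0 < (2 : ℝ) ^ n := by positivity
    have e1 : (2 : ℝ) ^ (2 - n) = 4 / 2 ^ n := by rw [Real.rpow_sub (by norm_num)]; norm_num
    have e2 : (2 : ℝ) ^ (2 * n - 5) = 2 ^ n * 2 ^ n / 32 := by
      rw [Real.rpow_sub (by norm_num), two_mul, Real.rpow_add (by norm_num) n n]; norm_num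
    constructor
    -- The threshold 2^(2 - n) on the low frequency is chosen so that its product with a high
    -- frequency, at least 2^n / 4, is at least 1.
    · rw [abs_mul]
      rw [e1] at r2
      calc (1 : ℝ) = 2 ^ n / 4 * (4 / 2 ^ n) := by field_simp
        _ ≤ _ := by gcongr
    · rw [e2]
      have : (2 : ℝ) ^ n / 8 ≤ |p.2 - r.2| := by
        have := abs_sub_abs_le_abs_sub p.2 r.2
        linarith
      calc (2 : ℝ) ^ n * 2 ^ n / 32 = 2 ^ n / 4 * (2 ^ n / 8) := by ring
        _ ≤ _ := by gcongr

/-- The high frequencies nearly cancel in the sum, so they have opposite signs: p - q = 2p + r has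
size at least 2^n / 4. -/
lemma highHigh_transversal (h : HighHighLow F G H n a b c) :
    OnInter F G H fun p q r => 1 ≤ |p.2 * q.2| ∧
      |r.2| * ((2 : ℝ) ^ n / 4) ≤ |r.2| * |p.2 - q.2| := by
  intro p q r h0 hp hq hr'
  obtain ⟨s0, p0, q0, r0, p1, p2, q1, q2, r1⟩ := h.bounds p q r h0 hp hq hr'
  have hN : 0 < (2 : ℝ) ^ n := by positivity
  have hN4 : (4 : ℝ) ≤ 2 ^ n := by
    calc (4 : ℝ) = 2 ^ (2 : ℝ) := by norm_num
      _ ≤ _ := Real.rpow_le_rpow_of_exponent_le (by norm_num) (by linarith [h.hn])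
  constructor
  · rw [abs_mul]
    calc (1 : ℝ) ≤ 2 ^ n / 4 * (2 ^ n / 4) := by nlinarith
      _ ≤ _ := by gcongr
  · gcongr
    have e : p.2 - q.2 = 2 * p.2 - (-r.2) := by linarith
    have := abs_sub_abs_le_abs_sub (2 * p.2) (-r.2)
    rw [← e, abs_neg, abs_mul, abs_two] at this
    linarith

/-- Transversality of the two high frequencies. -/
lemma triBound_highHigh (h : HighHighLow F G H n a b c)
    (hr : OnInter F G H fun _ _ r => (2 : ℝ) ^ m ≤ |r.2|) :
    TriBound F G H ((a + b - m - n) / 2 + 4) := by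
  refine (triBound_transversal (l := m + n - 2) h.measF h.measG h.measH h.modF h.modG ?_).mono
    (by linarith)
  intro p q r h0 hp hq hr'
  obtain ⟨h1, h2⟩ := h.highHigh_transversal p q r h0 hp hq hr'
  refine ⟨h1, le_trans ?_ h2⟩
  have r2 := hr p q r h0 hp hq hr'
  have e1 : (2 : ℝ) ^ (m + n - 2) = 2 ^ m * (2 ^ n / 4) := by
    rw [Real.rpow_sub (by norm_num), Real.rpow_add (by norm_num)]; norm_num; ring
  rw [e1]
  gcongr

lemma triBound_volume (h : HighHighLow F G H n a b c)
    (hr : OnInter F G H fun _ _ r => |r.2| ≤ (2 : ℝ) ^ m) :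
    TriBound F G H ((m + min a (min b c)) / 2 + 2) := by
  apply triBound_low h.measF h.measG h.measH hr
  rcases min_choice a (min b c) with e | e
  · rw [e]; exact Or.inl h.modF
  · rw [e]
    rcases min_choice b c with e | e
    · rw [e]; exact Or.inr (Or.inl h.modG)
    · rw [e]; exact Or.inr (Or.inr h.modH)

/-- If the low-frequency function lives in the exceptional region and its modulation dominates,
then its frequency is determined by its modulation up to a constant. -/
lemma freq_ge_of_dominant (h : HighHighLow F G H n a b c) (hD : ∀ r, H r ≠ 0 → r ∈ regionD)
    (hc : ∀ r, H r ≠ 0 → (2 : ℝ) ^ c ≤ bracket (modulation r))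
    (hac : a ≤ c - 10) (hbc : b ≤ c - 10) (h18 : 18 ≤ c) :
    OnInter F G H fun _ _ r => (2 : ℝ) ^ (c - 8 - 2 * n) ≤ |r.2| := by
  intro p q r h0 hp hq hr
  obtain ⟨-, p0, q0, r0, p1, p2, q1, q2, r1⟩ := h.bounds p q r h0 hp hq hr
  have hN : 0 < (2 : ℝ) ^ n := by positivity
  have hC : 0 < (2 : ℝ) ^ c := by positivity
  have hr' : 0 < |r.2| := abs_pos.2 r0
  have hM : ∀ x, x ≤ c - 10 → (2 : ℝ) ^ (x + 1) ≤ 2 ^ c / 512 := fun x hx => by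
    calc (2 : ℝ) ^ (x + 1) ≤ 2 ^ (c - 9) :=
          Real.rpow_le_rpow_of_exponent_le (by norm_num) (by linarith)
      _ = _ := by rw [Real.rpow_sub (by norm_num)]; norm_num
  have h1 := (h.modF p hp).trans (hM a hac)
  have h2 := (h.modG q hq).trans (hM b hbc)
  have h3 := hc r hr
  have h4 := freq_ge_of_mem_regionD (hD r hr) r0 (h.modH r hr)
  have h5 := resonance_lower h0 p0 q0 r0
  unfold bracket at h3
  have hone : (1 : ℝ) ≤ 2 ^ c / 512 := by
    have : (512 : ℝ) ≤ 2 ^ c := by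
      calc (512 : ℝ) = 2 ^ (9 : ℝ) := by norm_num
        _ ≤ _ := Real.rpow_le_rpow_of_exponent_le (by norm_num) (by linarith)
    linarith
  have l1 : (2 : ℝ) ^ n / 4 * (2 ^ n / 4) ≤ |p.2| * |q.2| := by gcongr
  have l2 : |p.2| * |q.2| ≤ 4 * (2 : ℝ) ^ n * (4 * (2 : ℝ) ^ n) := by gcongr
  have hsum : p.2 ^ 2 + q.2 ^ 2 + r.2 ^ 2 ≤ 33 * (2 ^ n * 2 ^ n) := by
    rw [← sq_abs p.2, ← sq_abs q.2, ← sq_abs r.2]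
    have s1 : |p.2| ^ 2 ≤ (4 * (2 : ℝ) ^ n) ^ 2 := by gcongr
    have s2 : |q.2| ^ 2 ≤ (4 * (2 : ℝ) ^ n) ^ 2 := by gcongr
    have s3 : |r.2| ^ 2 ≤ ((2 : ℝ) ^ n / 256) ^ 2 := by gcongr
    nlinarith
  have hdiv : (p.2 ^ 2 + q.2 ^ 2 + r.2 ^ 2) / (2 * |p.2 * q.2 * r.2|) ≤ 2 ^ c / 4 := by
    rw [div_le_iff₀ (by positivity), abs_mul, abs_mul]
    -- In D one has |r| ≥ 2^(-(c+2)/3), so 2^c |r| ≥ 2^((2c-2)/3) ≥ 2^11 once c ≥ 18. Hence the 1/ξ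
    -- part of the resonance is at most 2^c / 4, and the cubic part has to carry the dominant
    -- modulation.
    have t1 : (1056 : ℝ) ≤ 2 ^ c * |r.2| := by
      calc (1056 : ℝ) ≤ 2 ^ (c + -(c + 2) / 3) := by
            calc (1056 : ℝ) ≤ 2 ^ (11 : ℝ) := by norm_num
              _ ≤ 2 ^ (c + -(c + 2) / 3) :=
                Real.rpow_le_rpow_of_exponent_le (by norm_num) (by linarith)
        _ = 2 ^ c * 2 ^ (-(c + 2) / 3) := Real.rpow_add (by norm_num) _ _
        _ ≤ _ := by gcongr
    have t2 : (2 : ℝ) ^ n / 4 * (2 ^ n / 4) * 1056 ≤ |p.2| * |q.2| * (2 ^ c * |r.2|) := by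
      gcongr
    nlinarith
  have e1 : (2 : ℝ) ^ (c - 8 - 2 * n) = 2 ^ c / 256 / (2 ^ n * 2 ^ n) := by
    rw [Real.rpow_sub (by norm_num), Real.rpow_sub (by norm_num), two_mul,
      Real.rpow_add (by norm_num) n n]
    norm_num
  rw [e1, div_le_iff₀ (by positivity)]
  have l3 : |p.2 * q.2 * r.2| ≤ 4 * (2 : ℝ) ^ n * (4 * (2 : ℝ) ^ n) * |r.2| := by
    rw [abs_mul, abs_mul]; gcongr
  nlinarith

end HighHighLow

end Ostrovsky

end

noncomputable section

namespace Ostrovsky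

/-! ### Exponents of the localized trilinear bounds -/

section

variable {F G H : ℝ × ℝ → ℝ≥0∞} {E m : ℝ}

/-- The trilinear bound with the weight `|ξ|` on the third function. -/
def WeightedTriBound (F G H : ℝ × ℝ → ℝ≥0∞) (E : ℝ) : Prop :=
  triForm F G (fun r => ‖r.2‖ₑ * H r) ≤ e2 E * (l2 volume F * l2 volume G * l2 volume H)

lemma WeightedTriBound.mono {E E' : ℝ} (h : WeightedTriBound F G H E) (hE : E ≤ E') :
    WeightedTriBound F G H E' :=
  le_trans h (by gcongr; exact e2_mono hE)

lemma WeightedTriBound.swap (hF : Measurable F) (hG : Measurable G) (hH : Measurable H)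
    (h : WeightedTriBound F G H E) : WeightedTriBound G F H E := by
  unfold WeightedTriBound at *
  rw [triForm_swap hG hF (by fun_prop), mul_comm (l2 volume G)]; exact h

lemma WeightedTriBound.of_inter
    (h : (∃ p q r : ℝ × ℝ, p + q + r = 0 ∧ F p ≠ 0 ∧ G q ≠ 0 ∧ H r ≠ 0) →
      WeightedTriBound F G H E) :
    WeightedTriBound F G H E := by
  by_cases hex : ∃ p q r : ℝ × ℝ, p + q + r = 0 ∧ F p ≠ 0 ∧ G q ≠ 0 ∧ H r ≠ 0
  · exact h hex
  · unfold WeightedTriBound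
    rw [triForm_eq_zero fun p q r h0 hp hq hr =>
      hex ⟨p, q, r, h0, hp, hq, right_ne_zero_of_mul hr⟩]
    exact zero_le

lemma enorm_le_e2 {x : ℝ} (h : |x| ≤ (2 : ℝ) ^ m) : ‖x‖ₑ ≤ e2 m := by
  rw [Real.enorm_eq_ofReal_abs, e2_eq_ofReal]
  exact ENNReal.ofReal_le_ofReal h

lemma TriBound.weighted (h : TriBound F G H E)
    (hm : OnInter F G H fun _ _ r => |r.2| ≤ (2 : ℝ) ^ m) :
    WeightedTriBound F G H (E + m) := by
  have h1 : triForm F G (fun r => ‖r.2‖ₑ * H r) ≤ e2 m * triForm F G H := by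
    unfold triForm
    rw [← lintegral_const_mul' _ _ (e2_ne_top m)]
    refine lintegral_mono fun p => ?_
    rw [← lintegral_const_mul' _ _ (e2_ne_top m)]
    refine lintegral_mono fun q => ?_
    by_cases h0 : F p * G q * H (-(p + q)) = 0
    · have : F p * G q * (‖(-(p + q)).2‖ₑ * H (-(p + q))) =
          ‖(-(p + q)).2‖ₑ * (F p * G q * H (-(p + q))) := by ring
      simp only [this, h0, mul_zero, le_refl]
    · have h0' := h0
      simp only [mul_eq_zero, not_or] at h0'
      have := enorm_le_e2 (hm p q _ (by abel) h0'.1.1 h0'.1.2 h0'.2)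
      calc F p * G q * (‖(-(p + q)).2‖ₑ * H (-(p + q))) =
          ‖(-(p + q)).2‖ₑ * (F p * G q * H (-(p + q))) := by ring
        _ ≤ _ := by gcongr
  calc _ ≤ e2 m * triForm F G H := h1
    _ ≤ e2 m * (e2 E * (l2 volume F * l2 volume G * l2 volume H)) := by gcongr; exact h
    _ = _ := by rw [add_comm E m, e2_add, mul_assoc (e2 m)]

lemma measurable_indicator_mul_enorm {W : ℝ × ℝ → ℝ≥0∞} (hW : Measurable W) (hH : Measurable H)
    {S : Set (ℝ × ℝ)} (hS : MeasurableSet S) : Measurable fun r => W r * S.indicator H r :=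
  hW.mul (hH.indicator hS)

lemma triForm_mul_split (hF : Measurable F) (hG : Measurable G) (hH : Measurable H)
    {W : ℝ × ℝ → ℝ≥0∞} (hW : Measurable W) {S : Set (ℝ × ℝ)} (hS : MeasurableSet S) :
    triForm F G (fun r => W r * H r) = triForm F G (fun r => W r * S.indicator H r) +
      triForm F G (fun r => W r * Sᶜ.indicator H r) := by
  rw [triForm_eq_lconv hF hG (show Measurable fun r => W r * H r from hW.mul hH),
    triForm_eq_lconv hF hG (measurable_indicator_mul_enorm hW hH hS),
    triForm_eq_lconv hF hG (measurable_indicator_mul_enorm hW hH hS.compl),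
    ← lintegral_add_left]
  · congr 1; ext r
    by_cases hr : -r ∈ S <;> simp [hr]
  · exact (measurable_lconv hF hG).mul
      ((measurable_indicator_mul_enorm hW hH hS).comp measurable_neg)

lemma l2_indicator_le {S : Set (ℝ × ℝ)} : l2 volume (S.indicator H) ≤ l2 volume H :=
  l2_mono fun _ => Set.indicator_le_self' (fun _ _ => zero_le) _

lemma e2_add_one (x : ℝ) : e2 (x + 1) = e2 x + e2 x := by
  rw [add_comm, e2_add, ← two_mul]; simp [e2]

lemma TriBound.of_split (hF : Measurable F) (hG : Measurable G) (hH : Measurable H)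
    {S : Set (ℝ × ℝ)} (hS : MeasurableSet S) (h₁ : TriBound F G (S.indicator H) E)
    (h₂ : TriBound F G (Sᶜ.indicator H) E) : TriBound F G H (E + 1) := by
  have := triForm_mul_split hF hG hH (measurable_const (a := (1 : ℝ≥0∞))) hS
  simp only [one_mul] at this
  unfold TriBound at *
  rw [this, e2_add_one, add_mul]
  refine add_le_add (h₁.trans ?_) (h₂.trans ?_) <;>
  · gcongr; exact l2_indicator_le

lemma WeightedTriBound.of_split (hF : Measurable F) (hG : Measurable G) (hH : Measurable H)
    {S : Set (ℝ × ℝ)} (hS : MeasurableSet S) (h₁ : WeightedTriBound F G (S.indicator H) E)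
    (h₂ : WeightedTriBound F G (Sᶜ.indicator H) E) : WeightedTriBound F G H (E + 1) := by
  have := triForm_mul_split hF hG hH (show Measurable fun r : ℝ × ℝ => ‖r.2‖ₑ by fun_prop) hS
  unfold WeightedTriBound at *
  rw [this, e2_add_one, add_mul]
  refine add_le_add (h₁.trans ?_) (h₂.trans ?_) <;>
  · gcongr; exact l2_indicator_le

lemma measurableSet_low (x : ℝ) : MeasurableSet {r : ℝ × ℝ | |r.2| ≤ x} :=
  measurableSet_le (by fun_prop) measurable_const

end

lemma rpow_two_le_iff {x y : ℝ} : (2 : ℝ) ^ x ≤ 2 ^ y ↔ x ≤ y :=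
  Real.rpow_le_rpow_left_iff (by norm_num)

lemma min_three_le (a b c : ℝ) : min a (min b c) ≤ a ∧ min a (min b c) ≤ b ∧
    min a (min b c) ≤ c :=
  ⟨min_le_left _ _, (min_le_right _ _).trans (min_le_left _ _),
    (min_le_right _ _).trans (min_le_right _ _)⟩

lemma max_three_cases (a b c : ℝ) :
    (b ≤ a ∧ c ≤ a) ∨ (a ≤ b ∧ c ≤ b) ∨ (a ≤ c ∧ b ≤ c) := by
  rcases le_total a b with h | h
  · rcases le_total b c with h' | h'
    · exact Or.inr (Or.inr ⟨h.trans h', h'⟩)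
    · exact Or.inr (Or.inl ⟨h, h'⟩)
  · rcases le_total a c with h' | h'
    · exact Or.inr (Or.inr ⟨h', h.trans h'⟩)
    · exact Or.inl ⟨h, h'⟩

namespace HighHighLow

variable {F G H : ℝ × ℝ → ℝ≥0∞} {n a b c K m j : ℝ}

lemma indicator (h : HighHighLow F G H n a b c) {S : Set (ℝ × ℝ)} (hS : MeasurableSet S) :
    HighHighLow F G (S.indicator H) n a b c :=
  h.mono_right (h.measH.indicator hS) fun _ hp => (Set.indicator_apply_ne_zero.1 hp).2

/-- The low frequency is very low: only the volume of its support is used. -/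
lemma triBound_veryLow (h : HighHighLow F G H n a b c)
    (hlow : OnInter F G H fun _ _ r => |r.2| ≤ (2 : ℝ) ^ (2 - n)) :
    TriBound F G H ((a + b + c) / 2 - n + 20 - min b |b - n| / 8) := by
  apply TriBound.of_inter
  intro hex
  refine (h.triBound_volume hlow).mono ?_
  obtain ⟨m1, m2, m3⟩ := min_three_le a b c
  have ha := h.ha
  have hb := h.hb
  have hc := h.hc
  have g1 := min_le_left b |b - n|
  have g2 := min_le_right b |b - n|
  -- The volume bound alone gives -n/2. The largest modulation is at least 2^(n-9), and half of its
  -- exponent supplies the missing -n/2. When b is the largest, little may be left over, and the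
  -- gain is only |b - n| / 8.
  rcases max_three_cases a b c with hK | hK | hK
  · have := h.modulation_ge le_rfl hK.1 hK.2 hex
    linarith
  · have := h.modulation_ge hK.1 le_rfl hK.2 hex
    rcases abs_cases (b - n) with hh | hh <;> linarith
  · have := h.modulation_ge hK.1 hK.2 le_rfl hex
    linarith

/-- If a high-frequency modulation dominates, the other two functions are transversal and half of
the dominant exponent is left over. If the low-frequency modulation dominates, resonance makes |r|
at most 2^(c + 5 - 2n), and the volume bound already yields the factor 2^(-n). -/
lemma triBound_notVeryLow (h : HighHighLow F G H n a b c)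
    (hlow : OnInter F G H fun _ _ r => (2 : ℝ) ^ (2 - n) ≤ |r.2|) :
    TriBound F G H ((a + b + c) / 2 - n + 20 - min b |b - n| / 8) := by
  have ha := h.ha
  have hb := h.hb
  have hc := h.hc
  have g1 := min_le_left b |b - n|
  rcases max_three_cases a b c with hK | hK | hK
  · exact ((h.swap.triBound_highLow hlow.swap).swap h.measG h.measF h.measH).mono (by linarith)
  · exact (h.triBound_highLow hlow).mono (by linarith)
  · obtain ⟨m1, m2, m3⟩ := min_three_le a b c
    exact (h.triBound_volume fun p q r h0 hp hq hr =>
      (h.resonance hK.1 hK.2 le_rfl p q r h0 hp hq hr).1).mono (by linarith)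

lemma onInter_indicator_low (x : ℝ) :
    OnInter F G ({r : ℝ × ℝ | |r.2| ≤ x}.indicator H) fun _ _ r => |r.2| ≤ x :=
  fun _ _ _ _ _ _ hr => (Set.indicator_apply_ne_zero.1 hr).1

lemma onInter_indicator_compl_low (x : ℝ) :
    OnInter F G ({r : ℝ × ℝ | |r.2| ≤ x}ᶜ.indicator H) fun _ _ r => x ≤ |r.2| :=
  fun _ _ r _ _ _ hr => by
    have : ¬ |r.2| ≤ x := (Set.indicator_apply_ne_zero.1 hr).1
    exact (not_le.1 this).le

/-- High-low interaction into high frequencies. -/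
lemma triBound_output_high (h : HighHighLow F G H n a b c) :
    TriBound F G H ((a + b + c) / 2 - n + 20 - min b |b - n| / 8 + 1) := by
  have hS := measurableSet_low ((2 : ℝ) ^ (2 - n))
  exact TriBound.of_split h.measF h.measG h.measH hS
    ((h.indicator hS).triBound_veryLow (onInter_indicator_low _))
    ((h.indicator hS.compl).triBound_notVeryLow (onInter_indicator_compl_low _))

/-- High-low interaction into high frequencies, with the low-frequency function living in the
exceptional region: there is an additional gain in its modulation. -/
lemma triBound_output_high_regionD (h : HighHighLow F G H n a b c)
    (hD : ∀ r, H r ≠ 0 → r ∈ regionD)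
    (hcl : ∀ r, H r ≠ 0 → (2 : ℝ) ^ c ≤ bracket (modulation r)) :
    TriBound F G H ((a + b + c) / 2 - n + 20 -
      (min b |b - n| + min c |c - 3 / 2 * n|) / 8 + 1) := by
  have hS := measurableSet_low ((2 : ℝ) ^ (2 - n))
  have ha := h.ha
  have hb := h.hb
  have hc := h.hc
  have g1 := min_le_left b |b - n|
  have g2 := min_le_left c |c - 3 / 2 * n|
  have g3 := min_le_right c |c - 3 / 2 * n|
  obtain ⟨m1, m2, m3⟩ := min_three_le a b c
  have hlow : OnInter F G H fun _ _ r => (2 : ℝ) ^ (-(c + 2) / 3) ≤ |r.2| :=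
    fun p q r h0 hp hq hr => freq_ge_of_mem_regionD (hD r hr) (h.freqH r hr).1 (h.modH r hr)
  refine TriBound.of_split h.measF h.measG h.measH hS ?_ ?_
  · have h' := h.indicator hS
    apply TriBound.of_inter
    intro hex
    refine (h'.triBound_volume (onInter_indicator_low _)).mono ?_
    obtain ⟨p, q, r, h0, hp, hq, hr⟩ := hex
    have hr' := Set.indicator_apply_ne_zero.1 hr
    -- In D a frequency below 2^(2 - n) forces c ≥ 3n - 8, so the volume bound leaves room for both
    -- gains.
    have := rpow_two_le_iff.1 ((hlow p q r h0 hp hq hr'.2).trans hr'.1)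
    linarith
  · have h' := h.indicator hS.compl
    have hge := onInter_indicator_compl_low (F := F) (G := G) (H := H) ((2 : ℝ) ^ (2 - n))
    rcases max_three_cases a b c with hK | hK | hK
    · exact ((h'.swap.triBound_highLow hge.swap).swap h'.measG h'.measF h'.measH).mono
        (by linarith)
    · exact (h'.triBound_highLow hge).mono (by linarith)
    · have hv := h'.triBound_volume fun p q r h0 hp hq hr =>
        (h'.resonance hK.1 hK.2 le_rfl p q r h0 hp hq hr).1
      rcases le_or_gt c 18 with h18 | h18
      · exact hv.mono (by linarith)
      rcases le_or_gt (c - 10) a with ha' | ha'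
      · exact hv.mono (by linarith)
      rcases le_or_gt (c - 10) b with hb' | hb'
      · exact hv.mono (by linarith)
      apply TriBound.of_inter
      rintro ⟨p, q, r, h0, hp, hq, hr⟩
      have hr' := Set.indicator_apply_ne_zero.1 hr
      have l1 := rpow_two_le_iff.1 ((hlow p q r h0 hp hq hr'.2).trans
        (h'.resonance hK.1 hK.2 le_rfl p q r h0 hp hq hr).1)
      have hh := h'.triBound_highHigh (m := c - 8 - 2 * n)
        (h'.freq_ge_of_dominant (fun r hr => hD r (Set.indicator_apply_ne_zero.1 hr).2)
          (fun r hr => hcl r (Set.indicator_apply_ne_zero.1 hr).2) ha'.le hb'.le h18.le)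
      -- Here |r| is comparable to 2^(c - 2n), and the lower bound in D gives c ≥ 3n/2 up to a
      -- constant. The volume bound has max(a, b)/2 to spare, while transversality of the high
      -- frequencies gains c - 3n/2; whichever reserve is sufficient is used.
      rcases le_or_gt (c - 3 / 2 * n) (b / 4 + a / 4) with hx | hx
      · refine hv.mono ?_
        rcases abs_cases (c - 3 / 2 * n) with hh | hh <;> linarith
      · refine hh.mono ?_
        rcases abs_cases (c - 3 / 2 * n) with hh | hh <;> linarith

/-- High-low interaction into high frequencies with the low frequency of size `2 ^ j`, `j ≥ 1`. -/
lemma triBound_output_high_shell (h : HighHighLow F G H n a b c) (hj : 1 ≤ j) (hjn : j ≤ n)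
    (hH : ∀ r, H r ≠ 0 → (2 : ℝ) ^ (j - 1) ≤ |r.2|) :
    TriBound F G H ((a + b + c) / 2 - 5 / 4 * n - j / 2 + 20 - min b |b - (2 * n + j)| / 8) := by
  have hn := h.hn
  have ha := h.ha
  have hb := h.hb
  have hc := h.hc
  have g1 := min_le_left b |b - (2 * n + j)|
  have g2 := min_le_right b |b - (2 * n + j)|
  have hlow : OnInter F G H fun _ _ r => (2 : ℝ) ^ (j - 1) ≤ |r.2| :=
    fun p q r h0 hp hq hr => hH r hr
  have hlow' : OnInter F G H fun _ _ r => (2 : ℝ) ^ (2 - n) ≤ |r.2| :=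
    fun p q r h0 hp hq hr => (rpow_two_le_iff.2 (by linarith)).trans (hH r hr)
  apply TriBound.of_inter
  rintro ⟨p, q, r, h0, hp, hq, hr⟩
  rcases max_three_cases a b c with hK | hK | hK
  · have := rpow_two_le_iff.1 ((hH r hr).trans
      (h.resonance le_rfl hK.1 hK.2 p q r h0 hp hq hr).1)
    exact ((h.swap.triBound_highLow hlow'.swap).swap h.measG h.measF h.measH).mono (by linarith)
  · have := rpow_two_le_iff.1 ((hH r hr).trans
      (h.resonance hK.1 le_rfl hK.2 p q r h0 hp hq hr).1)
    refine (h.triBound_highLow hlow').mono ?_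
    rcases abs_cases (b - (2 * n + j)) with hh | hh <;> linarith
  -- This case fixes the coefficient 5/4. Resonance gives c ≥ 2n + j - 6, and with b ≤ c the reserve
  -- c/2 - b/8 is at least 3c/8, that is 3n/4 up to terms which do not hurt; transversality
  -- contributes the other n/2.
  · have := rpow_two_le_iff.1 ((hH r hr).trans
      (h.resonance hK.1 hK.2 le_rfl p q r h0 hp hq hr).1)
    exact (h.triBound_highHigh hlow).mono (by linarith)

/-- High-high interaction into frequencies of size `2 ^ j`, `j ≥ 1`. -/
lemma triBound_output_low_shell (h : HighHighLow F G H n a b c) (hj : 1 ≤ j) (hjn : j ≤ n)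
    (hH : ∀ r, H r ≠ 0 → (2 : ℝ) ^ (j - 1) ≤ |r.2|) :
    TriBound F G H ((a + b + c) / 2 - 3 / 2 * n - 5 / 8 * j + 20 -
      min c |c - (2 * n + j)| / 8) := by
  have hn := h.hn
  have ha := h.ha
  have hb := h.hb
  have hc := h.hc
  have g1 := min_le_left c |c - (2 * n + j)|
  have g2 := min_le_right c |c - (2 * n + j)|
  have hlow : OnInter F G H fun _ _ r => (2 : ℝ) ^ (j - 1) ≤ |r.2| :=
    fun p q r h0 hp hq hr => hH r hr
  have hlow' : OnInter F G H fun _ _ r => (2 : ℝ) ^ (2 - n) ≤ |r.2| :=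
    fun p q r h0 hp hq hr => (rpow_two_le_iff.2 (by linarith)).trans (hH r hr)
  apply TriBound.of_inter
  rintro ⟨p, q, r, h0, hp, hq, hr⟩
  -- The coefficient 5/8 is set by the first two cases. There the largest modulation is at least 2n
  -- + j - 6 and 3/8 of it remains after the gain c/8 is paid. Up to constants, 3n/4 + 3j/8 has to
  -- cover n/2 + 5j/8, which is exactly j ≤ n.
  rcases max_three_cases a b c with hK | hK | hK
  · have := rpow_two_le_iff.1 ((hH r hr).trans
      (h.resonance le_rfl hK.1 hK.2 p q r h0 hp hq hr).1)
    exact ((h.swap.triBound_highLow hlow'.swap).swap h.measG h.measF h.measH).mono (by linarith)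
  · have := rpow_two_le_iff.1 ((hH r hr).trans
      (h.resonance hK.1 le_rfl hK.2 p q r h0 hp hq hr).1)
    exact (h.triBound_highLow hlow').mono (by linarith)
  · have := rpow_two_le_iff.1 ((hH r hr).trans
      (h.resonance hK.1 hK.2 le_rfl p q r h0 hp hq hr).1)
    refine (h.triBound_highHigh hlow).mono ?_
    rcases abs_cases (c - (2 * n + j)) with hh | hh <;> linarith

lemma weighted_output_low_aux (h : HighHighLow F G H n a b c)
    (h1 : ∀ r, H r ≠ 0 → |r.2| ≤ 1) (hba : b ≤ a) (hca : c - 10 ≤ a)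
    (hlow : OnInter F G H fun _ _ r => (2 : ℝ) ^ (2 - n) ≤ |r.2|) :
    WeightedTriBound F G H ((a + b + c) / 2 - 3 / 2 * n + 20 - c / 8) := by
  have ha := h.ha
  have hc := h.hc
  -- The low frequency is at most 1 and at most 2^(a + 15 - 2n), hence at most the fourth root of
  -- the latter. This yields the missing -n/2 at the price a/4, leaving a/4 for the gain c/8.
  have hw : OnInter F G H fun _ _ r => |r.2| ≤ (2 : ℝ) ^ ((a + 15 - 2 * n) / 4) := by
    intro p q r h0 hp hq hr
    have l1 := (h.resonance (K := a + 10) (by linarith) (by linarith) (by linarith)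
      p q r h0 hp hq hr).1
    rcases le_total 0 (a + 15 - 2 * n) with hs | hs
    · exact (h1 r hr).trans (Real.one_le_rpow (by norm_num) (by linarith))
    · exact l1.trans (rpow_two_le_iff.2 (by linarith))
  exact (((h.swap.triBound_highLow hlow.swap).swap h.measG h.measF h.measH).weighted hw).mono
    (by linarith)

/-- High-high interaction into low frequencies when the output modulation does not dominate. -/
lemma weighted_output_low (h : HighHighLow F G H n a b c)
    (h1 : ∀ r, H r ≠ 0 → |r.2| ≤ 1) (hK : c - 10 ≤ a ∨ c - 10 ≤ b) :
    WeightedTriBound F G H ((a + b + c) / 2 - 3 / 2 * n + 20 - c / 8 + 1) := by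
  have hS := measurableSet_low ((2 : ℝ) ^ (2 - n))
  have ha := h.ha
  have hb := h.hb
  have hc := h.hc
  refine WeightedTriBound.of_split h.measF h.measG h.measH hS ?_ ?_
  · obtain ⟨m1, m2, m3⟩ := min_three_le a b c
    exact (((h.indicator hS).triBound_volume (onInter_indicator_low _)).weighted
      (onInter_indicator_low _)).mono (by linarith)
  · have h' := h.indicator hS.compl
    have hge := onInter_indicator_compl_low (F := F) (G := G) (H := H) ((2 : ℝ) ^ (2 - n))
    have h1' : ∀ r, {r : ℝ × ℝ | |r.2| ≤ (2 : ℝ) ^ (2 - n)}ᶜ.indicator H r ≠ 0 → |r.2| ≤ 1 :=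
      fun r hr => h1 r (Set.indicator_apply_ne_zero.1 hr).2
    rcases le_total b a with hab | hab
    · exact h'.weighted_output_low_aux h1' hab (by rcases hK with hK | hK <;> linarith) hge
    · exact ((h'.swap.weighted_output_low_aux h1' hab
        (by rcases hK with hK | hK <;> linarith) hge.swap).swap
          h'.measG h'.measF h'.measH).mono (by linarith)

/-- High-high interaction into low frequencies off the exceptional region when the output
modulation dominates. -/
lemma weighted_output_low_dominant (h : HighHighLow F G H n a b c)
    (h1 : ∀ r, H r ≠ 0 → |r.2| ≤ 1) (hac : a ≤ c - 10) (hbc : b ≤ c - 10)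
    (hD : ∀ r, H r ≠ 0 → r ∉ regionD)
    (hcl : ∀ r, H r ≠ 0 → (2 : ℝ) ^ c ≤ bracket (modulation r)) :
    WeightedTriBound F G H ((a + b + c) / 2 - 3 / 2 * n + 20 -
      min |c - 3 / 2 * n| |c - 2 * n| / 8 + 1) := by
  have hS := measurableSet_low ((2 : ℝ) ^ (-3 : ℝ))
  have e8 : (2 : ℝ) ^ (-3 : ℝ) = 1 / 8 := by rw [Real.rpow_neg (by norm_num)]; norm_num
  have ha := h.ha
  have hb := h.hb
  have hc := h.hc
  have g1 := min_le_left |c - 3 / 2 * n| |c - 2 * n|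
  have g2 := min_le_right |c - 3 / 2 * n| |c - 2 * n|
  obtain ⟨m1, m2, m3⟩ := min_three_le a b c
  refine WeightedTriBound.of_split h.measF h.measG h.measH hS ?_ ?_
  · have h' := h.indicator hS
    have hr1 : OnInter F G ({r : ℝ × ℝ | |r.2| ≤ (2 : ℝ) ^ (-3 : ℝ)}.indicator H) fun _ _ r =>
        |r.2| ≤ (2 : ℝ) ^ ((1 - c) / 3) := fun p q r _ _ _ hr => by
      have hr' := Set.indicator_apply_ne_zero.1 hr
      exact freq_le_of_notMem_regionD (hD r hr'.2) (h.freqH r hr'.2).1 (e8 ▸ hr'.1)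
        (hcl r hr'.2)
    have hr2 : OnInter F G ({r : ℝ × ℝ | |r.2| ≤ (2 : ℝ) ^ (-3 : ℝ)}.indicator H) fun _ _ r =>
        |r.2| ≤ (2 : ℝ) ^ (c + 5 - 2 * n) := fun p q r h0 hp hq hr =>
      (h'.resonance (by linarith) (by linarith) le_rfl p q r h0 hp hq hr).1
    -- The bound 2^((1-c)/3), valid off D, and the resonance bound 2^(c + 5 - 2n) balance at c =
    -- 3n/2. Inserted into the weighted volume estimate, which costs 3/2 of the frequency exponent,
    -- the smaller one gains |c - 3n/2| up to constants.
    rcases abs_cases (c - 3 / 2 * n) with hh | hh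
    · exact ((h'.triBound_volume hr1).weighted hr1).mono (by linarith)
    · exact ((h'.triBound_volume hr2).weighted hr2).mono (by linarith)
  · have h' := h.indicator hS.compl
    have hge := onInter_indicator_compl_low (F := F) (G := G) (H := H) ((2 : ℝ) ^ (-3 : ℝ))
    apply WeightedTriBound.of_inter
    rintro ⟨p, q, r, h0, hp, hq, hr⟩
    have := rpow_two_le_iff.1 ((hge p q r h0 hp hq hr).trans
      (h'.resonance (by linarith) (by linarith) le_rfl p q r h0 hp hq hr).1)
    have hw : OnInter F G ({r : ℝ × ℝ | |r.2| ≤ (2 : ℝ) ^ (-3 : ℝ)}ᶜ.indicator H) fun _ _ r =>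
        |r.2| ≤ (2 : ℝ) ^ (0 : ℝ) := fun p q r _ _ _ hr => by
      rw [Real.rpow_zero]; exact h1 r (Set.indicator_apply_ne_zero.1 hr).2
    refine ((h'.triBound_highHigh hge).weighted hw).mono ?_
    rcases abs_cases (c - 2 * n) with hh | hh <;> linarith

end HighHighLow

/-- The part of the exceptional region in which the modulation is comparable to `|ξ| 2 ^ (2n)`. -/
def resonantRegion (n : ℝ) : Set (ℝ × ℝ) :=
  {p | p ∈ regionD ∧ (2 : ℝ) ^ (2 * n - 5) * |p.2| ≤ bracket (modulation p) ∧
    bracket (modulation p) ≤ (2 : ℝ) ^ (2 * n + 10) * |p.2|}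

/-- In D a dominant modulation 2^c determines the low frequency: resonance bounds it above and
`freq_ge_of_dominant` below, both by 2^(c - 2n) up to constants. The constants in `resonantRegion`
are those of these two bounds, so nothing interacts outside it. -/
lemma HighHighLow.false_of_dominant {F G H : ℝ × ℝ → ℝ≥0∞} {n a b c : ℝ}
    (h : HighHighLow F G H n a b c) (hn : 30 ≤ n) (hac : a ≤ c - 10) (hbc : b ≤ c - 10)
    (hD : ∀ r, H r ≠ 0 → r ∈ regionD ∧ r ∉ resonantRegion n)
    (hcl : ∀ r, H r ≠ 0 → (2 : ℝ) ^ c ≤ bracket (modulation r)) :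
    OnInter F G H fun _ _ _ => False := by
  intro p q r h0 hp hq hr
  have hK := h.modulation_ge (K := c) (by linarith) (by linarith) le_rfl
    ⟨p, q, r, h0, hp, hq, hr⟩
  have h1 := (h.resonance (K := c) (by linarith) (by linarith) le_rfl p q r h0 hp hq hr).1
  have h2 := h.freq_ge_of_dominant (fun r hr => (hD r hr).1) hcl hac hbc (by linarith)
    p q r h0 hp hq hr
  refine (hD r hr).2 ⟨(hD r hr).1, ?_, ?_⟩
  · refine le_trans ?_ (hcl r hr)
    calc (2 : ℝ) ^ (2 * n - 5) * |r.2| ≤ 2 ^ (2 * n - 5) * 2 ^ (c + 5 - 2 * n) := by gcongr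
      _ = 2 ^ c := by rw [← Real.rpow_add (by norm_num)]; congr 1; ring
  · have h3 : bracket (modulation r) ≤ 2 ^ (c + 2) := by
      have := h.modH r hr
      have e : (2 : ℝ) ^ (c + 2) = 2 ^ (c + 1) + 2 ^ (c + 1) := by
        rw [show c + 2 = 1 + (c + 1) by ring, Real.rpow_add (by norm_num), Real.rpow_one]; ring
      have : (1 : ℝ) ≤ 2 ^ (c + 1) := Real.one_le_rpow (by norm_num) (by linarith)
      unfold bracket; linarith
    refine h3.trans ?_
    calc (2 : ℝ) ^ (c + 2) = 2 ^ (2 * n + 10) * 2 ^ (c - 8 - 2 * n) := by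
          rw [← Real.rpow_add (by norm_num)]; congr 1; ring
      _ ≤ _ := by gcongr

/-- All three frequencies are comparable to `2 ^ n`. -/
lemma triBound_comparable {F G H : ℝ × ℝ → ℝ≥0∞} {n a b c : ℝ}
    (mF : Measurable F) (mG : Measurable G) (mH : Measurable H)
    (hF : ModLE F a) (hG : ModLE G b) (hH : ModLE H c) (ha : 0 ≤ a) (hc : 0 ≤ c)
    (hn : 20 ≤ n) (fF : ∀ p, F p ≠ 0 → (2 : ℝ) ^ (n - 11) ≤ |p.2|)
    (fG : ∀ p, G p ≠ 0 → (2 : ℝ) ^ (n - 11) ≤ |p.2|)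
    (fH : ∀ p, H p ≠ 0 → (2 : ℝ) ^ (n - 11) ≤ |p.2|) :
    TriBound F G H ((a + b + c) / 2 - 7 / 4 * n + 30 - min c |c - 3 * n| / 8) := by
  have hone : ∀ x y : ℝ, (2 : ℝ) ^ (n - 11) ≤ |x| → (2 : ℝ) ^ (n - 11) ≤ |y| → 1 ≤ |x * y| := by
    intro x y hx hy
    rw [abs_mul]
    have h1 : (1 : ℝ) ≤ 2 ^ (n - 11) := Real.one_le_rpow (by norm_num) (by linarith)
    nlinarith
  have g1 := min_le_left c |c - 3 * n|
  have g2 := min_le_right c |c - 3 * n|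
  have hres : ∀ K, a ≤ K → b ≤ K → c ≤ K →
      (∃ p q r : ℝ × ℝ, p + q + r = 0 ∧ F p ≠ 0 ∧ G q ≠ 0 ∧ H r ≠ 0) → 3 * n - 34 ≤ K := by
    rintro K hK1 hK2 hK3 ⟨p, q, r, h0, hp, hq, hr⟩
    have hM : ∀ x, x ≤ K → (2 : ℝ) ^ (x + 1) ≤ 2 ^ (K + 1) := fun x hx =>
      Real.rpow_le_rpow_of_exponent_le (by norm_num) (by linarith)
    have hpos : (0 : ℝ) < 2 ^ (n - 11) := by positivity
    have n0 : ∀ x : ℝ, (2 : ℝ) ^ (n - 11) ≤ |x| → x ≠ 0 := fun x hx =>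
      abs_pos.1 (hpos.trans_le hx)
    have h1 := (resonance_upper h0 (n0 _ (fF p hp)) (n0 _ (fG q hq)) (n0 _ (fH r hr))
      ((hF p hp).trans (hM a hK1)) ((hG q hq).trans (hM b hK2))
      ((hH r hr).trans (hM c hK3))).1
    have h2 : (2 : ℝ) ^ (3 * (n - 11)) ≤ |p.2 * q.2 * r.2| := by
      rw [show 3 * (n - 11) = (n - 11) + (n - 11) + (n - 11) by ring, Real.rpow_add (by norm_num),
        Real.rpow_add (by norm_num), abs_mul, abs_mul]
      have := fF p hp
      have := fG q hq
      have := fH r hr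
      gcongr
    have := rpow_two_le_iff.1 (h2.trans h1)
    linarith
  apply TriBound.of_inter
  intro hex
  have mm : ∀ x y : ℝ, min x y / 2 + max x y / 4 ≤ (x + y) / 2 - max x y / 4 := fun x y => by
    linarith [min_add_max x y]
  -- The largest modulation is at least 2^(3n - 34), which gives 3n/2. The square-root estimate for
  -- the other two functions gives the remaining n/4 and leaves a quarter of the larger of their
  -- modulations, enough to pay c/8 when c does not dominate.
  rcases max_three_cases a b c with hK | hK | hK
  · have hk := hres a le_rfl hK.1 hK.2 hex
    have := triBound_square (n := n - 11) mG mH mF hG hH fun p q r _ hp hq hr =>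
      ⟨hone _ _ (fG p hp) (fH q hq), fF r hr⟩
    refine ((this.rot.swap mG mF mH).mono ?_)
    have := mm b c
    have := le_max_right b c
    linarith
  · have hk := hres b hK.1 le_rfl hK.2 hex
    have := triBound_square (n := n - 11) mF mH mG hF hH fun p q r _ hp hq hr =>
      ⟨hone _ _ (fF p hp) (fH q hq), fG r hr⟩
    refine (this.rot.mono ?_)
    have := mm a c
    have := le_max_right a c
    linarith
  · have hk := hres c hK.1 hK.2 le_rfl hex
    have := triBound_square (n := n - 11) mF mG mH hF hG fun p q r _ hp hq hr =>
      ⟨hone _ _ (fF p hp) (fG q hq), fH r hr⟩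
    refine this.mono ?_
    have := mm a b
    have : 0 ≤ max a b := ha.trans (le_max_left a b)
    rcases abs_cases (c - 3 * n) with hh | hh <;> linarith

end Ostrovsky

end

noncomputable section

namespace Ostrovsky

/-! ### Dyadic shells -/

lemma one_le_bracket (x : ℝ) : 1 ≤ bracket x := by
  unfold bracket; linarith [abs_nonneg x]

lemma bracket_pos (x : ℝ) : 0 < bracket x := zero_lt_one.trans_le (one_le_bracket x)

lemma bracket_neg (x : ℝ) : bracket (-x) = bracket x := by simp [bracket]

lemma modulation_neg (p : ℝ × ℝ) : modulation (-p) = -modulation p := by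
  simp only [modulation, Prod.fst_neg, Prod.snd_neg, div_neg]; ring

lemma neg_mem_shellB {k : ℕ} {p : ℝ × ℝ} : -p ∈ shellB k ↔ p ∈ shellB k := by
  simp only [shellB, Set.mem_ofPred_eq, modulation_neg, bracket_neg]

lemma neg_mem_shellA {k : ℕ} {p : ℝ × ℝ} : -p ∈ shellA k ↔ p ∈ shellA k := by
  simp only [shellA, Set.mem_ofPred_eq, Prod.snd_neg, bracket_neg]

lemma neg_mem_regionD {p : ℝ × ℝ} : -p ∈ regionD ↔ p ∈ regionD := by
  simp only [regionD, Set.mem_ofPred_eq, Prod.snd_neg, Prod.fst_neg, abs_neg]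

lemma neg_mem_resonantRegion {n : ℝ} {p : ℝ × ℝ} :
    -p ∈ resonantRegion n ↔ p ∈ resonantRegion n := by
  simp only [resonantRegion, Set.mem_ofPred_eq, neg_mem_regionD, Prod.snd_neg, abs_neg,
    modulation_neg, bracket_neg]

lemma measurable_bracket : Measurable bracket := by
  unfold bracket; fun_prop

lemma measurable_bracket_modulation : Measurable fun p => bracket (modulation p) :=
  measurable_bracket.comp measurable_modulation

lemma measurableSet_shellB (k : ℕ) : MeasurableSet (shellB k) :=
  (measurableSet_le measurable_const measurable_bracket_modulation).inter
    (measurableSet_lt measurable_bracket_modulation measurable_const)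

lemma measurableSet_shellA (k : ℕ) : MeasurableSet (shellA k) :=
  (measurableSet_le measurable_const (measurable_bracket.comp measurable_snd)).inter
    (measurableSet_lt (measurable_bracket.comp measurable_snd) measurable_const)

lemma measurableSet_regionD : MeasurableSet regionD :=
  (measurableSet_le (show Measurable fun p : ℝ × ℝ => |p.2| by fun_prop)
    (measurable_const (a := 1 / 8))).inter (measurableSet_le
      (show Measurable fun p : ℝ × ℝ => (|p.2| ^ 3)⁻¹ by fun_prop)
      (show Measurable fun p : ℝ × ℝ => |p.1| by fun_prop))

lemma measurableSet_resonantRegion (n : ℝ) : MeasurableSet (resonantRegion n) :=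
  measurableSet_regionD.inter ((measurableSet_le (by fun_prop) measurable_bracket_modulation).inter
    (measurableSet_le measurable_bracket_modulation (by fun_prop)))

lemma dyadic_unique {x : ℝ} {k l : ℕ} (h : (2 : ℝ) ^ k ≤ x ∧ x < 2 ^ (k + 1))
    (h' : (2 : ℝ) ^ l ≤ x ∧ x < 2 ^ (l + 1)) : k = l := by
  have h1 := (pow_lt_pow_iff_right₀ (by norm_num : (1 : ℝ) < 2)).1 (h.1.trans_lt h'.2)
  have h2 := (pow_lt_pow_iff_right₀ (by norm_num : (1 : ℝ) < 2)).1 (h'.1.trans_lt h.2)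
  omega

lemma exists_mem_shellB (p : ℝ × ℝ) : ∃ k, p ∈ shellB k :=
  exists_nat_pow_near (one_le_bracket _) (by norm_num)

lemma tsum_indicator_shellB (F : ℝ × ℝ → ℝ≥0∞) (p : ℝ × ℝ) : ∑' k, (shellB k).indicator F p = F p := by
  obtain ⟨k, hk⟩ := exists_mem_shellB p
  rw [tsum_eq_single k fun l hl =>
    Set.indicator_of_notMem (fun h : p ∈ shellB l => hl (dyadic_unique h hk)) F, Set.indicator_of_mem hk]

/-- The bracket of the modulation in `[0, ∞]`. -/
def modWeight (p : ℝ × ℝ) : ℝ≥0∞ := ENNReal.ofReal (bracket (modulation p))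

/-- The bracket of the frequency in `[0, ∞]`. -/
def freqWeight (p : ℝ × ℝ) : ℝ≥0∞ := ENNReal.ofReal (bracket p.2)

lemma measurable_modWeight : Measurable modWeight :=
  measurable_bracket_modulation.ennreal_ofReal

lemma modWeight_ne_zero (p : ℝ × ℝ) : modWeight p ≠ 0 :=
  (ENNReal.ofReal_pos.2 (bracket_pos _)).ne'

lemma modWeight_ne_top (p : ℝ × ℝ) : modWeight p ≠ ∞ := ENNReal.ofReal_ne_top

lemma ofReal_two_pow (k : ℕ) : ENNReal.ofReal ((2 : ℝ) ^ k) = e2 k := by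
  rw [e2_eq_ofReal, Real.rpow_natCast]

lemma e2_le_modWeight {k : ℕ} {p : ℝ × ℝ} (h : p ∈ shellB k) : e2 k ≤ modWeight p := by
  rw [← ofReal_two_pow]; exact ENNReal.ofReal_le_ofReal h.1

lemma e2_le_freqWeight {j : ℕ} {p : ℝ × ℝ} (h : p ∈ shellA j) : e2 j ≤ freqWeight p := by
  rw [← ofReal_two_pow]; exact ENNReal.ofReal_le_ofReal h.1

lemma freqWeight_le {j : ℕ} {p : ℝ × ℝ} (h : p ∈ shellA j) : freqWeight p ≤ e2 (j + 1) := by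
  have := ENNReal.ofReal_le_ofReal h.2.le
  rw [ofReal_two_pow] at this
  exact_mod_cast this

lemma rpow_neg_anti {x y : ℝ≥0∞} {s : ℝ} (hs : s ≤ 0) (h : x ≤ y) : y ^ s ≤ x ^ s := by
  rw [← neg_neg s, ENNReal.rpow_neg, ENNReal.rpow_neg x]
  exact ENNReal.inv_le_inv.2 (ENNReal.rpow_le_rpow h (by linarith))

lemma enorm_weighted (s b : ℝ) (f : ℝ × ℝ → ℂ) (p : ℝ × ℝ) :
    ‖weighted s b f p‖ₑ = freqWeight p ^ s * modWeight p ^ b * ‖f p‖ₑ := by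
  rw [weighted, enorm_mul, freqWeight, modWeight, ENNReal.ofReal_rpow_of_pos (bracket_pos _),
    ENNReal.ofReal_rpow_of_pos (bracket_pos _), ← ENNReal.ofReal_mul (by
      have := bracket_pos p.2; positivity)]
  congr 1
  rw [← ofReal_norm, Complex.norm_real, Real.norm_of_nonneg]
  have := bracket_pos p.2
  have := bracket_pos (modulation p)
  positivity

lemma eLpNorm_two_eq_l2 {α : Type*} [MeasurableSpace α] (μ : Measure α) (h : α → ℂ) :
    eLpNorm h 2 μ = l2 μ fun p => ‖h p‖ₑ := by
  rw [eLpNorm_eq_lintegral_rpow_enorm_toReal (by norm_num) (by norm_num)]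
  simp [l2]

lemma l2_restrict {α : Type*} [MeasurableSpace α] (μ : Measure α) {S : Set α}
    (hS : MeasurableSet S) (F : α → ℝ≥0∞) : l2 (μ.restrict S) F = l2 μ (S.indicator F) := by
  rw [l2, l2, ← lintegral_indicator hS]
  congr 2; ext p
  by_cases hp : p ∈ S <;> simp [hp]

/-! ### Dyadic norms of `[0, ∞]`-valued functions -/

/-- The `ℓ¹` norm of the weighted dyadic pieces. -/
def normOne (F : ℝ × ℝ → ℝ≥0∞) : ℝ≥0∞ :=
  ∑' k : ℕ, e2 ((k : ℝ) / 2) * l2 volume ((shellB k).indicator F)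

/-- The supremum of the norms of the weighted dyadic pieces. -/
def normSup (F : ℝ × ℝ → ℝ≥0∞) : ℝ≥0∞ :=
  ⨆ k : ℕ, e2 ((k : ℝ) / 2) * l2 volume ((shellB k).indicator F)

/-- The `ℓ¹` norm of the dyadic pieces with the dual weight. -/
def normDual (F : ℝ × ℝ → ℝ≥0∞) : ℝ≥0∞ :=
  ∑' k : ℕ, e2 (-(k : ℝ) / 2) * l2 volume ((shellB k).indicator F)

section

variable {F G : ℝ × ℝ → ℝ≥0∞} {f : ℝ × ℝ → ℂ} {j : ℕ}

lemma e2_half_mul_le_weighted (hF : F =ᵐ[volume] fun p => ‖f p‖ₑ)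
    (hA : ∀ p, F p ≠ 0 → p ∈ shellA j) (k : ℕ) :
    e2 ((k : ℝ) / 2) * l2 volume ((shellB k).indicator F) ≤ e2 (3 / 4 * (j + 1)) *
      l2 volume ((shellA j ∩ shellB k).indicator fun p => ‖weighted (-3 / 4) (1 / 2) f p‖ₑ) := by
  rw [← l2_const_mul (e2_ne_top _), ← l2_const_mul (e2_ne_top _)]
  have h1 : (fun p => e2 ((k : ℝ) / 2) * (shellB k).indicator F p) =ᵐ[volume]
      fun p => e2 ((k : ℝ) / 2) * (shellA j ∩ shellB k).indicator (fun p => ‖f p‖ₑ) p := by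
    filter_upwards [hF] with p hp
    by_cases hB : p ∈ shellB k
    · by_cases hA' : p ∈ shellA j
      · simp [hB, hA', hp]
      · have : F p = 0 := by
          by_contra h
          exact hA' (hA p h)
        simp [hB, hA', this]
    · simp [hB]
  rw [l2_congr h1]
  refine l2_mono fun p => ?_
  by_cases hp : p ∈ shellA j ∩ shellB k
  · simp only [Set.indicator_of_mem hp, enorm_weighted]
    rw [← mul_assoc]
    gcongr
    have a1 : e2 (-(3 / 4 * ((j : ℝ) + 1))) ≤ freqWeight p ^ (-3 / 4 : ℝ) := by
      have := rpow_neg_anti (s := -3 / 4) (by norm_num) (freqWeight_le hp.1)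
      rw [e2_rpow] at this
      convert this using 2; ring
    have a2 : e2 ((k : ℝ) / 2) ≤ modWeight p ^ (1 / 2 : ℝ) := by
      have := ENNReal.rpow_le_rpow (z := 1 / 2) (e2_le_modWeight hp.2) (by norm_num)
      rw [e2_rpow] at this
      convert this using 2; ring
    calc e2 ((k : ℝ) / 2) = e2 (3 / 4 * (j + 1)) *
          (e2 (-(3 / 4 * ((j : ℝ) + 1))) * e2 ((k : ℝ) / 2)) := by
          rw [← mul_assoc, e2_mul_neg, one_mul]
      _ ≤ _ := by gcongr
  · simp [hp]

lemma normOne_le (hF : F =ᵐ[volume] fun p => ‖f p‖ₑ) (hA : ∀ p, F p ≠ 0 → p ∈ shellA j) :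
    normOne F ≤ e2 (3 / 4 * (j + 1)) * normXsb1 (-3 / 4) (1 / 2) f := by
  calc normOne F ≤ ∑' k : ℕ, e2 (3 / 4 * (j + 1)) * eLpNorm (weighted (-3 / 4) (1 / 2) f) 2
        (volume.restrict (shellA j ∩ shellB k)) := by
        refine ENNReal.tsum_le_tsum fun k => ?_
        rw [eLpNorm_two_eq_l2,
          l2_restrict _ ((measurableSet_shellA j).inter (measurableSet_shellB k))]
        exact e2_half_mul_le_weighted hF hA k
    _ = e2 (3 / 4 * (j + 1)) * ∑' k : ℕ, eLpNorm (weighted (-3 / 4) (1 / 2) f) 2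
        (volume.restrict (shellA j ∩ shellB k)) := ENNReal.tsum_mul_left
    _ ≤ _ := by
      gcongr
      rw [normXsb1]
      refine le_trans ?_ (ENNReal.rpow_le_rpow (ENNReal.le_tsum j) (by norm_num))
      rw [← ENNReal.rpow_natCast, ← ENNReal.rpow_mul]
      norm_num

lemma normSup_le (hF : F =ᵐ[volume] fun p => ‖f p‖ₑ) (hA : ∀ p, F p ≠ 0 → p ∈ shellA j) :
    normSup F ≤ e2 (3 / 4 * (j + 1)) * normXsb (-3 / 4) (1 / 2) f := by
  refine iSup_le fun k => (e2_half_mul_le_weighted hF hA k).trans ?_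
  rw [normXsb, eLpNorm_two_eq_l2]
  gcongr
  exact l2_indicator_le

lemma normSup_le_normOne : normSup F ≤ normOne F :=
  iSup_le fun k => ENNReal.le_tsum k

lemma normSup_add_le (hF : Measurable F) (hG : Measurable G) :
    normSup (fun p => F p + G p) ≤ normSup F + normSup G := by
  refine iSup_le fun k => ?_
  calc _ ≤ e2 ((k : ℝ) / 2) * (l2 volume ((shellB k).indicator F) +
        l2 volume ((shellB k).indicator G)) := by
        gcongr
        refine le_trans (le_of_eq ?_) (l2_add_le (hF.indicator (measurableSet_shellB k))
          (hG.indicator (measurableSet_shellB k)))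
        congr 1
        exact Set.indicator_add' (shellB k) F G
    _ ≤ _ := by
      rw [mul_add]
      exact add_le_add (le_iSup (fun k : ℕ => e2 ((k : ℝ) / 2) *
        l2 volume ((shellB k).indicator F)) k) (le_iSup (fun k : ℕ => e2 ((k : ℝ) / 2) *
        l2 volume ((shellB k).indicator G)) k)

/-- Once a trilinear bound has summable decay in an input modulation, the supremum over shells
suffices. This is how the ℓ²-type control of an input in D becomes usable. -/
lemma tsum_mul_le_normSup (v : ℕ → ℝ≥0∞) :
    ∑' k : ℕ, v k * (e2 ((k : ℝ) / 2) * l2 volume ((shellB k).indicator F)) ≤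
      (∑' k, v k) * normSup F := by
  rw [← ENNReal.tsum_mul_right]
  refine ENNReal.tsum_le_tsum fun k => ?_
  gcongr
  exact le_iSup (fun k : ℕ => e2 ((k : ℝ) / 2) * l2 volume ((shellB k).indicator F)) k

/-! ### From trilinear bounds to dyadic norms of the convolution -/

lemma lconv_eq_tsum (hF : Measurable F) (hG : Measurable G) (r : ℝ × ℝ) :
    lconv F G r = ∑' a : ℕ, ∑' b : ℕ,
      lconv ((shellB a).indicator F) ((shellB b).indicator G) r := by
  have h1 : ∀ p, F p * G (r - p) = ∑' a : ℕ, ∑' b : ℕ,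
      (shellB a).indicator F p * (shellB b).indicator G (r - p) := by
    intro p
    simp_rw [ENNReal.tsum_mul_left, tsum_indicator_shellB, ENNReal.tsum_mul_right,
      tsum_indicator_shellB]
  have hm : ∀ a b : ℕ, Measurable fun p =>
      (shellB a).indicator F p * (shellB b).indicator G (r - p) := fun a b =>
    (hF.indicator (measurableSet_shellB a)).mul
      ((hG.indicator (measurableSet_shellB b)).comp (measurable_const.sub measurable_id))
  simp only [lconv, h1]
  rw [lintegral_tsum fun a => (Measurable.tsum fun b => hm a b).aemeasurable]
  congr 1; ext a
  rw [lintegral_tsum fun b => (hm a b).aemeasurable]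

lemma triForm_eq_tsum (hF : Measurable F) (hG : Measurable G) {X : ℝ × ℝ → ℝ≥0∞}
    (hX : Measurable X) : triForm F G X = ∑' a : ℕ, ∑' b : ℕ,
      triForm ((shellB a).indicator F) ((shellB b).indicator G) X := by
  have hFa := fun a => hF.indicator (measurableSet_shellB a)
  have hGb := fun b => hG.indicator (measurableSet_shellB b)
  have hm : ∀ a b : ℕ, Measurable fun r =>
      lconv ((shellB a).indicator F) ((shellB b).indicator G) r * X (-r) := fun a b =>
    (measurable_lconv (hFa a) (hGb b)).mul (hX.comp measurable_neg)
  rw [triForm_eq_lconv hF hG hX]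
  simp_rw [triForm_eq_lconv (hFa _) (hGb _) hX, lconv_eq_tsum hF hG, ← ENNReal.tsum_mul_right]
  rw [lintegral_tsum fun a => (Measurable.tsum fun b => hm a b).aemeasurable]
  congr 1; ext a
  rw [lintegral_tsum fun b => (hm a b).aemeasurable]

/-- The trilinear form sees the output at -r, so the test function is reflected; S and W are even,
which makes the reflection harmless. -/
lemma l2_lconv_le_of_dual (hF : Measurable F) (hG : Measurable G) {S : Set (ℝ × ℝ)}
    (hS : MeasurableSet S) (hneg : ∀ r, -r ∈ S ↔ r ∈ S) {K : ℝ≥0∞} {W : ℝ × ℝ → ℝ≥0∞}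
    (hW : Measurable W) (hWneg : ∀ r, W (-r) = W r)
    (h : ∀ H, Measurable H → (∀ r, H r ≠ 0 → r ∈ S ∧ W r ≠ 0) →
      triForm F G (fun r => W r * H r) ≤ K * l2 volume H) :
    l2 volume (S.indicator fun r => W r * lconv F G r) ≤ K := by
  apply l2_le_of_forall ((show Measurable fun r => W r * lconv F G r from
    hW.mul (measurable_lconv hF hG)).indicator hS)
  intro H hH hHS
  have hH' : Measurable fun r => H (-r) := hH.comp measurable_neg
  have h1 := h (fun r => H (-r)) hH' fun r hr => by
    have := Set.indicator_apply_ne_zero.1 (hHS _ hr)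
    refine ⟨(hneg r).1 this.1, fun h0 => this.2 ?_⟩
    simp only [hWneg, h0, zero_mul]
  have h2 : l2 volume (fun r => H (-r)) = l2 volume H := by
    rw [l2, l2, lintegral_neg_eq_self fun r => H r ^ 2]
  rw [h2, triForm_eq_lconv hF hG (show Measurable fun r => W r * H (-r) from hW.mul hH')] at h1
  refine le_trans (lintegral_mono fun r => ?_) h1
  calc _ ≤ W r * lconv F G r * H r := by
        gcongr
        exact Set.indicator_le_self' (fun _ _ => zero_le) _
    _ = _ := by rw [neg_neg, hWneg]; ring

/-- Summation of localized trilinear bounds. -/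
lemma normDual_lconv_le (hF : Measurable F) (hG : Measurable G) {Q : Set (ℝ × ℝ)}
    (hQ : MeasurableSet Q) (hneg : ∀ r, -r ∈ Q ↔ r ∈ Q) (E : ℝ) (γ₁ γ₂ γ₃ : ℕ → ℝ)
    (h : ∀ (a b k : ℕ) (H : ℝ × ℝ → ℝ≥0∞), Measurable H →
      (∀ r, H r ≠ 0 → r ∈ Q ∧ r ∈ shellB k ∧ r.2 ≠ 0) →
      WeightedTriBound ((shellB a).indicator F) ((shellB b).indicator G) H
        (((a : ℝ) + b + k) / 2 + E - γ₁ k - γ₂ a - γ₃ b)) :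
    normDual (Q.indicator fun r => ‖r.2‖ₑ * lconv F G r) ≤
      e2 E * (∑' k, e2 (-γ₁ k)) *
        (∑' a : ℕ, e2 (-γ₂ a) * (e2 ((a : ℝ) / 2) * l2 volume ((shellB a).indicator F))) *
        (∑' b : ℕ, e2 (-γ₃ b) * (e2 ((b : ℝ) / 2) * l2 volume ((shellB b).indicator G))) := by
  set x : ℕ → ℝ≥0∞ := fun a =>
    e2 (-γ₂ a) * (e2 ((a : ℝ) / 2) * l2 volume ((shellB a).indicator F))
  set y : ℕ → ℝ≥0∞ := fun b =>
    e2 (-γ₃ b) * (e2 ((b : ℝ) / 2) * l2 volume ((shellB b).indicator G))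
  have key : ∀ k : ℕ, e2 (-(k : ℝ) / 2) * l2 volume
      ((shellB k).indicator (Q.indicator fun r => ‖r.2‖ₑ * lconv F G r)) ≤
      e2 (-γ₁ k) * (e2 E * (∑' a, x a) * ∑' b, y b) := by
    intro k
    rw [Set.indicator_indicator]
    have := l2_lconv_le_of_dual hF hG ((measurableSet_shellB k).inter hQ)
      (fun r => and_congr neg_mem_shellB (hneg r)) (W := fun r => ‖r.2‖ₑ) (by fun_prop)
      (fun r => by simp) (K := e2 ((k : ℝ) / 2) * (e2 (-γ₁ k) * (e2 E * (∑' a, x a) * ∑' b, y b)))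
      ?_
    · calc _ ≤ e2 (-(k : ℝ) / 2) *
          (e2 ((k : ℝ) / 2) * (e2 (-γ₁ k) * (e2 E * (∑' a, x a) * ∑' b, y b))) := by gcongr
        _ = _ := by
          rw [← mul_assoc, ← e2_add]
          rw [show -(k : ℝ) / 2 + k / 2 = 0 by ring, e2_zero, one_mul]
    · intro H hH hHS
      rw [triForm_eq_tsum hF hG (by fun_prop)]
      calc _ ≤ ∑' a : ℕ, ∑' b : ℕ, e2 ((k : ℝ) / 2 + -γ₁ k + E) * (x a * y b) * l2 volume H := by
            refine ENNReal.tsum_le_tsum fun a => ENNReal.tsum_le_tsum fun b => ?_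
            refine (h a b k H hH fun r hr => ⟨(hHS r hr).1.2, (hHS r hr).1.1, ?_⟩).trans ?_
            · exact fun h0 => (hHS r hr).2 (by simp [h0])
            · apply le_of_eq
              rw [show ((a : ℝ) + b + k) / 2 + E - γ₁ k - γ₂ a - γ₃ b =
                (k / 2 + -γ₁ k + E) + (-γ₂ a) + (a / 2) + (-γ₃ b) + (b / 2) by ring,
                e2_add _ ((b : ℝ) / 2), e2_add _ (-γ₃ b), e2_add _ ((a : ℝ) / 2),
                e2_add _ (-γ₂ a)]
              simp only [x, y]
              ring
        _ = _ := by
          simp_rw [ENNReal.tsum_mul_right, ENNReal.tsum_mul_left, ENNReal.tsum_mul_right]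
          rw [e2_add, e2_add]
          ring
  calc _ ≤ ∑' k, e2 (-γ₁ k) * (e2 E * (∑' a, x a) * ∑' b, y b) := ENNReal.tsum_le_tsum key
    _ = _ := by rw [ENNReal.tsum_mul_right]; ring

end

end Ostrovsky

end

noncomputable section

namespace Ostrovsky

/-! ### Bounds for the output norms -/

lemma modWeight_rpow_neg_half_sq (p : ℝ × ℝ) :
    modWeight p ^ (-1 / 2 : ℝ) * modWeight p ^ (-1 / 2 : ℝ) = (modWeight p)⁻¹ := by
  rw [← ENNReal.rpow_add _ _ (modWeight_ne_zero p) (modWeight_ne_top p), ← ENNReal.rpow_neg_one]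
  norm_num

lemma measurable_modWeight_rpow (s : ℝ) : Measurable fun p => modWeight p ^ s :=
  measurable_modWeight.pow_const s

lemma measurable_fiber {V : ℝ × ℝ → ℝ≥0∞} (hV : Measurable V) (ξ : ℝ) :
    Measurable fun τ : ℝ => V (τ, ξ) :=
  hV.comp measurable_prodMk_right

section

variable {V : ℝ × ℝ → ℝ≥0∞} {Z : Set (ℝ × ℝ)} {c : ℝ}

/-- Cauchy-Schwarz in τ at fixed ξ, with the inverse weight split into two square roots. One half
integrates over the fibre of Z to at most 2^c, the other stays with V. -/
lemma l2_fiber_le (hV : Measurable V) (hZ : MeasurableSet Z) (hVZ : ∀ p, V p ≠ 0 → p ∈ Z)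
    (hc : ∀ ξ : ℝ, ∫⁻ τ : ℝ, Z.indicator (fun p => (modWeight p)⁻¹) (τ, ξ) ≤ e2 c) :
    l2 volume (fun ξ : ℝ => ∫⁻ τ : ℝ, (modWeight (τ, ξ))⁻¹ * V (τ, ξ)) ≤
      e2 (c / 2) * l2 volume fun p => modWeight p ^ (-1 / 2 : ℝ) * V p := by
  have hY : Measurable fun p => modWeight p ^ (-1 / 2 : ℝ) * V p :=
    (measurable_modWeight_rpow _).mul hV
  have hX : Measurable (Z.indicator fun p => modWeight p ^ (-1 / 2 : ℝ)) :=
    (measurable_modWeight_rpow _).indicator hZ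
  have h1 : ∀ ξ : ℝ, ∫⁻ τ : ℝ, (modWeight (τ, ξ))⁻¹ * V (τ, ξ) ≤
      e2 (c / 2) * l2 volume fun τ : ℝ => modWeight (τ, ξ) ^ (-1 / 2 : ℝ) * V (τ, ξ) := by
    intro ξ
    have e : ∀ τ : ℝ, (modWeight (τ, ξ))⁻¹ * V (τ, ξ) =
        (Z.indicator fun p => modWeight p ^ (-1 / 2 : ℝ)) (τ, ξ) *
          (modWeight (τ, ξ) ^ (-1 / 2 : ℝ) * V (τ, ξ)) := by
      intro τ
      by_cases hp : (τ, ξ) ∈ Z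
      · rw [Set.indicator_of_mem hp, ← mul_assoc, modWeight_rpow_neg_half_sq]
      · have : V (τ, ξ) = 0 := by
          by_contra h
          exact hp (hVZ _ h)
        simp [this]
    simp_rw [e]
    refine (lintegral_mul_le_l2 (measurable_fiber hX ξ).aemeasurable
      (measurable_fiber hY ξ).aemeasurable).trans ?_
    gcongr
    calc _ = (∫⁻ τ : ℝ, Z.indicator (fun p => (modWeight p)⁻¹) (τ, ξ)) ^ (1 / 2 : ℝ) := by
          rw [l2]
          congr 2; ext τ
          by_cases hp : (τ, ξ) ∈ Z
          · rw [Set.indicator_of_mem hp, Set.indicator_of_mem hp, sq, modWeight_rpow_neg_half_sq]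
          · simp [hp]
      _ ≤ e2 c ^ (1 / 2 : ℝ) := ENNReal.rpow_le_rpow (hc ξ) (by norm_num)
      _ = _ := by rw [e2_rpow]; congr 1; ring
  refine (l2_mono h1).trans ?_
  rw [l2_const_mul (e2_ne_top _)]
  gcongr
  apply le_of_eq
  rw [l2, l2]
  congr 1
  simp_rw [l2_sq]
  exact (lintegral_prod_symm _ (hY.pow_const 2).aemeasurable).symm

/-- On the fibre the integrand is at most 1/A, and τ lies in an interval of length 2A · 2^y; the
scale A cancels. -/
lemma lintegral_fiber_le {ξ A y : ℝ} (hA : 0 < A) (h : ∀ τ : ℝ, (τ, ξ) ∈ Z →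
    A ≤ bracket (modulation (τ, ξ)) ∧ bracket (modulation (τ, ξ)) ≤ A * 2 ^ y) :
    ∫⁻ τ : ℝ, Z.indicator (fun p => (modWeight p)⁻¹) (τ, ξ) ≤ e2 (1 + y) := by
  set S := Set.Icc (dispersion ξ - A * 2 ^ y) (dispersion ξ + A * 2 ^ y)
  calc _ ≤ ∫⁻ τ : ℝ, S.indicator (fun _ => ENNReal.ofReal A⁻¹) τ := by
        refine lintegral_mono fun τ => ?_
        by_cases hp : (τ, ξ) ∈ Z
        · have hτ : τ ∈ S := by
            have h2 := (h τ hp).2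
            rw [bracket, modulation_eq] at h2
            have h3 : |τ - dispersion ξ| ≤ A * 2 ^ y := by simp only at h2; linarith
            have := abs_le.1 h3
            constructor <;> linarith
          rw [Set.indicator_of_mem hp, Set.indicator_of_mem hτ, modWeight,
            ← ENNReal.ofReal_inv_of_pos (bracket_pos _)]
          exact ENNReal.ofReal_le_ofReal (inv_anti₀ hA (h τ hp).1)
        · rw [Set.indicator_of_notMem hp]; exact zero_le
    _ = ENNReal.ofReal A⁻¹ * ENNReal.ofReal (2 * (A * 2 ^ y)) := by
      rw [lintegral_indicator measurableSet_Icc, setLIntegral_const, Real.volume_Icc]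
      congr 2; ring
    _ = _ := by
      rw [← ENNReal.ofReal_mul (by positivity), ← ofReal_two_mul]
      congr 1
      field_simp

lemma lintegral_fiber_shellB_le (k : ℕ) (ξ : ℝ) :
    ∫⁻ τ : ℝ, (shellB k).indicator (fun p => (modWeight p)⁻¹) (τ, ξ) ≤ e2 2 := by
  refine (lintegral_fiber_le (A := 2 ^ k) (y := 1) (by positivity) fun τ hτ => ⟨hτ.1, ?_⟩).trans
    (le_of_eq (by norm_num))
  rw [Real.rpow_one, ← pow_succ]
  exact hτ.2.le

/-- At fixed ξ the modulation ranges over a window of ratio 2^15, since (2n + 10) - (2n - 5) = 15,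
so the bound is uniform in n and ξ. The fibre over ξ = 0 is empty because the bracket is positive.
-/
lemma lintegral_fiber_resonantRegion_le (n ξ : ℝ) :
    ∫⁻ τ : ℝ, (resonantRegion n).indicator (fun p => (modWeight p)⁻¹) (τ, ξ) ≤ e2 16 := by
  rcases eq_or_ne ξ 0 with rfl | hξ
  · have : ∀ τ : ℝ, (τ, (0 : ℝ)) ∉ resonantRegion n := by
      intro τ hτ
      have := hτ.2.2
      simp only [abs_zero, mul_zero] at this
      linarith [bracket_pos (modulation (τ, 0))]
    simp [this]
  · have hpos : 0 < |ξ| := abs_pos.2 hξ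
    refine (lintegral_fiber_le (A := 2 ^ (2 * n - 5) * |ξ|) (y := 15) (by positivity)
      fun τ hτ => ⟨hτ.2.1, hτ.2.2.trans (le_of_eq ?_)⟩).trans (le_of_eq (by norm_num))
    rw [mul_right_comm, ← Real.rpow_add (by norm_num)]
    congr 2
    ring

lemma l2_modWeight_shellB_le (k : ℕ) :
    l2 volume (fun p => modWeight p ^ (-1 / 2 : ℝ) * (shellB k).indicator V p) ≤
      e2 (-(k : ℝ) / 2) * l2 volume ((shellB k).indicator V) := by
  rw [← l2_const_mul (e2_ne_top _)]
  refine l2_mono fun p => ?_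
  by_cases hp : p ∈ shellB k
  · gcongr
    have := rpow_neg_anti (s := -1 / 2) (by norm_num) (e2_le_modWeight hp)
    rw [e2_rpow, show (k : ℝ) * (-1 / 2) = -(k : ℝ) / 2 by ring] at this
    simpa only [Set.indicator_of_mem hp] using this
  · simp [hp]

lemma l2_modWeight_le_normDual (hV : Measurable V) :
    l2 volume (fun p => modWeight p ^ (-1 / 2 : ℝ) * V p) ≤ normDual V := by
  have : (fun p => modWeight p ^ (-1 / 2 : ℝ) * V p) = fun p =>
      ∑' k : ℕ, modWeight p ^ (-1 / 2 : ℝ) * (shellB k).indicator V p := by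
    ext p
    rw [ENNReal.tsum_mul_left, tsum_indicator_shellB]
  rw [this]
  refine (l2_tsum_le fun k => (measurable_modWeight_rpow _).mul
    (hV.indicator (measurableSet_shellB k))).trans ?_
  exact ENNReal.tsum_le_tsum fun k => l2_modWeight_shellB_le k

lemma l2_fiber_le_normDual (hV : Measurable V) :
    l2 volume (fun ξ : ℝ => ∫⁻ τ : ℝ, (modWeight (τ, ξ))⁻¹ * V (τ, ξ)) ≤
      e2 1 * normDual V := by
  have hm : ∀ k, Measurable fun p => (modWeight p)⁻¹ * (shellB k).indicator V p := fun k =>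
    measurable_modWeight.inv.mul (hV.indicator (measurableSet_shellB k))
  have : (fun ξ : ℝ => ∫⁻ τ : ℝ, (modWeight (τ, ξ))⁻¹ * V (τ, ξ)) = fun ξ : ℝ =>
      ∑' k : ℕ, ∫⁻ τ : ℝ, (modWeight (τ, ξ))⁻¹ * (shellB k).indicator V (τ, ξ) := by
    ext ξ
    rw [← lintegral_tsum fun k => (measurable_fiber (hm k) ξ).aemeasurable]
    simp_rw [ENNReal.tsum_mul_left, tsum_indicator_shellB]
  rw [this]
  refine (l2_tsum_le fun k => (hm k).lintegral_prod_left').trans ?_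
  rw [normDual, ← ENNReal.tsum_mul_left]
  refine ENNReal.tsum_le_tsum fun k => ?_
  refine (l2_fiber_le (hV.indicator (measurableSet_shellB k)) (measurableSet_shellB k)
    (fun p hp => (Set.indicator_apply_ne_zero.1 hp).1) (lintegral_fiber_shellB_le k)).trans ?_
  rw [show (2 : ℝ) / 2 = 1 by norm_num]
  gcongr
  exact l2_modWeight_shellB_le k

end

section

variable {u : ℝ × ℝ → ℂ} {j : ℕ} {U₁ U₂ : ℝ × ℝ → ℝ≥0∞} {Z : Set (ℝ × ℝ)}

lemma freqWeight_rpow_le {p : ℝ × ℝ} (h : p ∈ shellA j) :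
    freqWeight p ^ (-3 / 4 : ℝ) ≤ e2 (-(3 / 4) * j) := by
  have := rpow_neg_anti (s := -3 / 4) (by norm_num) (e2_le_freqWeight h)
  rw [e2_rpow] at this
  convert this using 2; ring

lemma enorm_weighted_le (hu : ∀ p, u p ≠ 0 → p ∈ shellA j) {U : ℝ × ℝ → ℝ≥0∞}
    (hb : ∀ p, ‖u p‖ₑ ≤ (modWeight p)⁻¹ * U p) (p : ℝ × ℝ) :
    ‖weighted (-3 / 4) (1 / 2) u p‖ₑ ≤ e2 (-(3 / 4) * j) * (modWeight p ^ (-1 / 2 : ℝ) * U p) := by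
  by_cases h0 : u p = 0
  · simp [weighted, h0]
  rw [enorm_weighted]
  have e : modWeight p ^ (1 / 2 : ℝ) * (modWeight p)⁻¹ = modWeight p ^ (-1 / 2 : ℝ) := by
    rw [← ENNReal.rpow_neg_one, ← ENNReal.rpow_add _ _ (modWeight_ne_zero p) (modWeight_ne_top p)]
    norm_num
  calc _ ≤ e2 (-(3 / 4) * j) * modWeight p ^ (1 / 2 : ℝ) * ((modWeight p)⁻¹ * U p) := by
        gcongr
        · exact freqWeight_rpow_le (hu p h0)
        · exact hb p
    _ = _ := by rw [← e]; ring

lemma normXsb1_le (hu : ∀ p, u p ≠ 0 → p ∈ shellA j)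
    (hb : ∀ p, ‖u p‖ₑ ≤ (modWeight p)⁻¹ * U₁ p) :
    normXsb1 (-3 / 4) (1 / 2) u ≤ e2 (-(3 / 4) * j) * normDual U₁ := by
  have h0 : ∀ l : ℕ, l ≠ j → (∑' k : ℕ, eLpNorm (weighted (-3 / 4) (1 / 2) u) 2
      (volume.restrict (shellA l ∩ shellB k))) ^ 2 = 0 := by
    intro l hl
    have : ∀ k : ℕ, eLpNorm (weighted (-3 / 4) (1 / 2) u) 2
        (volume.restrict (shellA l ∩ shellB k)) = 0 := by
      intro k
      rw [eLpNorm_two_eq_l2,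
        l2_restrict _ ((measurableSet_shellA l).inter (measurableSet_shellB k))]
      have : ((shellA l ∩ shellB k).indicator fun p => ‖weighted (-3 / 4) (1 / 2) u p‖ₑ) = 0 := by
        ext p
        by_cases hp : p ∈ shellA l ∩ shellB k
        · have : u p = 0 := by
            by_contra h
            exact hl (dyadic_unique hp.1 (hu p h))
          simp [weighted, this]
        · simp [hp]
      rw [this]
      simp [l2]
    rw [ENNReal.tsum_eq_zero.2 this, sq, zero_mul]
  rw [normXsb1, tsum_eq_single j h0, ← ENNReal.rpow_natCast, ← ENNReal.rpow_mul]
  norm_num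
  rw [normDual, ← ENNReal.tsum_mul_left]
  refine ENNReal.tsum_le_tsum fun k => ?_
  rw [eLpNorm_two_eq_l2, l2_restrict _ ((measurableSet_shellA j).inter (measurableSet_shellB k))]
  refine le_trans ?_ (mul_le_mul_right (l2_modWeight_shellB_le k) _)
  rw [← l2_const_mul (e2_ne_top _)]
  refine l2_mono fun p => ?_
  by_cases hp : p ∈ shellA j ∩ shellB k
  · simp only [Set.indicator_of_mem hp, Set.indicator_of_mem hp.2]
    have := enorm_weighted_le hu hb p
    norm_num at this ⊢
    exact this
  · rw [Set.indicator_of_notMem hp]; exact zero_le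

lemma normXsb_le (hu : ∀ p, u p ≠ 0 → p ∈ shellA j) (h₁ : Measurable U₁) (h₂ : Measurable U₂)
    (hb : ∀ p, ‖u p‖ₑ ≤ (modWeight p)⁻¹ * (U₁ p + U₂ p)) :
    normXsb (-3 / 4) (1 / 2) u ≤ e2 (-(3 / 4) * j) *
      (normDual U₁ + l2 volume fun p => modWeight p ^ (-1 / 2 : ℝ) * U₂ p) := by
  rw [normXsb, eLpNorm_two_eq_l2]
  refine (l2_mono (enorm_weighted_le hu hb)).trans ?_
  rw [l2_const_mul (e2_ne_top _)]
  gcongr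
  simp_rw [mul_add]
  have m : ∀ {U : ℝ × ℝ → ℝ≥0∞}, Measurable U →
      Measurable fun p => modWeight p ^ (-1 / 2 : ℝ) * U p := fun hU =>
    (measurable_modWeight_rpow _).mul hU
  exact (l2_add_le (m h₁) (m h₂)).trans (by gcongr; exact l2_modWeight_le_normDual h₁)

/-- The majorant is split freely. The ℓ¹ norm of U₁ controls both summands of `normX`, hence the
factor 2, while U₂ lives in D and enters only the ℓ² summand, so it needs no summability over the
modulation shells. -/
lemma normX_le (hu : ∀ p, u p ≠ 0 → p ∈ shellA j) (h₁ : Measurable U₁) (h₂ : Measurable U₂)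
    (hb : ∀ p, ‖u p‖ₑ ≤ (modWeight p)⁻¹ * (U₁ p + U₂ p)) (hU : ∀ p, U₂ p ≠ 0 → p ∈ regionD) :
    normX u ≤ e2 (-(3 / 4) * j) * (e2 1 * normDual U₁ +
      l2 volume fun p => modWeight p ^ (-1 / 2 : ℝ) * U₂ p) := by
  have a := normXsb1_le (u := regionDᶜ.indicator u) (U₁ := U₁)
    (fun p hp => hu p (Set.indicator_apply_ne_zero.1 hp).2) fun p => by
      by_cases hp : p ∈ regionD
      · simp [hp]
      · have h0 : U₂ p = 0 := by
          by_contra h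
          exact hp (hU p h)
        have := hb p
        rw [h0, add_zero] at this
        simpa [hp] using this
  have b := normXsb_le (u := regionD.indicator u)
    (fun p hp => hu p (Set.indicator_apply_ne_zero.1 hp).2) h₁ h₂ fun p => by
      by_cases hp : p ∈ regionD
      · simpa [hp] using hb p
      · simp [hp]
  calc normX u ≤ _ := add_le_add a b
    _ = _ := by
      rw [show e2 1 = 1 + 1 by norm_num [e2, one_add_one_eq_two]]
      ring

lemma normL2L1_le (hu : ∀ p, u p ≠ 0 → p ∈ shellA j) (h₁ : Measurable U₁) (h₂ : Measurable U₂)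
    (hb : ∀ p, ‖u p‖ₑ ≤ (modWeight p)⁻¹ * (U₁ p + U₂ p)) (hZ : MeasurableSet Z)
    (hU : ∀ p, U₂ p ≠ 0 → p ∈ Z) {c : ℝ}
    (hc : ∀ ξ : ℝ, ∫⁻ τ : ℝ, Z.indicator (fun p => (modWeight p)⁻¹) (τ, ξ) ≤ e2 c) :
    normL2L1 (fun p => ((bracket p.2 ^ (-3 / 4 : ℝ) : ℝ) : ℂ) * u p) ≤
      e2 (-(3 / 4) * j) * (e2 1 * normDual U₁ +
        e2 (c / 2) * l2 volume fun p => modWeight p ^ (-1 / 2 : ℝ) * U₂ p) := by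
  have hpt : ∀ p : ℝ × ℝ, ‖((bracket p.2 ^ (-3 / 4 : ℝ) : ℝ) : ℂ) * u p‖ₑ ≤
      e2 (-(3 / 4) * j) * ((modWeight p)⁻¹ * U₁ p + (modWeight p)⁻¹ * U₂ p) := by
    intro p
    by_cases h0 : u p = 0
    · simp [h0]
    rw [enorm_mul, ← mul_add]
    refine mul_le_mul' (le_trans (le_of_eq ?_) (freqWeight_rpow_le (hu p h0))) (hb p)
    rw [freqWeight, ENNReal.ofReal_rpow_of_pos (bracket_pos _), ← ofReal_norm,
      Complex.norm_real, Real.norm_of_nonneg]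
    have := bracket_pos p.2
    positivity
  have m₁ : Measurable fun p => (modWeight p)⁻¹ * U₁ p := measurable_modWeight.inv.mul h₁
  have m₂ : Measurable fun p => (modWeight p)⁻¹ * U₂ p := measurable_modWeight.inv.mul h₂
  calc _ ≤ l2 volume fun ξ : ℝ => e2 (-(3 / 4) * j) *
        ((∫⁻ τ : ℝ, (modWeight (τ, ξ))⁻¹ * U₁ (τ, ξ)) +
          ∫⁻ τ : ℝ, (modWeight (τ, ξ))⁻¹ * U₂ (τ, ξ)) := by
        refine l2_mono fun ξ => ?_
        rw [← lintegral_add_left (measurable_fiber m₁ ξ),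
          ← lintegral_const_mul' _ _ (e2_ne_top _)]
        exact lintegral_mono fun τ => hpt (τ, ξ)
    _ ≤ _ := by
      rw [l2_const_mul (e2_ne_top _)]
      gcongr
      refine (l2_add_le m₁.lintegral_prod_left' m₂.lintegral_prod_left').trans ?_
      gcongr
      · exact l2_fiber_le_normDual h₁
      · exact l2_fiber_le h₂ hZ hU hc

end

end Ostrovsky

end

noncomputable section

namespace Ostrovsky

/-! ### Trilinear bounds for dyadic pieces -/

/-- `F` is a measurable function supported in `A_j ∩ B_k`, off the line `ξ = 0`. -/
structure Dyadic (F : ℝ × ℝ → ℝ≥0∞) (j k : ℕ) : Prop where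
  meas : Measurable F
  memA : ∀ p, F p ≠ 0 → p ∈ shellA j
  memB : ∀ p, F p ≠ 0 → p ∈ shellB k
  ne : ∀ p, F p ≠ 0 → p.2 ≠ 0

lemma abs_freq_lt {j : ℕ} {p : ℝ × ℝ} (h : p ∈ shellA j) : |p.2| < (2 : ℝ) ^ (j + 1) - 1 := by
  have := h.2
  unfold bracket at this
  linarith

lemma le_abs_freq {j : ℕ} {p : ℝ × ℝ} (h : p ∈ shellA j) : (2 : ℝ) ^ j - 1 ≤ |p.2| := by
  have := h.1
  unfold bracket at this
  linarith

lemma abs_freq_le_rpow {j : ℕ} {x : ℝ} {p : ℝ × ℝ} (h : p ∈ shellA j) (hx : (j : ℝ) + 1 ≤ x) :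
    |p.2| ≤ (2 : ℝ) ^ x := by
  calc |p.2| ≤ (2 : ℝ) ^ (j + 1) := by linarith [abs_freq_lt h]
    _ = (2 : ℝ) ^ ((j : ℝ) + 1) := by rw [← Real.rpow_natCast]; push_cast; rfl
    _ ≤ _ := rpow_two_le_iff.2 hx

/-- The bracket is 1 + |ξ|, so the shell gives |ξ| ≥ 2^j - 1. This is at least 2^(j-1) only for j ≥
1; the shell with j = 0 reaches down to frequency zero. -/
lemma rpow_le_abs_freq {j : ℕ} {x : ℝ} {p : ℝ × ℝ} (h : p ∈ shellA j) (hj : 1 ≤ j)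
    (hx : x ≤ (j : ℝ) - 1) : (2 : ℝ) ^ x ≤ |p.2| := by
  obtain ⟨i, rfl⟩ : ∃ i, j = i + 1 := ⟨j - 1, by omega⟩
  calc (2 : ℝ) ^ x ≤ 2 ^ (i : ℝ) := rpow_two_le_iff.2 (by push_cast at hx; linarith)
    _ = 2 ^ i := Real.rpow_natCast _ _
    _ ≤ 2 ^ (i + 1) - 1 := by
      have : (1 : ℝ) ≤ 2 ^ i := one_le_pow₀ (by norm_num)
      rw [pow_succ]; linarith
    _ ≤ _ := le_abs_freq h

/-- One frequency cannot be much larger than both others. -/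
lemma not_add_eq_zero {i j l : ℕ} {p q r : ℝ × ℝ} (h0 : p + q + r = 0) (hp : p ∈ shellA i)
    (hq : q ∈ shellA j) (hr : r ∈ shellA l) (hij : i + 2 ≤ j) (hlj : l + 2 ≤ j) : False := by
  have h2 : p.2 + q.2 + r.2 = 0 := by simpa using congrArg Prod.snd h0
  have a := abs_freq_lt hp
  have b := le_abs_freq hq
  have c := abs_freq_lt hr
  obtain ⟨d, rfl⟩ : ∃ d, j = d + 2 := ⟨j - 2, by omega⟩
  have e1 : (2 : ℝ) ^ (i + 1) ≤ 2 ^ (d + 1) := pow_le_pow_right₀ (by norm_num) (by omega)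
  have e2 : (2 : ℝ) ^ (l + 1) ≤ 2 ^ (d + 1) := pow_le_pow_right₀ (by norm_num) (by omega)
  have e3 : (2 : ℝ) ^ (d + 2) = 2 * 2 ^ (d + 1) := by ring
  have : |q.2| ≤ |p.2| + |r.2| := by
    rw [show q.2 = -p.2 + -r.2 by linarith, ← abs_neg p.2, ← abs_neg r.2]
    exact abs_add_le _ _
  linarith

lemma WeightedTriBound.of_false {F G H : ℝ × ℝ → ℝ≥0∞} {E : ℝ}
    (h : OnInter F G H fun _ _ _ => False) : WeightedTriBound F G H E :=
  WeightedTriBound.of_inter fun ⟨p, q, r, h0, hp, hq, hr⟩ => (h p q r h0 hp hq hr).elim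

namespace Dyadic

variable {F G H : ℝ × ℝ → ℝ≥0∞} {j j₁ j₂ a b k : ℕ}

lemma modLE (h : Dyadic F j k) : ModLE F k := by
  intro p hp
  have := (h.memB p hp).2
  unfold bracket at this
  calc |modulation p| ≤ (2 : ℝ) ^ (k + 1) := by linarith
    _ = (2 : ℝ) ^ ((k : ℝ) + 1) := by rw [← Real.rpow_natCast]; push_cast; rfl

lemma rpow_le_bracket (h : Dyadic F j k) :
    ∀ p, F p ≠ 0 → (2 : ℝ) ^ (k : ℝ) ≤ bracket (modulation p) := fun p hp => by
  rw [Real.rpow_natCast]; exact (h.memB p hp).1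

lemma indicator (h : Dyadic F j k) {S : Set (ℝ × ℝ)} (hS : MeasurableSet S) :
    Dyadic (S.indicator F) j k :=
  ⟨h.meas.indicator hS, fun p hp => h.memA p (Set.indicator_apply_ne_zero.1 hp).2,
    fun p hp => h.memB p (Set.indicator_apply_ne_zero.1 hp).2,
    fun p hp => h.ne p (Set.indicator_apply_ne_zero.1 hp).2⟩

lemma highHighLow {n : ℝ} (hF : Dyadic F j₁ a) (hG : Dyadic G j₂ b) (hH : Dyadic H j k)
    (hn : 20 ≤ n) (h₁ : |(j₁ : ℝ) - n| ≤ 1) (h₂ : |(j₂ : ℝ) - n| ≤ 1) (hj : (j : ℝ) + 9 ≤ n) :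
    HighHighLow F G H n a b k := by
  have h₁' := abs_le.1 h₁
  have h₂' := abs_le.1 h₂
  have pos : ∀ i : ℕ, n - 1 ≤ (i : ℝ) → 1 ≤ i := fun i hi => by
    by_contra h
    have : i = 0 := by omega
    subst this
    norm_num at hi
    linarith
  exact ⟨hF.meas, hG.meas, hH.meas, hF.modLE, hG.modLE, hH.modLE, by positivity, by positivity,
    by positivity, hn, fun p hp => ⟨rpow_le_abs_freq (hF.memA p hp) (pos _ (by linarith))
      (by linarith), abs_freq_le_rpow (hF.memA p hp) (by linarith)⟩,
    fun p hp => ⟨rpow_le_abs_freq (hG.memA p hp) (pos _ (by linarith))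
      (by linarith), abs_freq_le_rpow (hG.memA p hp) (by linarith)⟩,
    fun p hp => ⟨hH.ne p hp, abs_freq_le_rpow (hH.memA p hp) (by linarith)⟩⟩

lemma abs_sub_le_one_of_inter (hF : Dyadic F j₁ a) (hG : Dyadic G j₂ b) (hH : Dyadic H j k)
    (hj : j + 2 ≤ j₁) (hj' : j + 2 ≤ j₂)
    (hex : ∃ p q r : ℝ × ℝ, p + q + r = 0 ∧ F p ≠ 0 ∧ G q ≠ 0 ∧ H r ≠ 0) :
    |(j₁ : ℝ) - j₂| ≤ 1 := by
  obtain ⟨p, q, r, h0, hp, hq, hr⟩ := hex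
  have c1 : j₁ ≤ j₂ + 1 := by
    by_contra hc
    exact not_add_eq_zero (p := q) (q := p) (r := r) (by rw [← h0]; abel) (hG.memA q hq)
      (hF.memA p hp) (hH.memA r hr) (by omega) (by omega)
  have c2 : j₂ ≤ j₁ + 1 := by
    by_contra hc
    exact not_add_eq_zero h0 (hF.memA p hp) (hG.memA q hq) (hH.memA r hr) (by omega) (by omega)
  have c1' : (j₁ : ℝ) ≤ j₂ + 1 := by exact_mod_cast c1
  have c2' : (j₂ : ℝ) ≤ j₁ + 1 := by exact_mod_cast c2
  rw [abs_le]; constructor <;> linarith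

lemma inter_rot (hex : ∃ p q r : ℝ × ℝ, p + q + r = 0 ∧ F p ≠ 0 ∧ G q ≠ 0 ∧ H r ≠ 0) :
    ∃ p q r : ℝ × ℝ, p + q + r = 0 ∧ F p ≠ 0 ∧ H q ≠ 0 ∧ G r ≠ 0 := by
  obtain ⟨p, q, r, h0, hp, hq, hr⟩ := hex
  exact ⟨p, r, q, by rw [← h0]; abel, hp, hr, hq⟩

lemma onInter_freq_le {x : ℝ} (hH : Dyadic H j k) (hx : (j : ℝ) + 1 ≤ x) :
    OnInter F G H fun _ _ r => |r.2| ≤ (2 : ℝ) ^ x :=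
  fun _ _ r _ _ _ hr => abs_freq_le_rpow (hH.memA r hr) hx

/-- All three frequencies are bounded. -/
lemma bound_low (hF : Dyadic F j₁ a) (hG : Dyadic G j₂ b) (hH : Dyadic H j k)
    (h : (j < 30 ∧ j₁ < 30) ∨ (j < 30 ∧ j₂ < 30) ∨ (j₁ < 30 ∧ j₂ < 30)) :
    WeightedTriBound F G H (((a : ℝ) + b + k) / 2 + (150 + 3 / 4 * j - 3 / 4 * j₁ - 3 / 4 * j₂)
      - k / 8 - a / 8 - b / 8) := by
  apply WeightedTriBound.of_inter
  rintro ⟨p, q, r, h0, hp, hq, hr⟩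
  have hA := hF.memA p hp
  have hB := hG.memA q hq
  have hC := hH.memA r hr
  have c1 : j ≤ 31 := by
    by_contra hc
    exact not_add_eq_zero (p := p) (q := r) (r := q) (by rw [← h0]; abel) hA hC hB
      (by omega) (by omega)
  have c2 : j₁ ≤ 31 := by
    by_contra hc
    exact not_add_eq_zero (p := q) (q := p) (r := r) (by rw [← h0]; abel) hB hA hC
      (by omega) (by omega)
  have c3 : j₂ ≤ 31 := by
    by_contra hc
    exact not_add_eq_zero h0 hA hB hC (by omega) (by omega)
  have c1' : (j : ℝ) ≤ 31 := by exact_mod_cast c1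
  have c2' : (j₁ : ℝ) ≤ 31 := by exact_mod_cast c2
  have c3' : (j₂ : ℝ) ≤ 31 := by exact_mod_cast c3
  have ha : (0 : ℝ) ≤ a := by positivity
  have hb : (0 : ℝ) ≤ b := by positivity
  have hk : (0 : ℝ) ≤ k := by positivity
  have hj : (0 : ℝ) ≤ j := by positivity
  have hx : (j : ℝ) + 1 ≤ 32 := by linarith
  obtain ⟨m1, m2, m3⟩ := min_three_le (a : ℝ) b k
  -- The smallest of three exponents is at most a third of their sum, so replacing (a + b + k)/2 by
  -- min(a, b, k)/2 leaves more than an eighth of each.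
  refine ((triBound_low (k := min (a : ℝ) (min b k)) hF.meas hG.meas hH.meas
    (hH.onInter_freq_le hx) ?_).weighted (hH.onInter_freq_le hx)).mono (by linarith)
  rcases min_choice (a : ℝ) (min b k) with e | e
  · rw [e]; exact Or.inl hF.modLE
  · rw [e]
    rcases min_choice (b : ℝ) k with e | e
    · rw [e]; exact Or.inr (Or.inl hG.modLE)
    · rw [e]; exact Or.inr (Or.inr hH.modLE)

/-- High-high to low interactions with output frequency at least `1`. -/
lemma bound_highHigh (hF : Dyadic F j₁ a) (hG : Dyadic G j₂ b) (hH : Dyadic H j k)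
    (h₁ : 30 ≤ j₁) (hj : 0 < j) (hj₁ : j + 10 ≤ j₁) :
    WeightedTriBound F G H (((a : ℝ) + b + k) / 2 +
      (21 + 3 / 8 * j - 3 / 2 * j₁) - min (k : ℝ) |k - (2 * j₁ + j : ℝ)| / 8) := by
  apply WeightedTriBound.of_inter
  intro hex
  have hj₂ : j + 2 ≤ j₂ ∨ j₂ < j + 2 := by omega
  rcases hj₂ with hj₂ | hj₂
  · have hadj := hF.abs_sub_le_one_of_inter hG hH (by omega) hj₂ hex
    have h1 : (30 : ℝ) ≤ j₁ := by exact_mod_cast h₁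
    have h2 : (j : ℝ) + 10 ≤ j₁ := by exact_mod_cast hj₁
    have h3 : (1 : ℝ) ≤ j := by exact_mod_cast hj
    have hh := hF.highHighLow hG hH (n := j₁) (by linarith) (by simp)
      (by rw [abs_sub_comm]; exact hadj) (by linarith)
    exact ((hh.triBound_output_low_shell h3 (by linarith) fun r hr =>
      rpow_le_abs_freq (hH.memA r hr) hj le_rfl).weighted (hH.onInter_freq_le le_rfl)).mono
        (by linarith)
  · obtain ⟨p, q, r, h0, hp, hq, hr⟩ := hex
    exact (not_add_eq_zero (p := q) (q := p) (r := r) (by rw [← h0]; abel) (hG.memA q hq)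
      (hF.memA p hp) (hH.memA r hr) (by omega) (by omega)).elim

/-- High-low to high interactions with low frequency at least `1`. -/
lemma bound_highLow (hF : Dyadic F j₁ a) (hG : Dyadic G j₂ b) (hH : Dyadic H j k)
    (h₁ : 30 ≤ j) (hj : 0 < j₂) (hj₂ : j₂ + 11 ≤ j) :
    WeightedTriBound F G H (((a : ℝ) + b + k) / 2 +
      (21 - 1 / 4 * j - 1 / 2 * j₂) - min (k : ℝ) |k - (2 * j + j₂ : ℝ)| / 8) := by
  apply WeightedTriBound.of_inter
  intro hex
  have hcase : j₂ + 2 ≤ j₁ ∨ j₁ < j₂ + 2 := by omega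
  rcases hcase with hc | hc
  · have hadj := hF.abs_sub_le_one_of_inter hH hG hc (by omega) (inter_rot hex)
    have h1 : (30 : ℝ) ≤ j := by exact_mod_cast h₁
    have h2 : (j₂ : ℝ) + 11 ≤ j := by exact_mod_cast hj₂
    have h3 : (1 : ℝ) ≤ j₂ := by exact_mod_cast hj
    have hh := hF.highHighLow hH hG (n := j) (by linarith) hadj (by simp) (by linarith)
    exact ((hh.triBound_output_high_shell h3 (by linarith) fun r hr =>
      rpow_le_abs_freq (hG.memA r hr) hj le_rfl).rot.weighted (hH.onInter_freq_le le_rfl)).mono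
        (by linarith)
  · obtain ⟨p, q, r, h0, hp, hq, hr⟩ := hex
    exact (not_add_eq_zero (p := p) (q := r) (r := q) (by rw [← h0]; abel) (hF.memA p hp)
      (hH.memA r hr) (hG.memA q hq) (by omega) (by omega)).elim

/-- Interactions of comparable high frequencies. -/
lemma bound_comparable (hF : Dyadic F j₁ a) (hG : Dyadic G j₂ b) (hH : Dyadic H j k)
    (h : 30 ≤ j) (h₁ : |(j : ℝ) - j₁| ≤ 10) (h₂ : |(j : ℝ) - j₂| ≤ 10) :
    WeightedTriBound F G H (((a : ℝ) + b + k) / 2 +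
      (31 - 3 / 4 * j) - min (k : ℝ) |k - (3 * j : ℝ)| / 8) := by
  have h1 : (30 : ℝ) ≤ j := by exact_mod_cast h
  have h₁' := abs_le.1 h₁
  have h₂' := abs_le.1 h₂
  have pos : ∀ i : ℕ, (j : ℝ) - 10 ≤ i → 1 ≤ i := fun i hi => by
    by_contra h
    have : i = 0 := by omega
    subst this
    norm_num at hi
    linarith
  refine ((triBound_comparable (n := j) hF.meas hG.meas hH.meas hF.modLE hG.modLE hH.modLE
    (by positivity) (by positivity) (by linarith)
    (fun p hp => rpow_le_abs_freq (hF.memA p hp) (pos _ (by linarith)) (by linarith))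
    (fun p hp => rpow_le_abs_freq (hG.memA p hp) (pos _ (by linarith)) (by linarith))
    (fun p hp => rpow_le_abs_freq (hH.memA p hp) (pos _ (by linarith)) (by linarith))).weighted
      (hH.onInter_freq_le le_rfl)).mono (by linarith)

/-- Interactions of a high frequency with one below `1`. -/
lemma bound_highVeryLow (hF : Dyadic F j₁ a) (hG : Dyadic G 0 b) (hH : Dyadic H j k)
    (h : 30 ≤ j) (h₁ : 30 ≤ j₁) :
    WeightedTriBound F G H (((a : ℝ) + b + k) / 2 +
      (23 + 3 / 4 * j - 3 / 4 * j₁) - min (k : ℝ) |k - (j : ℝ)| / 8) := by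
  apply WeightedTriBound.of_inter
  intro hex
  have hadj := hF.abs_sub_le_one_of_inter hH hG (by omega) (by omega) (inter_rot hex)
  have h1 : (30 : ℝ) ≤ j := by exact_mod_cast h
  have hh := hF.highHighLow hH hG (n := j) (by linarith) hadj (by simp)
    (by norm_num; linarith)
  have := abs_le.1 hadj
  exact (hh.triBound_output_high.rot.weighted (hH.onInter_freq_le le_rfl)).mono (by linarith)

/-- Interactions of a high frequency with one below `1` in the exceptional region. -/
lemma bound_highVeryLow_regionD (hF : Dyadic F j₁ a) (hG : Dyadic G 0 b) (hH : Dyadic H j k)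
    (h : 30 ≤ j) (h₁ : 30 ≤ j₁) (hD : ∀ q, G q ≠ 0 → q ∈ regionD) :
    WeightedTriBound F G H (((a : ℝ) + b + k) / 2 +
      (23 + 3 / 4 * j - 3 / 4 * j₁) - min (k : ℝ) |k - (j : ℝ)| / 8 -
        min (b : ℝ) |b - (3 / 2 * j : ℝ)| / 8) := by
  apply WeightedTriBound.of_inter
  intro hex
  have hadj := hF.abs_sub_le_one_of_inter hH hG (by omega) (by omega) (inter_rot hex)
  have h1 : (30 : ℝ) ≤ j := by exact_mod_cast h
  have hh := hF.highHighLow hH hG (n := j) (by linarith) hadj (by simp)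
    (by norm_num; linarith)
  have := abs_le.1 hadj
  exact ((hh.triBound_output_high_regionD hD hG.rpow_le_bracket).rot.weighted
    (hH.onInter_freq_le le_rfl)).mono (by linarith)

/-- High-high interactions into frequencies below `1`, off the resonant region. -/
lemma bound_highHighVeryLow (hF : Dyadic F j₁ a) (hG : Dyadic G j₂ b) (hH : Dyadic H 0 k)
    (h₁ : 30 ≤ j₁) (h₂ : 30 ≤ j₂) (hZ : ∀ r, H r ≠ 0 → r ∉ resonantRegion j₁) :
    WeightedTriBound F G H (((a : ℝ) + b + k) / 2 + (24 - 3 / 4 * j₁ - 3 / 4 * j₂) -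
      min (k : ℝ) (min |k - (3 / 2 * j₁ : ℝ)| |k - (2 * j₁ : ℝ)|) / 8) := by
  apply WeightedTriBound.of_inter
  intro hex
  have hadj := hF.abs_sub_le_one_of_inter hG hH (by omega) (by omega) hex
  have h1 : (30 : ℝ) ≤ j₁ := by exact_mod_cast h₁
  have hadj' := abs_le.1 hadj
  have hh := hF.highHighLow hG hH (n := j₁) (by linarith) (by simp)
    (by rw [abs_sub_comm]; exact hadj) (by norm_num; linarith)
  have hone : ∀ r, H r ≠ 0 → |r.2| ≤ 1 := fun r hr => by
    have := abs_freq_lt (hH.memA r hr)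
    norm_num at this
    exact this.le
  have g1 := min_le_left (k : ℝ) (min |k - (3 / 2 * j₁ : ℝ)| |k - (2 * j₁ : ℝ)|)
  have g2 := min_le_right (k : ℝ) (min |k - (3 / 2 * j₁ : ℝ)| |k - (2 * j₁ : ℝ)|)
  rcases le_or_gt ((k : ℝ) - 10) a with ha | ha
  · exact (hh.weighted_output_low hone (Or.inl ha)).mono (by linarith)
  rcases le_or_gt ((k : ℝ) - 10) b with hb | hb
  · exact (hh.weighted_output_low hone (Or.inr hb)).mono (by linarith)
  -- The output modulation now dominates. Inside D the interaction would lie in the excluded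
  -- resonant region, hence is empty; outside D smallness of the frequency gives the gain.
  have hS := measurableSet_regionD
  refine (WeightedTriBound.of_split (E := ((a : ℝ) + b + k) / 2 - 3 / 2 * j₁ + 20 -
      min |(k : ℝ) - 3 / 2 * j₁| |(k : ℝ) - 2 * j₁| / 8 + 1)
    hF.meas hG.meas hH.meas hS (WeightedTriBound.of_false ?_) ?_).mono (by linarith)
  · exact (hh.indicator hS).false_of_dominant h1 ha.le hb.le
      (fun r hr => ⟨(Set.indicator_apply_ne_zero.1 hr).1,
        hZ r (Set.indicator_apply_ne_zero.1 hr).2⟩)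
      (hH.indicator hS).rpow_le_bracket
  · exact (hh.indicator hS.compl).weighted_output_low_dominant
      (fun r hr => hone r (Set.indicator_apply_ne_zero.1 hr).2) ha.le hb.le
      (fun r hr => (Set.indicator_apply_ne_zero.1 hr).1)
      (hH.indicator hS.compl).rpow_le_bracket

/-- High-high interactions into frequencies below `1`, with the weight `|ξ|^(1/2)`. -/
lemma bound_resonant (hF : Dyadic F j₁ a) (hG : Dyadic G j₂ b) (hH : Measurable H)
    (hA : ∀ r, H r ≠ 0 → r ∈ shellA 0) (h0 : ∀ r, H r ≠ 0 → r.2 ≠ 0)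
    (h₁ : 30 ≤ j₁) (h₂ : 30 ≤ j₂) :
    triForm F G (fun r => ‖r.2‖ₑ ^ (1 / 2 : ℝ) * H r) ≤
      e2 (((a : ℝ) + b) / 2 + (6 + 1 / 4 * j₁ - 3 / 4 * j₂)) *
        (l2 volume F * l2 volume G * l2 volume H) := by
  by_cases hex : ∃ p q r : ℝ × ℝ, p + q + r = 0 ∧ F p ≠ 0 ∧ G q ≠ 0 ∧ H r ≠ 0
  swap
  · rw [triForm_eq_zero fun p q r h0 hp hq hr =>
      hex ⟨p, q, r, h0, hp, hq, right_ne_zero_of_mul hr⟩]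
    exact zero_le
  have h1 : (30 : ℝ) ≤ j₁ := by exact_mod_cast h₁
  have hadj : |(j₁ : ℝ) - j₂| ≤ 1 := by
    obtain ⟨p, q, r, h0, hp, hq, hr⟩ := hex
    have c1 : j₁ ≤ j₂ + 1 := by
      by_contra hc
      exact not_add_eq_zero (p := q) (q := p) (r := r) (by rw [← h0]; abel) (hG.memA q hq)
        (hF.memA p hp) (hA r hr) (by omega) (by omega)
    have c2 : j₂ ≤ j₁ + 1 := by
      by_contra hc
      exact not_add_eq_zero h0 (hF.memA p hp) (hG.memA q hq) (hA r hr) (by omega) (by omega)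
    have c1' : (j₁ : ℝ) ≤ j₂ + 1 := by exact_mod_cast c1
    have c2' : (j₂ : ℝ) ≤ j₁ + 1 := by exact_mod_cast c2
    rw [abs_le]; constructor <;> linarith
  have hadj' := abs_le.1 hadj
  have hW : Measurable fun r : ℝ × ℝ => ‖r.2‖ₑ ^ (1 / 2 : ℝ) := by fun_prop
  rw [triForm_eq_lconv hF.meas hG.meas
    (show Measurable fun r : ℝ × ℝ => ‖r.2‖ₑ ^ (1 / 2 : ℝ) * H r from hW.mul hH)]
  have hbig : ∀ i : ℕ, 30 ≤ i → ∀ p : ℝ × ℝ, p ∈ shellA i → (j₁ : ℝ) - 2 ≤ i - 1 →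
      (2 : ℝ) ^ (j₁ : ℝ) / 4 ≤ |p.2| := by
    intro i hi p hp hij
    have := rpow_le_abs_freq hp (by omega) hij
    rw [Real.rpow_sub (by norm_num)] at this
    norm_num at this ⊢
    exact this
  have key := lintegral_lconv_mul_le hF.meas hG.meas hH hW
    (K := e2 ((a : ℝ) + b + 7 - j₁)) fun r hr => by
      have r0 : r.2 ≠ 0 := by simpa using h0 _ hr
      have hr' : 0 < |r.2| := abs_pos.2 r0
      have hN : (0 : ℝ) < 2 ^ (j₁ : ℝ) := by positivity
      have r1 : |r.2| ≤ 1 := by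
        have := abs_freq_lt (hA _ hr)
        norm_num at this
        exact this.le
      have hN' : (8 : ℝ) ≤ 2 ^ (j₁ : ℝ) := by
        calc (8 : ℝ) = 2 ^ (3 : ℝ) := by norm_num
          _ ≤ _ := rpow_two_le_iff.2 (by linarith)
      have hv := volume_transversal_le (F := F) (G := G) (r := r)
        (L := |r.2| * (2 ^ (j₁ : ℝ) / 4)) (by positivity) hF.modLE hG.modLE fun p hp hq => by
          have b1 := hbig _ h₁ p (hF.memA p hp) (by linarith)
          have b2 := hbig _ h₂ _ (hG.memA _ hq) (by linarith)
          simp only [Prod.snd_sub] at b2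
          constructor
          · rw [abs_mul]
            calc (1 : ℝ) ≤ 2 ^ (j₁ : ℝ) / 4 * (2 ^ (j₁ : ℝ) / 4) := by nlinarith
              _ ≤ _ := by gcongr
          · gcongr
            have := abs_sub_abs_le_abs_sub (2 * p.2) r.2
            rw [abs_sub_comm, abs_mul, abs_two] at this
            linarith
      have e : (‖r.2‖ₑ ^ (1 / 2 : ℝ)) ^ 2 = e2 (Real.logb 2 |r.2|) := by
        rw [← ENNReal.rpow_natCast, ← ENNReal.rpow_mul, e2_eq_ofReal,
          Real.rpow_logb (by norm_num) (by norm_num) hr', Real.enorm_eq_ofReal_abs]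
        norm_num
      -- The squared weight |r| cancels the factor |r| of the transversality L = |r| 2^(j₁) / 4, so
      -- the bound is uniform in the output frequency.
      calc _ ≤ e2 (Real.logb 2 |r.2|) *
            e2 ((a : ℝ) + b + 5 - Real.logb 2 (|r.2| * (2 ^ (j₁ : ℝ) / 4))) := by
            rw [e]; gcongr
        _ = _ := by
          rw [← e2_add, Real.logb_mul (by positivity) (by positivity),
            Real.logb_div (by positivity) (by norm_num), Real.logb_rpow (by norm_num) (by norm_num),
            show (4 : ℝ) = 2 ^ (2 : ℝ) by norm_num, Real.logb_rpow (by norm_num) (by norm_num)]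
          congr 1; ring
  rw [e2_rpow] at key
  refine le_trans (le_of_eq ?_) (key.trans ?_)
  · congr 1; ext r; simp
  · gcongr
    exact e2_mono (by linarith)

end Dyadic

end Ostrovsky

end

noncomputable section

namespace Ostrovsky

/-! ### The bilinear estimates -/

/-- `F` is measurable and supported in `A_j`, off the line `ξ = 0`. -/
structure Shell (F : ℝ × ℝ → ℝ≥0∞) (j : ℕ) : Prop where
  meas : Measurable F
  memA : ∀ p, F p ≠ 0 → p ∈ shellA j
  ne : ∀ p, F p ≠ 0 → p.2 ≠ 0

lemma e2_neg_min_le (x y : ℝ) : e2 (-(min x y / 8)) ≤ e2 (-x / 8) + e2 (-y / 8) := by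
  rcases min_choice x y with e | e
  · rw [e, neg_div]; exact le_self_add
  · rw [e, neg_div 8 y]; exact le_add_self

lemma tsum_e2_min_le {f g : ℕ → ℝ} {A B : ℝ≥0∞} (hf : ∑' k, e2 (-f k / 8) ≤ A)
    (hg : ∑' k, e2 (-g k / 8) ≤ B) : ∑' k, e2 (-(min (f k) (g k) / 8)) ≤ A + B := by
  calc _ ≤ ∑' k, (e2 (-f k / 8) + e2 (-g k / 8)) :=
        ENNReal.tsum_le_tsum fun k => e2_neg_min_le _ _
    _ ≤ _ := by rw [ENNReal.tsum_add]; exact add_le_add hf hg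

lemma tsum_e2_min_peak (x : ℝ) : ∑' k : ℕ, e2 (-(min (k : ℝ) |(k : ℝ) - x| / 8)) ≤ e2 7 := by
  refine (tsum_e2_min_le tsum_e2_neg_nat (tsum_e2_peak x)).trans ?_
  rw [show (7 : ℝ) = 6 + 1 by norm_num, e2_add_one]
  gcongr
  exact e2_mono (by norm_num)

lemma tsum_e2_min_two_peaks (x y : ℝ) :
    ∑' k : ℕ, e2 (-(min (k : ℝ) (min |(k : ℝ) - x| |(k : ℝ) - y|) / 8)) ≤ e2 8 := by
  have h : ∑' k : ℕ, e2 (-(min |(k : ℝ) - x| |(k : ℝ) - y| / 8)) ≤ e2 7 :=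
    (tsum_e2_min_le (tsum_e2_peak x) (tsum_e2_peak y)).trans
      (le_of_eq (by rw [← e2_add_one]; norm_num))
  simp only [← neg_div] at h
  refine (tsum_e2_min_le tsum_e2_neg_nat h).trans ?_
  rw [show (8 : ℝ) = 7 + 1 by norm_num, e2_add_one]
  gcongr
  exact e2_mono (by norm_num)

section

variable {F G : ℝ × ℝ → ℝ≥0∞} {j j₁ j₂ : ℕ}

lemma Shell.dyadic (h : Shell F j) (a : ℕ) : Dyadic ((shellB a).indicator F) j a :=
  ⟨h.meas.indicator (measurableSet_shellB a),
    fun p hp => h.memA p (Set.indicator_apply_ne_zero.1 hp).2,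
    fun _ hp => (Set.indicator_apply_ne_zero.1 hp).1,
    fun p hp => h.ne p (Set.indicator_apply_ne_zero.1 hp).2⟩

lemma Shell.indicator (h : Shell F j) {S : Set (ℝ × ℝ)} (hS : MeasurableSet S) :
    Shell (S.indicator F) j :=
  ⟨h.meas.indicator hS, fun p hp => h.memA p (Set.indicator_apply_ne_zero.1 hp).2,
    fun p hp => h.ne p (Set.indicator_apply_ne_zero.1 hp).2⟩

lemma normOne_eq : ∑' a : ℕ, e2 (-(0 : ℝ)) * (e2 ((a : ℝ) / 2) *
    l2 volume ((shellB a).indicator F)) = normOne F := by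
  simp [normOne, e2_zero]

/-- The part of the frequency-weighted convolution with output frequency in `A_j`. -/
def output (j : ℕ) (F G : ℝ × ℝ → ℝ≥0∞) : ℝ × ℝ → ℝ≥0∞ :=
  (shellA j).indicator fun r => ‖r.2‖ₑ * lconv F G r

lemma measurable_output (hF : Measurable F) (hG : Measurable G) : Measurable (output j F G) :=
  (Measurable.mul (by fun_prop) (measurable_lconv hF hG)).indicator (measurableSet_shellA j)

lemma lconv_comm : lconv F G = lconv G F := by
  ext r
  rw [lconv, lconv, ← lintegral_sub_left_eq_self _ r]
  congr 1; ext p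
  rw [sub_sub_cancel, mul_comm]

lemma output_comm : output j F G = output j G F := by
  rw [output, lconv_comm]; rfl

lemma normDual_add_le {U V : ℝ × ℝ → ℝ≥0∞} (hU : Measurable U) (hV : Measurable V) :
    normDual (fun p => U p + V p) ≤ normDual U + normDual V := by
  rw [normDual, normDual, normDual, ← ENNReal.tsum_add]
  refine ENNReal.tsum_le_tsum fun k => ?_
  rw [← mul_add]
  gcongr
  refine le_trans (le_of_eq ?_) (l2_add_le (hU.indicator (measurableSet_shellB k))
    (hV.indicator (measurableSet_shellB k)))
  congr 1
  exact Set.indicator_add' (shellB k) U V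

lemma lconv_add_right {G' : ℝ × ℝ → ℝ≥0∞} (hF : Measurable F) (hG : Measurable G) (r : ℝ × ℝ) :
    lconv F (fun p => G p + G' p) r = lconv F G r + lconv F G' r := by
  simp only [lconv, mul_add]
  rw [lintegral_add_left (by fun_prop)]

/-- The bound in `ℓ¹`-based norms from trilinear bounds on dyadic pieces. -/
lemma normDual_le_of_dyadic (hF : Shell F j₁) (hG : Shell G j₂) {Q : Set (ℝ × ℝ)}
    (hQ : MeasurableSet Q) (hneg : ∀ r, -r ∈ Q ↔ r ∈ Q) (hQj : Q ⊆ shellA j)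
    {E s : ℝ} {γ : ℕ → ℝ} (hγ : ∑' k, e2 (-γ k) ≤ e2 s)
    (h : ∀ (a b k : ℕ) (H : ℝ × ℝ → ℝ≥0∞), Dyadic H j k → (∀ r, H r ≠ 0 → r ∈ Q) →
      WeightedTriBound ((shellB a).indicator F) ((shellB b).indicator G) H
        (((a : ℝ) + b + k) / 2 + E - γ k)) :
    normDual (Q.indicator fun r => ‖r.2‖ₑ * lconv F G r) ≤
      e2 (E + s) * (normOne F * normOne G) := by
  refine (normDual_lconv_le hF.meas hG.meas hQ hneg E γ (fun _ => 0) (fun _ => 0)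
    fun a b k H hH hHS => ?_).trans ?_
  · simp only [sub_zero]
    exact h a b k H ⟨hH, fun r hr => hQj (hHS r hr).1, fun r hr => (hHS r hr).2.1,
      fun r hr => (hHS r hr).2.2⟩ fun r hr => (hHS r hr).1
  · rw [normOne_eq, normOne_eq, e2_add]
    calc _ ≤ e2 E * e2 s * normOne F * normOne G := by gcongr
      _ = _ := by ring

lemma normDual_output_le (hF : Shell F j₁) (hG : Shell G j₂)
    {E s : ℝ} {γ : ℕ → ℝ} (hγ : ∑' k, e2 (-γ k) ≤ e2 s)
    (h : ∀ (a b k : ℕ) (H : ℝ × ℝ → ℝ≥0∞), Dyadic H j k →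
      WeightedTriBound ((shellB a).indicator F) ((shellB b).indicator G) H
        (((a : ℝ) + b + k) / 2 + E - γ k)) :
    normDual (output j F G) ≤ e2 (E + s) * (normOne F * normOne G) :=
  normDual_le_of_dyadic hF hG (measurableSet_shellA j) (fun _ => neg_mem_shellA) subset_rfl hγ
    fun a b k H hH _ => h a b k H hH

/-- The crude volume bound decays in all three modulations, so both inputs may be measured by the
supremum norm and no distinction between D and its complement is needed. -/
lemma normDual_output_low (hF : Shell F j₁) (hG : Shell G j₂)
    (h : (j < 30 ∧ j₁ < 30) ∨ (j < 30 ∧ j₂ < 30) ∨ (j₁ < 30 ∧ j₂ < 30)) :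
    normDual (output j F G) ≤
      e2 (162 + 3 / 4 * j - 3 / 4 * j₁ - 3 / 4 * j₂) * (normSup F * normSup G) := by
  refine (normDual_lconv_le hF.meas hG.meas (measurableSet_shellA j) (fun _ => neg_mem_shellA)
    (150 + 3 / 4 * j - 3 / 4 * j₁ - 3 / 4 * j₂) (fun k => k / 8) (fun k => k / 8)
    (fun k => k / 8) fun a b k H hH hHS => ?_).trans ?_
  · exact (hF.dyadic a).bound_low (hG.dyadic b) ⟨hH, fun r hr => (hHS r hr).1,
      fun r hr => (hHS r hr).2.1, fun r hr => (hHS r hr).2.2⟩ h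
  · have h4 : ∑' k : ℕ, e2 (-((k : ℝ) / 8)) ≤ e2 4 := by
      simp_rw [← neg_div]; exact tsum_e2_neg_nat
    calc _ ≤ e2 (150 + 3 / 4 * j - 3 / 4 * j₁ - 3 / 4 * j₂) * e2 4 * (e2 4 * normSup F) *
          (e2 4 * normSup G) := by
          gcongr
          · exact (tsum_mul_le_normSup _).trans (by gcongr)
          · exact (tsum_mul_le_normSup _).trans (by gcongr)
      _ = e2 (150 + 3 / 4 * j - 3 / 4 * j₁ - 3 / 4 * j₂) * e2 4 * e2 4 * e2 4 *
          (normSup F * normSup G) := by ring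
      _ = _ := by
        rw [← e2_add, ← e2_add, ← e2_add]; congr 2; ring

/-- The low-frequency input is split along D. Off D its ℓ¹ norm is available; on D the extra peak in
its own modulation, centred at 3j/2, replaces ℓ¹ summability by a supremum. -/
lemma normDual_output_highVeryLow (hF : Shell F j₁) (hG : Shell G 0) (h : 30 ≤ j)
    (h₁ : 30 ≤ j₁) :
    normDual (output j F G) ≤ e2 (37 + 3 / 4 * j - 3 / 4 * j₁) *
      (normOne F * (normOne (regionDᶜ.indicator G) + normSup (regionD.indicator G))) := by
  have hD := measurableSet_regionD
  have h1 : normDual (output j F (regionDᶜ.indicator G)) ≤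
      e2 (23 + 3 / 4 * j - 3 / 4 * j₁ + 7) * (normOne F * normOne (regionDᶜ.indicator G)) :=
    normDual_output_le hF (hG.indicator hD.compl) (tsum_e2_min_peak j) fun a b k H hH =>
      (hF.dyadic a).bound_highVeryLow ((hG.indicator hD.compl).dyadic b) hH h h₁
  have h2 : normDual (output j F (regionD.indicator G)) ≤
      e2 (23 + 3 / 4 * j - 3 / 4 * j₁ + 14) * (normOne F * normSup (regionD.indicator G)) := by
    refine (normDual_lconv_le hF.meas (hG.indicator hD).meas (measurableSet_shellA j)
      (fun _ => neg_mem_shellA) (23 + 3 / 4 * j - 3 / 4 * j₁)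
      (fun k => min (k : ℝ) |k - (j : ℝ)| / 8) (fun _ => 0)
      (fun b => min (b : ℝ) |b - (3 / 2 * j : ℝ)| / 8) fun a b k H hH hHS => ?_).trans ?_
    · simp only [sub_zero]
      exact (hF.dyadic a).bound_highVeryLow_regionD ((hG.indicator hD).dyadic b)
        ⟨hH, fun r hr => (hHS r hr).1, fun r hr => (hHS r hr).2.1, fun r hr => (hHS r hr).2.2⟩ h h₁
        fun q hq => (Set.indicator_apply_ne_zero.1 (Set.indicator_apply_ne_zero.1 hq).2).1
    · rw [normOne_eq]
      calc _ ≤ e2 (23 + 3 / 4 * j - 3 / 4 * j₁) * e2 7 * normOne F *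
            (e2 7 * normSup (regionD.indicator G)) := by
            gcongr
            · exact tsum_e2_min_peak _
            · exact (tsum_mul_le_normSup _).trans (by gcongr; exact tsum_e2_min_peak _)
        _ = e2 (23 + 3 / 4 * j - 3 / 4 * j₁) * e2 7 * e2 7 *
            (normOne F * normSup (regionD.indicator G)) := by ring
        _ = _ := by rw [← e2_add, ← e2_add]; congr 2; ring
  have hsplit : output j F G = fun p =>
      output j F (regionDᶜ.indicator G) p + output j F (regionD.indicator G) p := by
    ext p
    have hG' : G = fun p => regionDᶜ.indicator G p + regionD.indicator G p := by
      ext p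
      by_cases hp : p ∈ regionD <;> simp [hp]
    by_cases hp : p ∈ shellA j
    · simp only [output, Set.indicator_of_mem hp]
      conv_lhs => rw [hG']
      rw [lconv_add_right hF.meas (hG.indicator hD.compl).meas, mul_add]
    · simp [output, hp]
  rw [hsplit]
  refine (normDual_add_le (measurable_output hF.meas (hG.indicator hD.compl).meas)
    (measurable_output hF.meas (hG.indicator hD).meas)).trans ?_
  rw [mul_add, mul_add]
  refine add_le_add (h1.trans ?_) (h2.trans ?_) <;>
  · gcongr
    exact e2_mono (by linarith)

lemma normDual_output_nonresonant (hF : Shell F j₁) (hG : Shell G j₂)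
    (h₁ : 30 ≤ j₁) (h₂ : 30 ≤ j₂) :
    normDual ((resonantRegion j₁)ᶜ.indicator (output 0 F G)) ≤
      e2 (32 - 3 / 4 * j₁ - 3 / 4 * j₂) * (normOne F * normOne G) := by
  rw [output, Set.indicator_indicator]
  refine (normDual_le_of_dyadic (j := 0) hF hG
    ((measurableSet_resonantRegion j₁).compl.inter (measurableSet_shellA 0))
    (fun r => and_congr (not_congr neg_mem_resonantRegion) neg_mem_shellA)
    Set.inter_subset_right (tsum_e2_min_two_peaks (3 / 2 * j₁) (2 * j₁)) fun a b k H hH hHQ =>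
      (hF.dyadic a).bound_highHighVeryLow (hG.dyadic b) hH h₁ h₂ fun r hr => (hHQ r hr).1).trans ?_
  gcongr
  exact e2_mono (by linarith)

/-- In the resonant region the output modulation follows |ξ| 2^(2j₁), so dyadic summation in k is
avoided and all modulations are treated together. The weight becomes 2^(-j₁) |ξ|^(1/2) up to a
constant, which is what `Dyadic.bound_resonant` handles. -/
lemma l2_output_resonant (hF : Shell F j₁) (hG : Shell G j₂)
    (h₁ : 30 ≤ j₁) (h₂ : 30 ≤ j₂) :
    l2 volume (fun p => modWeight p ^ (-1 / 2 : ℝ) *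
      (resonantRegion j₁).indicator (output 0 F G) p) ≤
      e2 (32 - 3 / 4 * j₁ - 3 / 4 * j₂) * (normOne F * normOne G) := by
  have hR := measurableSet_resonantRegion (j₁ : ℝ)
  set S := resonantRegion (j₁ : ℝ) ∩ shellA 0
  have hS : MeasurableSet S := hR.inter (measurableSet_shellA 0)
  have hdual := l2_lconv_le_of_dual hF.meas hG.meas hS
    (fun r => and_congr neg_mem_resonantRegion neg_mem_shellA)
    (W := fun r => ‖r.2‖ₑ ^ (1 / 2 : ℝ)) (by fun_prop) (fun r => by simp)
    (K := e2 (6 + 1 / 4 * j₁ - 3 / 4 * j₂) * (normOne F * normOne G)) fun H hH hHS => by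
      rw [triForm_eq_tsum hF.meas hG.meas (by fun_prop)]
      calc _ ≤ ∑' a : ℕ, ∑' b : ℕ, e2 (6 + 1 / 4 * j₁ - 3 / 4 * j₂) *
            ((e2 ((a : ℝ) / 2) * l2 volume ((shellB a).indicator F)) *
              (e2 ((b : ℝ) / 2) * l2 volume ((shellB b).indicator G))) * l2 volume H := by
            refine ENNReal.tsum_le_tsum fun a => ENNReal.tsum_le_tsum fun b => ?_
            refine ((hF.dyadic a).bound_resonant (hG.dyadic b) hH
              (fun r hr => (hHS r hr).1.2) (fun r hr h0 => (hHS r hr).2 (by simp [h0]))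
              h₁ h₂).trans (le_of_eq ?_)
            rw [show ((a : ℝ) + b) / 2 + (6 + 1 / 4 * j₁ - 3 / 4 * j₂) =
              (6 + 1 / 4 * j₁ - 3 / 4 * j₂) + a / 2 + b / 2 by ring, e2_add, e2_add]
            ring
        _ = _ := by
          simp_rw [ENNReal.tsum_mul_right, ENNReal.tsum_mul_left, ENNReal.tsum_mul_right]
          rfl
  -- Only the lower bound 2^(2j₁ - 5) |ξ| for the modulation enters: its power -1/2 turns |ξ| into
  -- 2^(5/2 - j₁) |ξ|^(1/2).
  have hpt : ∀ p, modWeight p ^ (-1 / 2 : ℝ) * (resonantRegion j₁).indicator (output 0 F G) p ≤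
      e2 (5 / 2 - j₁) * S.indicator (fun r => ‖r.2‖ₑ ^ (1 / 2 : ℝ) * lconv F G r) p := by
    intro p
    by_cases hp : p ∈ S
    · rw [Set.indicator_of_mem hp, Set.indicator_of_mem hp.1, output, Set.indicator_of_mem hp.2]
      have hm : e2 (2 * j₁ - 5) * ‖p.2‖ₑ ≤ modWeight p := by
        rw [e2_eq_ofReal, Real.enorm_eq_ofReal_abs, ← ENNReal.ofReal_mul (by positivity)]
        exact ENNReal.ofReal_le_ofReal hp.1.2.1
      have hpos : p.2 ≠ 0 := by
        intro h0
        have := hp.1.2.2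
        rw [h0, abs_zero, mul_zero] at this
        linarith [bracket_pos (modulation p)]
      have hpos' : ‖p.2‖ₑ ≠ 0 := by simpa using hpos
      have h3 := rpow_neg_anti (s := -1 / 2) (by norm_num) hm
      rw [ENNReal.mul_rpow_of_ne_top (e2_ne_top _) (by simp), e2_rpow] at h3
      calc _ ≤ e2 ((2 * j₁ - 5) * (-1 / 2)) * ‖p.2‖ₑ ^ (-1 / 2 : ℝ) *
            (‖p.2‖ₑ * lconv F G p) := by gcongr
        _ = e2 (5 / 2 - j₁) * (‖p.2‖ₑ ^ (-1 / 2 : ℝ) * ‖p.2‖ₑ ^ (1 : ℝ) * lconv F G p) := by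
          rw [ENNReal.rpow_one, show ((2 : ℝ) * j₁ - 5) * (-1 / 2) = 5 / 2 - j₁ by ring]
          ring
        _ = _ := by
          rw [← ENNReal.rpow_add _ _ hpos' (by simp)]
          norm_num
    · have : (resonantRegion (j₁ : ℝ)).indicator (output 0 F G) p = 0 := by
        rw [output, Set.indicator_indicator]
        exact Set.indicator_of_notMem hp _
      rw [this, mul_zero]; exact zero_le
  refine (l2_mono hpt).trans ?_
  rw [l2_const_mul (e2_ne_top _)]
  calc _ ≤ e2 (5 / 2 - j₁) * (e2 (6 + 1 / 4 * j₁ - 3 / 4 * j₂) * (normOne F * normOne G)) := by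
        gcongr
    _ ≤ _ := by
      rw [← mul_assoc, ← e2_add]
      gcongr
      exact e2_mono (by linarith)

end

end Ostrovsky

end

noncomputable section

namespace Ostrovsky

/-! ### Passage to complex-valued functions -/

section

variable {f g : ℝ × ℝ → ℂ} {F G : ℝ × ℝ → ℝ≥0∞} {j j₁ j₂ : ℕ}

lemma ae_freq_ne_zero : ∀ᵐ p : ℝ × ℝ, p.2 ≠ 0 := by
  have h : ∀ᵐ x : ℝ, x ≠ 0 := Measure.ae_ne volume 0
  exact (Measure.quasiMeasurePreserving_snd (μ := (volume : Measure ℝ))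
    (ν := (volume : Measure ℝ))).ae h

/-- Passing to a measurable representative and removing the null line ξ = 0 makes the support
conditions hold everywhere, as the pointwise resonance arguments require. -/
lemma exists_shell (hf : AEStronglyMeasurable f volume)
    (hs : ∀ᵐ p : ℝ × ℝ, p ∉ shellA j → f p = 0) :
    ∃ F, Shell F j ∧ F =ᵐ[volume] fun p => ‖f p‖ₑ := by
  set S := shellA j ∩ {p : ℝ × ℝ | p.2 ≠ 0}
  have hS : MeasurableSet S :=
    (measurableSet_shellA j).inter (measurable_snd (measurableSet_singleton 0).compl)
  refine ⟨S.indicator fun p => ‖hf.mk f p‖ₑ,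
    ⟨hf.stronglyMeasurable_mk.measurable.enorm.indicator hS,
      fun p hp => (Set.indicator_apply_ne_zero.1 hp).1.1,
      fun p hp => (Set.indicator_apply_ne_zero.1 hp).1.2⟩, ?_⟩
  filter_upwards [hf.ae_eq_mk, hs, ae_freq_ne_zero] with p h1 h2 h3
  by_cases hp : p ∈ shellA j
  · rw [Set.indicator_of_mem (show p ∈ S from ⟨hp, h3⟩), h1]
  · rw [Set.indicator_of_notMem (show p ∉ S from fun h => hp h.1), h2 hp, enorm_zero]

lemma indicator_ae_eq (hf : F =ᵐ[volume] fun p => ‖f p‖ₑ) (S : Set (ℝ × ℝ)) :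
    S.indicator F =ᵐ[volume] fun p => ‖S.indicator f p‖ₑ := by
  filter_upwards [hf] with p hp
  by_cases h : p ∈ S <;> simp [h, hp]

lemma normOne_add_normSup_le (hF : Shell F j) (hf : F =ᵐ[volume] fun p => ‖f p‖ₑ) :
    normOne (regionDᶜ.indicator F) + normSup (regionD.indicator F) ≤
      e2 (3 / 4 * j + 1) * normX f := by
  have h1 := normOne_le (indicator_ae_eq hf regionDᶜ)
    (hF.indicator measurableSet_regionD.compl).memA
  have h2 := normSup_le (indicator_ae_eq hf regionD) (hF.indicator measurableSet_regionD).memA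
  refine (add_le_add h1 h2).trans ?_
  rw [← mul_add, normX]
  gcongr
  exact e2_mono (by linarith)

lemma normSup_le_normX (hF : Shell F j) (hf : F =ᵐ[volume] fun p => ‖f p‖ₑ) :
    normSup F ≤ e2 (3 / 4 * j + 1) * normX f := by
  refine le_trans ?_ (normOne_add_normSup_le hF hf)
  have hD := measurableSet_regionD
  have : F = fun p => regionDᶜ.indicator F p + regionD.indicator F p := by
    ext p
    by_cases hp : p ∈ regionD <;> simp [hp]
  calc normSup F = normSup fun p => regionDᶜ.indicator F p + regionD.indicator F p := by
        rw [← this]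
    _ ≤ _ := (normSup_add_le (hF.indicator hD.compl).meas (hF.indicator hD).meas).trans
      (by gcongr; exact normSup_le_normOne)

/-- D lies in |ξ| ≤ 1/8, hence meets only the shell with j = 0. For j ≥ 1 the norm of the function
is the ℓ¹-based one. -/
lemma normOne_le_normX (hF : Shell F j) (hf : F =ᵐ[volume] fun p => ‖f p‖ₑ) (hj : 1 ≤ j) :
    normOne F ≤ e2 (3 / 4 * j + 1) * normX f := by
  refine le_trans ?_ (normOne_add_normSup_le hF hf)
  have : regionDᶜ.indicator F = F := by
    ext p
    by_cases hp : p ∈ regionD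
    · have : F p = 0 := by
        by_contra h
        have h1 := le_abs_freq (hF.memA p h)
        have h2 : (2 : ℝ) ^ 1 ≤ 2 ^ j := pow_le_pow_right₀ (by norm_num) hj
        have h3 := hp.1
        norm_num at h2
        linarith
      simp [hp, this]
    · simp [hp]
  rw [this]
  exact le_self_add

lemma l2_le_normXsb (hF : Shell F j) (hf : F =ᵐ[volume] fun p => ‖f p‖ₑ) :
    l2 volume F ≤ e2 (3 / 4 * (j + 1)) * normXsb (-3 / 4) (1 / 2) f := by
  rw [normXsb, eLpNorm_two_eq_l2, ← l2_const_mul (e2_ne_top _)]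
  have h1 : F =ᵐ[volume] (shellA j).indicator fun p => ‖f p‖ₑ := by
    filter_upwards [hf] with p hp
    by_cases h : p ∈ shellA j
    · simp [h, hp]
    · have : F p = 0 := by
        by_contra h'
        exact h (hF.memA p h')
      simp [h, this]
  rw [l2_congr h1]
  refine l2_mono fun p => ?_
  by_cases hp : p ∈ shellA j
  · rw [Set.indicator_of_mem hp, enorm_weighted]
    have a1 : e2 (-(3 / 4 * ((j : ℝ) + 1))) ≤ freqWeight p ^ (-3 / 4 : ℝ) := by
      have := rpow_neg_anti (s := -3 / 4) (by norm_num) (freqWeight_le hp)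
      rw [e2_rpow] at this
      convert this using 2; ring
    have a2 : 1 ≤ modWeight p ^ (1 / 2 : ℝ) := by
      apply ENNReal.one_le_rpow _ (by norm_num)
      rw [modWeight, ← ENNReal.ofReal_one]
      exact ENNReal.ofReal_le_ofReal (one_le_bracket _)
    apply le_e2_mul
    calc _ ≤ freqWeight p ^ (-3 / 4 : ℝ) * 1 * ‖f p‖ₑ := by rw [mul_one]; gcongr
      _ ≤ _ := by gcongr
  · rw [Set.indicator_of_notMem hp]; exact zero_le

lemma l2_le_normOne {V : ℝ × ℝ → ℝ≥0∞} (hV : Measurable V) : l2 volume V ≤ normOne V := by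
  have : V = fun p => ∑' k : ℕ, (shellB k).indicator V p := by
    ext p; rw [tsum_indicator_shellB]
  conv_lhs => rw [this]
  refine (l2_tsum_le fun k => hV.indicator (measurableSet_shellB k)).trans
    (ENNReal.tsum_le_tsum fun k => ?_)
  calc _ = e2 0 * l2 volume ((shellB k).indicator V) := by rw [e2_zero, one_mul]
    _ ≤ _ := by
      gcongr
      exact e2_mono (by positivity)

lemma memLp_two (hm : AEStronglyMeasurable f volume)
    (hs : ∀ᵐ p : ℝ × ℝ, p ∉ shellA j → f p = 0) (h : normX f < ∞) : MemLp f 2 volume := by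
  refine ⟨hm, ?_⟩
  obtain ⟨F, hF, hf⟩ := exists_shell hm hs
  have hD := measurableSet_regionD
  have hX := ENNReal.add_lt_top.1 h
  rw [eLpNorm_two_eq_l2, ← l2_congr hf]
  have hsplit : F = fun p => regionDᶜ.indicator F p + regionD.indicator F p := by
    ext p
    by_cases hp : p ∈ regionD <;> simp [hp]
  rw [hsplit]
  refine (l2_add_le (hF.indicator hD.compl).meas (hF.indicator hD).meas).trans_lt
    (ENNReal.add_lt_top.2 ⟨?_, ?_⟩)
  · refine (l2_le_normOne (hF.indicator hD.compl).meas).trans_lt ?_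
    exact (normOne_le (indicator_ae_eq hf _) (hF.indicator hD.compl).memA).trans_lt
      (ENNReal.mul_lt_top (e2_ne_top _).lt_top hX.1)
  · exact (l2_le_normXsb (hF.indicator hD) (indicator_ae_eq hf _)).trans_lt
      (ENNReal.mul_lt_top (e2_ne_top _).lt_top hX.2)

/-- Both factors are in L², so Cauchy-Schwarz gives absolute convergence at every point, not merely
almost everywhere. -/
lemma convolutionExistsAt (hf : MemLp f 2 volume) (hg : MemLp g 2 volume) (p : ℝ × ℝ) :
    ConvolutionExistsAt f g p (ContinuousLinearMap.mul ℝ ℂ) volume := by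
  have hg' : MemLp (fun t => g (p - t)) 2 volume :=
    hg.comp_measurePreserving (Measure.measurePreserving_sub_left volume p)
  exact hf.integrable_mul hg'

/-- No integrability is required: where the defining integral diverges, the Bochner integral is 0
and the inequality is trivial. Hence the final estimates also cover infinite input norms. -/
lemma enorm_conv_le (hf : F =ᵐ[volume] fun p => ‖f p‖ₑ) (hg : G =ᵐ[volume] fun p => ‖g p‖ₑ)
    (p : ℝ × ℝ) : ‖conv f g p‖ₑ ≤ lconv F G p := by
  have hg' := (quasiMeasurePreserving_sub_left volume p).ae_eq_comp hg
  calc ‖conv f g p‖ₑ ≤ ∫⁻ t, ‖f t * g (p - t)‖ₑ := enorm_integral_le_lintegral_enorm _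
    _ = lconv F G p := by
      refine lintegral_congr_ae ?_
      filter_upwards [hf, hg'] with t h1 h2
      simp only [Function.comp_apply] at h2
      rw [enorm_mul, h1, h2]

lemma enorm_localized_le (hf : F =ᵐ[volume] fun p => ‖f p‖ₑ)
    (hg : G =ᵐ[volume] fun p => ‖g p‖ₑ) (p : ℝ × ℝ) :
    ‖localized j f g p‖ₑ ≤ (modWeight p)⁻¹ * output j F G p := by
  by_cases hp : p ∈ shellA j
  · rw [localized, output, Set.indicator_of_mem hp, Set.indicator_of_mem hp, enorm_mul,
      ← mul_assoc]
    refine mul_le_mul' (le_of_eq ?_) (enorm_conv_le hf hg p)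
    rw [modWeight, ← ENNReal.ofReal_inv_of_pos (bracket_pos _), Real.enorm_eq_ofReal_abs,
      ← ENNReal.ofReal_mul (inv_nonneg.2 (bracket_pos _).le), ← ofReal_norm, Complex.norm_real,
      Real.norm_eq_abs, abs_mul, abs_of_nonneg (inv_nonneg.2 (bracket_pos _).le)]
  · simp [localized, hp]

/-- The two output norms are controlled by the dyadic norms of the pieces of the output. -/
lemma norms_localized_le (hf : F =ᵐ[volume] fun p => ‖f p‖ₑ)
    (hg : G =ᵐ[volume] fun p => ‖g p‖ₑ) {U₁ U₂ : ℝ × ℝ → ℝ≥0∞} (h₁ : Measurable U₁)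
    (h₂ : Measurable U₂) (hU : ∀ p, output j F G p ≤ U₁ p + U₂ p) {n : ℝ}
    (hn : ∀ p, U₂ p ≠ 0 → p ∈ resonantRegion n) {x : ℝ} {N : ℝ≥0∞}
    (b₁ : normDual U₁ ≤ e2 (x + 3 / 4 * j) * N)
    (b₂ : l2 volume (fun p => modWeight p ^ (-1 / 2 : ℝ) * U₂ p) ≤ e2 (x + 3 / 4 * j) * N) :
    normX (localized j f g) ≤ e2 (x + 9) * N ∧
      normL2L1 (fun p => ((bracket p.2 ^ (-3 / 4 : ℝ) : ℝ) : ℂ) * localized j f g p) ≤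
        e2 (x + 9) * N := by
  have hsupp : ∀ p, localized j f g p ≠ 0 → p ∈ shellA j := fun p hp =>
    (Set.indicator_apply_ne_zero.1 hp).1
  have hb : ∀ p, ‖localized j f g p‖ₑ ≤ (modWeight p)⁻¹ * (U₁ p + U₂ p) := fun p =>
    (enorm_localized_le hf hg p).trans (by gcongr; exact hU p)
  have key : ∀ c : ℝ, c ≤ 8 → e2 (-(3 / 4) * j) * (e2 1 * normDual U₁ +
      e2 c * l2 volume fun p => modWeight p ^ (-1 / 2 : ℝ) * U₂ p) ≤ e2 (x + 9) * N := by
    intro c hc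
    calc _ ≤ e2 (-(3 / 4) * j) * (e2 8 * (e2 (x + 3 / 4 * j) * N) +
          e2 8 * (e2 (x + 3 / 4 * j) * N)) := by
          gcongr
          · exact e2_mono (by norm_num)
          · exact e2_mono hc
      _ = e2 (-(3 / 4) * j) * (e2 8 + e2 8) * e2 (x + 3 / 4 * j) * N := by ring
      _ = _ := by
        rw [← e2_add_one, ← e2_add, ← e2_add]
        congr 2; ring
  constructor
  · refine (normX_le hsupp h₁ h₂ hb fun p hp => (hn p hp).1).trans ?_
    have := key 0 (by norm_num)
    rwa [e2_zero, one_mul] at this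
  · refine (normL2L1_le hsupp h₁ h₂ hb (measurableSet_resonantRegion n) hn
      (lintegral_fiber_resonantRegion_le n)).trans (key _ (by norm_num))

lemma norms_localized_le_of_normDual (hF : Measurable F) (hG : Measurable G)
    (hf : F =ᵐ[volume] fun p => ‖f p‖ₑ) (hg : G =ᵐ[volume] fun p => ‖g p‖ₑ) {x : ℝ} {N : ℝ≥0∞}
    (b : normDual (output j F G) ≤ e2 (x + 3 / 4 * j) * N) :
    normX (localized j f g) ≤ e2 (x + 9) * N ∧
      normL2L1 (fun p => ((bracket p.2 ^ (-3 / 4 : ℝ) : ℝ) : ℂ) * localized j f g p) ≤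
        e2 (x + 9) * N :=
  norms_localized_le (n := 0) hf hg (measurable_output hF hG) (measurable_const (a := 0))
    (fun p => by simp) (fun p hp => (hp rfl).elim) b (by simp [l2])

/-- Bookkeeping of the constants. -/
lemma le_const_mul {X M₁ M₂ N₁ N₂ : ℝ≥0∞} {x y : ℝ} (hX : X ≤ e2 (x + 9) * (N₁ * N₂))
    (h₁ : N₁ ≤ e2 (3 / 4 * j₁ + 1) * M₁) (h₂ : N₂ ≤ e2 (3 / 4 * j₂ + 1) * M₂)
    (hxy : x + 3 / 4 * j₁ + 3 / 4 * j₂ ≤ 180 + y) :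
    X ≤ ENNReal.ofReal ((2 : ℝ) ^ (200 : ℝ) * (2 : ℝ) ^ y) * M₁ * M₂ := by
  rw [← Real.rpow_add (by norm_num), ← e2_eq_ofReal]
  calc X ≤ e2 (x + 9) * ((e2 (3 / 4 * j₁ + 1) * M₁) * (e2 (3 / 4 * j₂ + 1) * M₂)) :=
        hX.trans (by gcongr)
    _ = e2 (x + 9) * e2 (3 / 4 * j₁ + 1) * e2 (3 / 4 * j₂ + 1) * M₁ * M₂ := by ring
    _ ≤ _ := by
      rw [← e2_add, ← e2_add]
      gcongr
      exact e2_mono (by linarith)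

end

lemma abs_cast_sub_le {a b : ℕ} {m : ℤ} (h : |(a : ℤ) - b| ≤ m) : |(a : ℝ) - b| ≤ m := by
  have : ((|(a : ℤ) - b| : ℤ) : ℝ) ≤ m := by exact_mod_cast h
  simpa using this

/-- The bilinear estimates in terms of the majorants. -/
lemma localized_bounds {f g : ℝ × ℝ → ℂ} {F G : ℝ × ℝ → ℝ≥0∞} {j j₁ j₂ : ℕ} {c : ℝ}
    (hF : Shell F j₁) (hG : Shell G j₂) (hf : F =ᵐ[volume] fun p => ‖f p‖ₑ)
    (hg : G =ᵐ[volume] fun p => ‖g p‖ₑ) (hc : InteractionSize j j₁ j₂ c) :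
    normX (localized j f g) ≤
        ENNReal.ofReal ((2 : ℝ) ^ (200 : ℝ) * c) * normX f * normX g ∧
      normL2L1 (fun p => ((bracket p.2 ^ (-3 / 4 : ℝ) : ℝ) : ℂ) * localized j f g p) ≤
        ENNReal.ofReal ((2 : ℝ) ^ (200 : ℝ) * c) * normX f * normX g := by
  have oF := normOne_le_normX hF hf
  have oG := normOne_le_normX hG hg
  have reduce : ∀ {N₁ N₂ : ℝ≥0∞} {x y : ℝ},
      normDual (output j F G) ≤ e2 (x + 3 / 4 * j) * (N₁ * N₂) →
      N₁ ≤ e2 (3 / 4 * j₁ + 1) * normX f → N₂ ≤ e2 (3 / 4 * j₂ + 1) * normX g → c = 2 ^ y →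
      x + 3 / 4 * j₁ + 3 / 4 * j₂ ≤ 180 + y →
      normX (localized j f g) ≤
        ENNReal.ofReal ((2 : ℝ) ^ (200 : ℝ) * c) * normX f * normX g ∧
      normL2L1 (fun p => ((bracket p.2 ^ (-3 / 4 : ℝ) : ℝ) : ℂ) * localized j f g p) ≤
        ENNReal.ofReal ((2 : ℝ) ^ (200 : ℝ) * c) * normX f * normX g := by
    rintro N₁ N₂ x y h h₁ h₂ rfl hxy
    obtain ⟨a, b⟩ := norms_localized_le_of_normDual hF.meas hG.meas hf hg h
    exact ⟨le_const_mul a h₁ h₂ hxy, le_const_mul b h₁ h₂ hxy⟩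
  have one : (1 : ℝ) = 2 ^ (0 : ℝ) := (Real.rpow_zero 2).symm
  rcases hc with ⟨h, hc⟩ | ⟨h₁, h₂, h₃, h₄, h₅, hc⟩ | ⟨h₁, h₂, h₃, h₄, h₅, hc⟩ |
    ⟨h₁, h₂, h₃, h₄, h₅, hc⟩ | ⟨h₁, h₂, h₃, h₄, h₅, hc⟩ | ⟨h₁, h₂, h₃, hc⟩ |
    ⟨h₁, h₂, h₃, hc⟩ | ⟨h₁, h₂, h₃, hc⟩
  · exact reduce (x := 162 - 3 / 4 * j₁ - 3 / 4 * j₂)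
      ((normDual_output_low hF hG h).trans (by gcongr; exact e2_mono (by linarith)))
      (normSup_le_normX hF hf) (normSup_le_normX hG hg) (hc.trans one) (by linarith)
  · have h₃' := abs_le.1 (abs_cast_sub_le h₃)
    push_cast at h₃'
    -- In each case x is the exponent of the dyadic bound plus the cost of summing over k, here 21 +
    -- 7, minus the 3j/4 regained from the output weight. Adding the input weights 3j₁/4 + 3j₂/4
    -- must give the exponent of c up to a constant.
    exact reduce (x := 28 - 3 / 8 * j - 3 / 2 * j₁)
      ((normDual_output_le hF hG (tsum_e2_min_peak (2 * j₁ + j)) fun a b k H hH =>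
        (hF.dyadic a).bound_highHigh (hG.dyadic b) hH h₁ h₄ (by omega)).trans
          (by gcongr; exact e2_mono (by linarith)))
      (oF (by omega)) (oG (by omega)) hc (by linarith)
  · have h₃' := abs_le.1 (abs_cast_sub_le h₃)
    push_cast at h₃'
    exact reduce (x := 28 - j - 1 / 2 * j₂)
      ((normDual_output_le hF hG (tsum_e2_min_peak (2 * j + j₂)) fun a b k H hH =>
        (hF.dyadic a).bound_highLow (hG.dyadic b) hH h₁ h₄ (by omega)).trans
          (by gcongr; exact e2_mono (by linarith)))
      (oF (by omega)) (oG (by omega)) hc (by linarith)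
  · have h₃' := abs_le.1 (abs_cast_sub_le h₃)
    push_cast at h₃'
    have b := normDual_output_le hG hF (tsum_e2_min_peak (2 * j + j₁)) fun a b k H hH =>
      (hG.dyadic a).bound_highLow (hF.dyadic b) hH h₁ h₄ (by omega)
    rw [output_comm, mul_comm (normOne G)] at b
    exact reduce (x := 28 - j - 1 / 2 * j₁)
      (b.trans (by gcongr; exact e2_mono (by linarith)))
      (oF (by omega)) (oG (by omega)) hc (by linarith)
  · have h₄' := abs_cast_sub_le h₄
    have h₅' := abs_cast_sub_le h₅
    push_cast at h₄' h₅'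
    have h₄'' := abs_le.1 h₄'
    have h₅'' := abs_le.1 h₅'
    exact reduce (x := 38 - 3 / 2 * j)
      ((normDual_output_le hF hG (tsum_e2_min_peak (3 * j)) fun a b k H hH =>
        (hF.dyadic a).bound_comparable (hG.dyadic b) hH h₁ h₄' h₅').trans
          (by gcongr; exact e2_mono (by linarith)))
      (oF (by omega)) (oG (by omega)) (hc.trans one) (by linarith)
  · subst h₃
    have hR := measurableSet_resonantRegion (j₁ : ℝ)
    have hm := measurable_output (j := 0) hF.meas hG.meas
    -- The only case with a nonzero second piece: the resonant part of the output is controlled in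
    -- the ℓ² norm, the rest in the ℓ¹ norm.
    obtain ⟨a, b⟩ := norms_localized_le (j := 0) hf hg (hm.indicator hR.compl) (hm.indicator hR)
      (fun p => le_of_eq (by by_cases hp : p ∈ resonantRegion (j₁ : ℝ) <;> simp [hp]))
      (fun p hp => (Set.indicator_apply_ne_zero.1 hp).1)
      (x := 32 - 3 / 4 * j₁ - 3 / 4 * j₂) (N := normOne F * normOne G)
      (by simpa using normDual_output_nonresonant hF hG h₁ h₂)
      (by simpa using l2_output_resonant hF hG h₁ h₂)
    rw [hc, one]
    exact ⟨le_const_mul a (oF (by omega)) (oG (by omega)) (by linarith),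
      le_const_mul b (oF (by omega)) (oG (by omega)) (by linarith)⟩
  · subst h₃
    exact reduce (x := 37 - 3 / 4 * j₁)
      ((normDual_output_highVeryLow hF hG h₁ h₂).trans (by gcongr; exact e2_mono (by linarith)))
      (oF (by omega)) (normOne_add_normSup_le hG hg) (hc.trans one) (by norm_num)
  · subst h₃
    have b := normDual_output_highVeryLow hG hF h₁ h₂
    rw [output_comm, mul_comm (normOne G)] at b
    exact reduce (x := 37 - 3 / 4 * j₂)
      (b.trans (by gcongr; exact e2_mono (by linarith)))
      (normOne_add_normSup_le hF hf) (oG (by omega)) (hc.trans one) (by norm_num)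

end Ostrovsky

end

/-! ### Absolute convergence and the bilinear bounds for complex functions -/

theorem lemma3p1 :
    ∃ C : ℝ, 0 < C ∧
      ∀ (j₁ j₂ : ℕ) (f g : ℝ × ℝ → ℂ),
        AEStronglyMeasurable f volume → AEStronglyMeasurable g volume →
        (∀ᵐ p : ℝ × ℝ, p ∉ Ostrovsky.shellA j₁ → f p = 0) →
        (∀ᵐ p : ℝ × ℝ, p ∉ Ostrovsky.shellA j₂ → g p = 0) →
        -- `f * g` is given by an absolutely convergent integral almost everywhere
        (Ostrovsky.normX f < ∞ → Ostrovsky.normX g < ∞ →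
          ∀ᵐ p : ℝ × ℝ,
            ConvolutionExistsAt f g p (ContinuousLinearMap.mul ℝ ℂ) volume) ∧
        ∀ (j : ℕ) (c : ℝ), Ostrovsky.InteractionSize j j₁ j₂ c →
          Ostrovsky.normX (Ostrovsky.localized j f g) ≤
              ENNReal.ofReal (C * c) * Ostrovsky.normX f * Ostrovsky.normX g ∧
          Ostrovsky.normL2L1
              (fun p => ((Ostrovsky.bracket p.2 ^ (-3 / 4 : ℝ) : ℝ) : ℂ) *
                Ostrovsky.localized j f g p) ≤
              ENNReal.ofReal (C * c) * Ostrovsky.normX f * Ostrovsky.normX g := by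
  -- The cases need at most the exponent 180; the output norms add 9 and the two input norms 1 each,
  -- so 200 is a convenient round bound.
  refine ⟨(2 : ℝ) ^ (200 : ℝ), by positivity, fun j₁ j₂ f g hf hg hfs hgs => ⟨?_, ?_⟩⟩
  · intro hfX hgX
    exact Filter.Eventually.of_forall fun p => Ostrovsky.convolutionExistsAt
      (Ostrovsky.memLp_two hf hfs hfX) (Ostrovsky.memLp_two hg hgs hgX) p
  · intro j c hc
    obtain ⟨F, hF, hfF⟩ := Ostrovsky.exists_shell hf hfs
    obtain ⟨G, hG, hgG⟩ := Ostrovsky.exists_shell hg hgs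
    exact Ostrovsky.localized_bounds hF hG hfF hgG hc
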